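/- Let $n\ge 1$, let $\beta\in\{1,2,4\}$, and let $\mathbb H_{n,\beta}$ be the Euclidean space of $n\times n$ self-adjoint matrices over $\mathbb R$, $\mathbb C$ or the quaternions, respectively, with $\langle x|y\rangle=\Re\operatorname{tr}(xy)$. Let $\mathcal K_{n,\beta}$ be the orthogonal, unitary or symplectic group, respectively. An *ensemble* is a probability law on $\mathbb H_{n,\beta}$ that is invariant under $x\mapsto UxU^*$ for all $U\in\mathcal K_{n,\beta}$. Let $\Psi$ be the linear map on symmetric endomorphisms of $\mathbb H_{n,\beta}$ with $\Psi(y\otimes y)(h)=yhy$ for all $y,h$, where $(y\otimes y)(h)=\langle y|h\rangle y$. Let $\mathbf X$ have law $\mu$, an ensemble, and put $L(\theta)=\mathbb E\,e^{\langle\theta|\mathbf X\rangle}$, $k=\log L$ and $\Theta=\operatorname{int}\{L<\infty\}$. Assume $\Theta\neq\emptyset$. For $\theta\in\mathbb H_{n,\beta}$ let $\sigma_j(\theta)$ be the $j$-th elementary symmetric function of the eigenvalues of $\theta$ ($\sigma_0=1$, and $\sigma_j=0$ for $j<0$ and $j>n$). Let $U_{\mathbf X}\subset\mathbb R^n$ be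 the set of all $(\sigma_1(\theta),\dots,\sigma_n(\theta))$ with $\theta\in\Theta$ real diagonal with distinct diagonal entries. Then $U_{\mathbf X}$ is open and has $0$ in its closure. For $g:U_{\mathbf X}\to\mathbb R$ write $g_r=\partial g/\partial\sigma_r$, $g_{rs}=\partial^2g/\partial\sigma_r\partial\sigma_s$, and let $\mathbb D(g)$ be the vector with components, for $j=1,\dots,n$, $$\mathbb D(g)_j=\sum_{r,s=1}^{j}\sigma_{r+s-1-j}\,g_{rs}-\sum_{r,s=j+1}^{n}\sigma_{r+s-1-j}\,g_{rs}-(n-j)\frac{\beta}{2}\,g_{j+1}$$ (for $j=n$ the last two terms are absent). For real $a,b$ consider the following three cases. In each of them $g:U_{\mathbf X}\to\mathbb R$ is the function given by the formula for $g(\sigma_1(\theta),\dots,\sigma_n(\theta))$, for all $\theta\in\Theta$ with distinct eigenvalues. (i) $a\ne0$: $g(\sigma_1(\theta),\dots,\sigma_n(\theta))=\exp(-4a\,k(\theta)-b\operatorname{tr}\theta)$, with system $\mathbb D(g)=((b^2-4a)g,0,\dots,0)^T$ and limits $g\to1$, $g_1\to-b$. (ii) $a=0$, $b\neq0$: $g(\sigma_1(\theta),\dots,\sigma_n(\theta))=k(\theta)+\frac1{2b}\operatorname{tr}\theta$,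 with system $\mathbb D(g)=2b\,(g_1,\dots,g_n)^T$ and limits $g\to0$, $g_1\to\frac1{2b}$. (iii) $a=b=0$: $g(\sigma_1(\theta),\dots,\sigma_n(\theta))=k(\theta)$, with system $\mathbb D(g)=(1,0,\dots,0)^T$ and limits $g\to0$, $g_1\to0$. All limits are taken as $(\sigma_1,\dots,\sigma_n)\to0$ within $U_{\mathbf X}$. For $a\ne-\frac12$, we say that $\mu$ is *Meixner with parameters $a,b$* if it is an ensemble with second moments and, for independent $\mathbf X,\mathbf Y$ of law $\mu$ and $\mathbf S=\mathbf X+\mathbf Y$, $$\mathbb E\big((\mathbf X-\mathbf Y)^2\,\big|\,\mathbf S\big)=\frac{2}{1+2a}\left(\mathbf I_n+b\mathbf S+a\mathbf S^2\right).$$ **Direct part.** Suppose that $\mathbb E\mathbf X=0$, $\mathbb E\mathbf X^2=\mathbf I_n$, and that $\mu$ is Meixner with parameters $a,b$, $a\neq-\frac12$. Then, in the case that applies to $(a,b)$, the function $g$ is well defined and twice continuously differentiable on $U_{\mathbf X}$, satisfies the system on $U_{\mathbf X}$, and has the stated limits. **Converse part.** Suppose that for some real $a,b$ the function $g$ of the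 case that applies to $(a,b)$ satisfies its system on $U_{\mathbf X}$. Then $$\Psi(k''(\theta))(\mathbf I_n)=\mathbf I_n+2b\,k'(\theta)+4a\,(k'(\theta))^2\qquad\text{for all }\theta\in\Theta,$$ where $k'$ is the gradient and $k''$ the Hessian of $k$, and if $a\ne-\frac12$ then $\mu$ is Meixner with parameters $a,b$. If $g$ also has the limits of that case, then $\mathbb E\mathbf X=0$ and $\mathbb E\mathbf X^2=\mathbf I_n$. -/

import Mathlib

open MeasureTheory Filter Topology

namespace MeixnerEnsemble

/-- The three Peirce constants `β = 1, 2, 4`. -/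
inductive Peirce
  | one
  | two
  | four

namespace Peirce

/-- The Peirce constant as a real number. -/
def val : Peirce → ℝ
  | one => 1
  | two => 2
  | four => 4

/-- The scalars: real numbers, complex numbers, quaternions. -/
def Scalar : Peirce → Type
  | one => ℝ
  | two => ℂ
  | four => Quaternion ℝ

noncomputable instance instDivisionRing : (β : Peirce) → DivisionRing β.Scalar
  | one => inferInstanceAs (DivisionRing ℝ)
  | two => inferInstanceAs (DivisionRing ℂ)
  | four => inferInstanceAs (DivisionRing (Quaternion ℝ))

noncomputable instance instStarRing : (β : Peirce) → StarRing β.Scalar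
  | one => inferInstanceAs (StarRing ℝ)
  | two => inferInstanceAs (StarRing ℂ)
  | four => inferInstanceAs (StarRing (Quaternion ℝ))

noncomputable instance instAlgebra : (β : Peirce) → Algebra ℝ β.Scalar
  | one => inferInstanceAs (Algebra ℝ ℝ)
  | two => inferInstanceAs (Algebra ℝ ℂ)
  | four => inferInstanceAs (Algebra ℝ (Quaternion ℝ))

instance instStarModule : (β : Peirce) → StarModule ℝ β.Scalar
  | one => inferInstanceAs (StarModule ℝ ℝ)
  | two => inferInstanceAs (StarModule ℝ ℂ)
  | four => ⟨fun r x => Quaternion.star_smul r x⟩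

instance instFinite : (β : Peirce) → Module.Finite ℝ β.Scalar
  | one => inferInstanceAs (Module.Finite ℝ ℝ)
  | two => inferInstanceAs (Module.Finite ℝ ℂ)
  | four => inferInstanceAs (Module.Finite ℝ (Quaternion ℝ))

/-- Real part of a scalar. -/
def re : (β : Peirce) → β.Scalar →ₗ[ℝ] ℝ
  | one => (LinearMap.id : ℝ →ₗ[ℝ] ℝ)
  | two => Complex.reLm
  | four => QuaternionAlgebra.reₗ (-1 : ℝ) 0 (-1)

theorem re_star (β : Peirce) (x : β.Scalar) : β.re (star x) = β.re x := by
  cases β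
  · rfl
  · exact Complex.conj_re x
  · exact Quaternion.re_star x

theorem re_mul_comm (β : Peirce) (x y : β.Scalar) : β.re (x * y) = β.re (y * x) := by
  cases β
  · exact mul_comm (G := ℝ) x y
  · exact congrArg Complex.re (mul_comm (G := ℂ) x y)
  · have h : ∀ x y : Quaternion ℝ, (x * y).re = (y * x).re := fun x y => by
      simp only [Quaternion.re_mul]
      ring
    exact h x y

theorem re_mul_star_nonneg (β : Peirce) (x : β.Scalar) : 0 ≤ β.re (x * star x) := by
  cases β
  · exact mul_self_nonneg (R := ℝ) x
  · have h : ∀ x : ℂ, 0 ≤ (x * (starRingEnd ℂ) x).re := fun x => by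
      rw [Complex.mul_conj]
      exact Complex.normSq_nonneg x
    exact h x
  · exact Quaternion.normSq_nonneg (R := ℝ)

theorem eq_zero_of_re_mul_star (β : Peirce) (x : β.Scalar) (h : β.re (x * star x) = 0) :
    x = 0 := by
  cases β
  · exact mul_self_eq_zero.1 (show (x : ℝ) * x = 0 from h)
  · have h' : ∀ x : ℂ, (x * (starRingEnd ℂ) x).re = 0 → x = 0 := fun x hx => by
      rw [Complex.mul_conj] at hx
      exact Complex.normSq_eq_zero.1 hx
    exact h' x h
  · exact Quaternion.normSq_eq_zero.1 (show Quaternion.normSq (x : Quaternion ℝ) = 0 from h)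

end Peirce

/-- The real vector space of `n × n` self-adjoint matrices over the scalars attached to `β`. -/
def Herm (β : Peirce) (n : ℕ) : Type :=
  selfAdjoint (Matrix (Fin n) (Fin n) β.Scalar)

namespace Herm

variable {β : Peirce} {n : ℕ}

noncomputable instance : AddCommGroup (Herm β n) :=
  inferInstanceAs (AddCommGroup (selfAdjoint (Matrix (Fin n) (Fin n) β.Scalar)))

noncomputable instance : Module ℝ (Herm β n) :=
  inferInstanceAs (Module ℝ (selfAdjoint (Matrix (Fin n) (Fin n) β.Scalar)))

/-- The underlying matrix. -/
def mat (x : Herm β n) : Matrix (Fin n) (Fin n) β.Scalar := x.1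

/-- The underlying matrix, as a real linear map. -/
def matL : Herm β n →ₗ[ℝ] Matrix (Fin n) (Fin n) β.Scalar where
  toFun := mat
  map_add' _ _ := rfl
  map_smul' _ _ := rfl

theorem mat_injective : Function.Injective (mat : Herm β n → _) := Subtype.val_injective

@[simp] theorem mat_add (x y : Herm β n) : (x + y).mat = x.mat + y.mat := rfl

@[simp] theorem mat_smul (c : ℝ) (x : Herm β n) : (c • x).mat = c • x.mat := rfl

@[simp] theorem star_mat (x : Herm β n) : star x.mat = x.mat := x.2

instance : FiniteDimensional ℝ (Herm β n) :=
  FiniteDimensional.of_injective (matL : Herm β n →ₗ[ℝ] _) mat_injective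

/-- Real part of the trace of a matrix. -/
noncomputable def reTr (x : Matrix (Fin n) (Fin n) β.Scalar) : ℝ := β.re x.trace

/-- The Euclidean structure `⟨x | y⟩ = Re tr (x y)`. -/
noncomputable abbrev core : InnerProductSpace.Core ℝ (Herm β n) where
  inner x y := reTr (x.mat * y.mat)
  conj_inner_symm x y := by
    simp only [reTr, Matrix.trace, Matrix.diag, Matrix.mul_apply, map_sum, conj_trivial]
    rw [Finset.sum_comm]
    simp_rw [β.re_mul_comm]
  re_inner_nonneg x := by
    change 0 ≤ reTr (x.mat * x.mat)
    nth_rewrite 2 [← star_mat x]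
    simp only [reTr, Matrix.trace, Matrix.diag, Matrix.mul_apply, map_sum, Matrix.star_apply]
    exact Finset.sum_nonneg fun i _ => Finset.sum_nonneg fun j _ => β.re_mul_star_nonneg _
  add_left x y z := by simp [reTr, add_mul]
  smul_left x y r := by simp [reTr]
  definite x h := by
    change reTr (x.mat * x.mat) = 0 at h
    nth_rewrite 2 [← star_mat x] at h
    simp only [reTr, Matrix.trace, Matrix.diag, Matrix.mul_apply, map_sum,
      Matrix.star_apply] at h
    apply mat_injective
    ext i j
    have h1 := (Finset.sum_eq_zero_iff_of_nonneg
      (fun i _ => Finset.sum_nonneg fun j _ => β.re_mul_star_nonneg _)).1 h i (Finset.mem_univ _)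
    have h2 := (Finset.sum_eq_zero_iff_of_nonneg
      (fun j _ => β.re_mul_star_nonneg _)).1 h1 j (Finset.mem_univ _)
    exact β.eq_zero_of_re_mul_star _ h2

noncomputable instance : NormedAddCommGroup (Herm β n) :=
  (core (β := β) (n := n)).toNormedAddCommGroup

noncomputable instance : InnerProductSpace ℝ (Herm β n) :=
  InnerProductSpace.ofCore (core (β := β) (n := n)).toCore

noncomputable instance : CompleteSpace (Herm β n) := FiniteDimensional.complete ℝ _

noncomputable instance : MeasurableSpace (Herm β n) := borel _

instance : BorelSpace (Herm β n) := ⟨rfl⟩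

theorem inner_def (x y : Herm β n) : inner ℝ x y = reTr (x.mat * y.mat) := rfl

/-- The identity matrix. -/
noncomputable instance : One (Herm β n) := ⟨⟨1, star_one _⟩⟩

/-- The trace of a self-adjoint matrix (a real number). -/
noncomputable def tr (x : Herm β n) : ℝ := reTr x.mat

/-- The square `x²`. -/
noncomputable def sq (x : Herm β n) : Herm β n :=
  ⟨x.mat * x.mat, (star_mul x.mat x.mat).trans (by rw [star_mat])⟩

/-- Conjugation `x ↦ U x U*`. -/
noncomputable def conj (U : Matrix (Fin n) (Fin n) β.Scalar) (x : Herm β n) : Herm β n :=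
  ⟨U * x.mat * star U, by
    rw [selfAdjoint.mem_iff, star_mul, star_mul, star_star, star_mat, mul_assoc]⟩

/-- The real diagonal matrix with diagonal `v`. -/
noncomputable def diag (v : Fin n → ℝ) : Herm β n :=
  ⟨Matrix.diagonal fun i => algebraMap ℝ β.Scalar (v i), by
    rw [selfAdjoint.mem_iff, Matrix.star_eq_conjTranspose, Matrix.diagonal_conjTranspose]
    congr 1
    funext i
    exact (algebraMap_star_comm (v i)).symm⟩

/-- `v` lists the eigenvalues of `x` with multiplicity: `x = U diag(v) U*` with `U` in the
orthogonal (`β = 1`), unitary (`β = 2`) or symplectic (`β = 4`) group. -/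
def HasEigenvalues (x : Herm β n) (v : Fin n → ℝ) : Prop :=
  ∃ U ∈ unitary (Matrix (Fin n) (Fin n) β.Scalar), x = conj U (diag v)

/-- The symmetrized product `(x h y + y h x) / 2`. -/
noncomputable def triple (x h y : Herm β n) : Herm β n :=
  ⟨(2⁻¹ : ℝ) • (x.mat * h.mat * y.mat + y.mat * h.mat * x.mat), by
    rw [selfAdjoint.mem_iff]
    simp only [star_smul, star_add, star_mul, star_mat, star_trivial, mul_assoc]
    rw [add_comm]⟩

theorem mat_triple (x h y : Herm β n) : (triple x h y).mat =
    (2⁻¹ : ℝ) • (x.mat * h.mat * y.mat + y.mat * h.mat * x.mat) := rfl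

/-- The operator `h ↦ y ⟨y | h⟩`. -/
noncomputable def tensor (y : Herm β n) : Herm β n →ₗ[ℝ] Herm β n where
  toFun h := (inner ℝ y h) • y
  map_add' g h := by rw [inner_add_right, add_smul]
  map_smul' c h := by rw [inner_smul_right, RingHom.id_apply, mul_smul]

theorem tensor_apply (y h : Herm β n) : tensor y h = (inner ℝ y h : ℝ) • y := rfl

/-- The operator `h ↦ y h y`. -/
noncomputable def quad (y : Herm β n) : Herm β n →ₗ[ℝ] Herm β n where
  toFun h := ⟨y.mat * h.mat * y.mat, by
    rw [selfAdjoint.mem_iff, star_mul, star_mul, star_mat, star_mat, mul_assoc]⟩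
  map_add' g h := mat_injective (by
    change y.mat * (g.mat + h.mat) * y.mat = y.mat * g.mat * y.mat + y.mat * h.mat * y.mat
    rw [mul_add, add_mul])
  map_smul' c h := mat_injective (by
    change y.mat * (c • h.mat) * y.mat = c • (y.mat * h.mat * y.mat)
    rw [mul_smul_comm, smul_mul_assoc])

/-- The symmetrized product as a linear map in the middle argument. -/
noncomputable def tripleL (x y : Herm β n) : Herm β n →ₗ[ℝ] Herm β n where
  toFun h := triple x h y
  map_add' g h := mat_injective (by
    simp only [mat_triple, mat_add, mul_add, add_mul, smul_add]
    abel)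
  map_smul' c h := mat_injective (by
    simp only [mat_triple, mat_smul, mul_smul_comm, smul_mul_assoc, ← smul_add,
      RingHom.id_apply]
    rw [smul_comm])

theorem tripleL_add_left (x x' y : Herm β n) :
    tripleL (x + x') y = tripleL x y + tripleL x' y := by
  ext h : 1
  apply mat_injective
  change (2⁻¹ : ℝ) • ((x.mat + x'.mat) * h.mat * y.mat + y.mat * h.mat * (x.mat + x'.mat)) =
    (2⁻¹ : ℝ) • (x.mat * h.mat * y.mat + y.mat * h.mat * x.mat) +
    (2⁻¹ : ℝ) • (x'.mat * h.mat * y.mat + y.mat * h.mat * x'.mat)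
  simp only [mul_add, add_mul, smul_add]
  abel

theorem tripleL_smul_left (c : ℝ) (x y : Herm β n) :
    tripleL (c • x) y = c • tripleL x y := by
  ext h : 1
  apply mat_injective
  change (2⁻¹ : ℝ) • ((c • x.mat) * h.mat * y.mat + y.mat * h.mat * (c • x.mat)) =
    c • (2⁻¹ : ℝ) • (x.mat * h.mat * y.mat + y.mat * h.mat * x.mat)
  simp only [mul_smul_comm, smul_mul_assoc, ← smul_add]
  rw [smul_comm]

theorem tripleL_comm (x y : Herm β n) : tripleL x y = tripleL y x := by
  ext h : 1
  apply mat_injective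
  change (2⁻¹ : ℝ) • (_ + _) = (2⁻¹ : ℝ) • (_ + _)
  rw [add_comm]

theorem tripleL_self (y : Herm β n) : tripleL y y = quad y := by
  ext h : 1
  apply mat_injective
  change (2⁻¹ : ℝ) • (y.mat * h.mat * y.mat + y.mat * h.mat * y.mat) = y.mat * h.mat * y.mat
  rw [← two_smul ℝ, smul_smul]
  norm_num

/-- The endomorphism `Ψ`, which on symmetric operators is determined by `Ψ(y ⊗ y) = ℙ_y` (see
`Psi_tensor` and `Psi_unique`); in an orthonormal basis `e`,
`Ψ(T)(h) = ∑ᵢ (eᵢ h T(eᵢ) + T(eᵢ) h eᵢ) / 2`. -/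
noncomputable def Psi : (Herm β n →ₗ[ℝ] Herm β n) →ₗ[ℝ] (Herm β n →ₗ[ℝ] Herm β n) where
  toFun T := ∑ i, tripleL (stdOrthonormalBasis ℝ (Herm β n) i)
    (T (stdOrthonormalBasis ℝ (Herm β n) i))
  map_add' S T := by
    rw [← Finset.sum_add_distrib]
    refine Finset.sum_congr rfl fun i _ => ?_
    rw [LinearMap.add_apply, tripleL_comm, tripleL_add_left, tripleL_comm, tripleL_comm (T _)]
  map_smul' c T := by
    rw [RingHom.id_apply, Finset.smul_sum]
    refine Finset.sum_congr rfl fun i _ => ?_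
    rw [LinearMap.smul_apply, tripleL_comm, tripleL_smul_left, tripleL_comm]

theorem Psi_tensor (y : Herm β n) : Psi (tensor y) = quad y := by
  have h1 : ∀ i, tripleL (stdOrthonormalBasis ℝ (Herm β n) i)
      (tensor y (stdOrthonormalBasis ℝ (Herm β n) i)) =
      tripleL y ((inner ℝ (stdOrthonormalBasis ℝ (Herm β n) i) y) •
        stdOrthonormalBasis ℝ (Herm β n) i) := fun i => by
    change tripleL _ ((inner ℝ y _ : ℝ) • y) = _
    rw [tripleL_comm, tripleL_smul_left, tripleL_comm y (_ • _), tripleL_smul_left,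
      tripleL_comm y, real_inner_comm]
  have h2 : ∀ (ι : Type) (s : Finset ι) (u : ι → Herm β n),
      ∑ i ∈ s, tripleL y (u i) = tripleL y (∑ i ∈ s, u i) := fun ι s u => by
    simp_rw [tripleL_comm y]
    exact (map_sum (LinearMap.mk ⟨fun x => tripleL x y, fun a b => tripleL_add_left a b y⟩
      (fun c a => tripleL_smul_left c a y) : Herm β n →ₗ[ℝ] _) u s).symm
  change ∑ i : Fin _, tripleL _ _ = quad y
  simp_rw [h1]
  rw [h2, (stdOrthonormalBasis ℝ (Herm β n)).sum_repr' y, tripleL_self]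

theorem Psi_unique (Φ : (Herm β n →ₗ[ℝ] Herm β n) →ₗ[ℝ] (Herm β n →ₗ[ℝ] Herm β n))
    (hΦ : ∀ y, Φ (tensor y) = quad y) (T : Herm β n →ₗ[ℝ] Herm β n) (hT : T.IsSymmetric) :
    Φ T = Psi T := by
  have hT' : T = ∑ i, hT.eigenvalues rfl i • tensor (hT.eigenvectorBasis rfl i) := by
    apply (hT.eigenvectorBasis rfl).toBasis.ext
    intro j
    simp only [OrthonormalBasis.coe_toBasis, LinearMap.sum_apply, LinearMap.smul_apply]
    rw [Finset.sum_eq_single j]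
    · rw [hT.apply_eigenvectorBasis, tensor_apply, real_inner_self_eq_norm_sq,
        (hT.eigenvectorBasis rfl).norm_eq_one]
      simp
    · intro i _ hij
      rw [tensor_apply, (hT.eigenvectorBasis rfl).inner_eq_zero hij]
      simp
    · simp
  rw [hT']
  simp only [map_sum, map_smul, hΦ, Psi_tensor]

end Herm

open Herm

section Law

variable {β : Peirce} {n : ℕ}

/-- The law `μ` is invariant under `x ↦ U x U*`. -/
def IsRotationInvariant (μ : Measure (Herm β n)) : Prop :=
  ∀ U ∈ unitary (Matrix (Fin n) (Fin n) β.Scalar), μ.map (conj U) = μ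

/-- `L(θ) = E exp ⟨θ | X⟩`. -/
noncomputable def laplace (μ : Measure (Herm β n)) (θ : Herm β n) : ℝ :=
  ∫ x, Real.exp (inner ℝ θ x) ∂μ

/-- The interior of the set where the Laplace transform is finite. -/
def laplaceDomain (μ : Measure (Herm β n)) : Set (Herm β n) :=
  interior {θ | Integrable (fun x => Real.exp (inner ℝ θ x)) μ}

/-- `k(θ) = log L(θ)`. -/
noncomputable def logLaplace (μ : Measure (Herm β n)) (θ : Herm β n) : ℝ :=
  Real.log (laplace μ θ)

/-- With `X`, `Y` independent of law `μ` and `S = X + Y`: the law is rotation invariant, has second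
moments, and `E((X - Y)² | S) = A S² + B S + C I`. -/
def IsMeixner (μ : Measure (Herm β n)) (A B C : ℝ) : Prop :=
  IsRotationInvariant μ ∧ MemLp id 2 μ ∧
    (μ.prod μ)[fun p : Herm β n × Herm β n => sq (p.1 - p.2) |
        MeasurableSpace.comap (fun p : Herm β n × Herm β n => p.1 + p.2) inferInstance]
      =ᵐ[μ.prod μ] fun p => A • sq (p.1 + p.2) + B • (p.1 + p.2) + C • (1 : Herm β n)

/-- `E((X - Y)² | S) = 2 / (1 + 2 a) (I + b S + a S²)`, for a rotation invariant law with second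
moments. Meaningful for `1 + 2 a ≠ 0`. -/
def IsMeixnerWith (μ : Measure (Herm β n)) (a b : ℝ) : Prop :=
  IsMeixner μ (2 * a / (1 + 2 * a)) (2 * b / (1 + 2 * a)) (2 / (1 + 2 * a))

/-- `E X = 0` and `E X² = I`. -/
def IsStandardized (μ : Measure (Herm β n)) : Prop :=
  MemLp id 2 μ ∧ ∫ x, x ∂μ = 0 ∧ ∫ x, sq x ∂μ = 1

/-- `Ψ(k''(θ))(I) = I + 2 b k'(θ) + 4 a k'(θ)²` at all `θ` in the Laplace domain; `k'` is the
gradient and `k''` the derivative of the gradient. -/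
def SatisfiesCumulantEquation (μ : Measure (Herm β n)) (a b : ℝ) : Prop :=
  ∀ θ ∈ laplaceDomain μ,
    Psi (fderiv ℝ (gradient (logLaplace μ)) θ : Herm β n →ₗ[ℝ] Herm β n) 1 =
      1 + (2 * b) • gradient (logLaplace μ) θ + (4 * a) • sq (gradient (logLaplace μ) θ)

/-- The elementary symmetric functions `(e₁(v), …, eₙ(v))`. -/
noncomputable def elemSymm (v : Fin n → ℝ) : Fin n → ℝ :=
  fun i => (Finset.univ.val.map v).esymm (i.val + 1)

/-- The image under `(σ₁, …, σₙ)` of the diagonal matrices with distinct eigenvalues in the Laplace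
domain. -/
def sigmaDomain (μ : Measure (Herm β n)) : Set (Fin n → ℝ) :=
  elemSymm '' {v | Function.Injective v ∧ (diag v : Herm β n) ∈ laplaceDomain μ}

/-- `g(σ₁(θ), …, σₙ(θ)) = f(θ)` for `θ` in the Laplace domain with distinct eigenvalues. -/
def Represents (μ : Measure (Herm β n)) (f : Herm β n → ℝ) (g : (Fin n → ℝ) → ℝ) : Prop :=
  ∀ θ ∈ laplaceDomain μ, ∀ v : Fin n → ℝ, Function.Injective v → HasEigenvalues θ v →
    g (elemSymm v) = f θ

/-- `σ_m` as a function of the point `s = (σ₁, …, σₙ)`, with `σ₀ = 1` and `σ_m = 0` for `m < 0` and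
for `m > n`. -/
noncomputable def coord (s : Fin n → ℝ) (m : ℤ) : ℝ :=
  if m = 0 then 1 else ∑ i : Fin n, if (i.val : ℤ) + 1 = m then s i else 0

/-- `g_r = ∂g/∂σ_r` for `r = 1, …, n` (and `0` for other `r`). -/
noncomputable def pderiv (r : ℕ) (g : (Fin n → ℝ) → ℝ) (s : Fin n → ℝ) : ℝ :=
  fderiv ℝ g s (fun i => if i.val + 1 = r then 1 else 0)

/-- The `j`-th component (`j = 1, …, n`) of `𝔻(g)` at `s = (σ₁, …, σₙ)`. -/
noncomputable def opD (β : Peirce) (g : (Fin n → ℝ) → ℝ) (s : Fin n → ℝ) (j : ℕ) : ℝ :=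
  (∑ p ∈ Finset.Icc 1 j, ∑ q ∈ Finset.Icc 1 j,
      coord s ((p : ℤ) + q - 1 - j) * pderiv p (pderiv q g) s)
    - (∑ p ∈ Finset.Icc (j + 1) n, ∑ q ∈ Finset.Icc (j + 1) n,
      coord s ((p : ℤ) + q - 1 - j) * pderiv p (pderiv q g) s)
    - ((n : ℝ) - j) * (β.val / 2) * pderiv (j + 1) g s

/-- Case `a ≠ 0`: `g` represents `exp(-4 a k - b tr)` and `𝔻(g) = ((b² - 4a) g, 0, …, 0)`. -/
def SystemI (μ : Measure (Herm β n)) (a b : ℝ) (g : (Fin n → ℝ) → ℝ) : Prop :=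
  Represents μ (fun θ => Real.exp (-4 * a * logLaplace μ θ - b * tr θ)) g ∧
    ∀ s ∈ sigmaDomain μ, ∀ j ∈ Finset.Icc 1 n,
      opD β g s j = if j = 1 then (b ^ 2 - 4 * a) * g s else 0

/-- Case `a = 0 ≠ b`: `g` represents `k + tr / (2b)` and `𝔻(g) = 2b (g₁, …, gₙ)`. -/
def SystemII (μ : Measure (Herm β n)) (b : ℝ) (g : (Fin n → ℝ) → ℝ) : Prop :=
  Represents μ (fun θ => logLaplace μ θ + 1 / (2 * b) * tr θ) g ∧
    ∀ s ∈ sigmaDomain μ, ∀ j ∈ Finset.Icc 1 n, opD β g s j = 2 * b * pderiv j g s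

/-- Case `a = b = 0`: `g` represents `k` and `𝔻(g) = (1, 0, …, 0)`. -/
def SystemIII (μ : Measure (Herm β n)) (g : (Fin n → ℝ) → ℝ) : Prop :=
  Represents μ (logLaplace μ) g ∧
    ∀ s ∈ sigmaDomain μ, ∀ j ∈ Finset.Icc 1 n, opD β g s j = if j = 1 then 1 else 0

/-- `g → c₀` and `∂g/∂σ₁ → c₁` as `(σ₁, …, σₙ) → 0` over the domain. -/
def HasBoundaryLimits (μ : Measure (Herm β n)) (g : (Fin n → ℝ) → ℝ) (c₀ c₁ : ℝ) : Prop :=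
  Tendsto g (𝓝[sigmaDomain μ] 0) (𝓝 c₀) ∧ Tendsto (pderiv 1 g) (𝓝[sigmaDomain μ] 0) (𝓝 c₁)

end Law

end MeixnerEnsemble

open MeixnerEnsemble

/-! Write `E_θ` for the expectation under the tilted law `exp⟨θ|x⟩ μ(dx) / L(θ)`. Then `k'(θ) = E_θ
X`, the Hessian `k''(θ)` is the covariance of the tilted law, and since `Ψ(x ⊗ x)(I) = x²`, one has
`Ψ(k''(θ))(I) = E_θ X² - (E_θ X)²`. If the regression residual is multiplied by `exp⟨θ|S⟩` and
integrated against `μ × μ`, everything factors, and the result is a nonzero multiple of the defect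
in `Ψ(k'')(I) = I + 2b k' + 4a (k')²` (`integral_exp_residual_meixner`). So the Meixner property
gives this cumulant equation. Conversely, the equation makes the exponential integrals of the
residual vanish on an open set, and uniqueness of Laplace transforms returns the conditional
expectation (`setIntegral_eq_zero_of_integral_exp_eq_zero`).

By invariance `k` depends on the eigenvalues only. The Hessian at a diagonal matrix acts on
off-diagonal directions by divided differences of the gradient, so `Ψ(k'')(I)` is diagonal with
entries `∂ᵢ²k + (β/2) ∑_{j≠i} (∂ᵢk - ∂ⱼk)/(vᵢ - vⱼ)` (`Psi_hessian_diag`). In the coordinates `σ`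
this operator becomes `∑ⱼ 𝔻(g)ⱼ e_{j-1}(v without vᵢ)` (`muirhead_comp_elemSymm`). The matrix of
these `e_{j-1}` is invertible when the `vᵢ` are distinct, so the `n` scalar equations are equivalent
to a system for `𝔻(g)`. For `a ≠ 0` the exponential in the definition of `g` absorbs the quadratic
term; for `a = 0 ≠ b` adding a multiple of the trace absorbs the constant.

Two analytic facts remain. In the converse part second moments are not given: on a ray of scalar
matrices the equation bounds the second moment by the square of the first, and a differential
inequality prevents blow-up at the origin (`SatisfiesCumulantEquation.memLp_two`). In the direct
part the limits need `0 ∈ Θ`: the regression property, tested against exponentials of a truncated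
norm, yields an exponential moment (`IsMeixnerWith.zero_mem_laplaceDomain`). Then `k` is smooth at
the origin, and iterated divided differences bound the derivatives `g_r` there, which gives the
limit of `g₁` (`EigenRep.tendsto`). In the converse part limits along a single ray suffice. -/

namespace MeixnerEnsemble

open Herm

open scoped ContDiff

variable {β : Peirce} {n : ℕ}

/-! ### The scalars: an orthonormal basis of units and the real part. -/

namespace Peirce

/-- The quaternion with the given coordinates. -/
def quat (a b c d : ℝ) : Quaternion ℝ := ⟨a, b, c, d⟩

@[simp] theorem quat_re (a b c d : ℝ) : (quat a b c d).re = a := rfl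

@[simp] theorem quat_imI (a b c d : ℝ) : (quat a b c d).imI = b := rfl

@[simp] theorem quat_imJ (a b c d : ℝ) : (quat a b c d).imJ = c := rfl

@[simp] theorem quat_imK (a b c d : ℝ) : (quat a b c d).imK = d := rfl

/-- The real dimension of the scalars. -/
def dim : Peirce → ℕ
  | one => 1
  | two => 2
  | four => 4

theorem dim_cast (β : Peirce) : (β.dim : ℝ) = β.val := by
  cases β <;> norm_num [dim, val]

/-- The standard orthonormal basis of the scalars over the reals; it consists of units. -/
noncomputable def unit : (β : Peirce) → Fin β.dim → β.Scalar
  | one => fun _ => (1 : ℝ)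
  | two => (![1, Complex.I] : Fin 2 → ℂ)
  | four => (![quat 1 0 0 0, quat 0 1 0 0, quat 0 0 1 0, quat 0 0 0 1] : Fin 4 → Quaternion ℝ)

theorem unit_mul_star (β : Peirce) (m : Fin β.dim) : β.unit m * star (β.unit m) = 1 := by
  cases β
  · exact (by simp : (1 : ℝ) * star (1 : ℝ) = 1)
  · have h : ∀ m : Fin 2, (![1, Complex.I] : Fin 2 → ℂ) m * star ((![1, Complex.I] : Fin 2 → ℂ) m)
        = 1 := by
      intro m; fin_cases m <;> simp
    exact h m
  · have h : ∀ m : Fin 4, (![quat 1 0 0 0, quat 0 1 0 0, quat 0 0 1 0, quat 0 0 0 1] : Fin 4 → Quaternion ℝ) m *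
        star ((![quat 1 0 0 0, quat 0 1 0 0, quat 0 0 1 0, quat 0 0 0 1] : Fin 4 → Quaternion ℝ) m) = 1 := by
      intro m; fin_cases m <;> ext <;> simp [Quaternion.re_mul, Quaternion.imI_mul,
        Quaternion.imJ_mul, Quaternion.imK_mul] <;> rfl
    exact h m

theorem star_mul_unit (β : Peirce) (m : Fin β.dim) : star (β.unit m) * β.unit m = 1 :=
  mul_eq_one_comm.1 (β.unit_mul_star m)

theorem sum_re_unit (β : Peirce) (x : β.Scalar) :
    ∑ m, β.re (star (β.unit m) * x) • β.unit m = x := by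
  cases β
  · have h : ∀ x : ℝ, ∑ _m : Fin 1, (star (1 : ℝ) * x) • (1 : ℝ) = x := by intro x; simp
    exact h x
  · have h : ∀ x : ℂ, ∑ m : Fin 2, (star ((![1, Complex.I] : Fin 2 → ℂ) m) * x).re •
        (![1, Complex.I] : Fin 2 → ℂ) m = x := by
      intro x; rw [Fin.sum_univ_two]; apply Complex.ext <;> simp
    exact h x
  · have h : ∀ x : Quaternion ℝ, ∑ m : Fin 4,
        (star ((![quat 1 0 0 0, quat 0 1 0 0, quat 0 0 1 0, quat 0 0 0 1] : Fin 4 → Quaternion ℝ) m) * x).re •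
        (![quat 1 0 0 0, quat 0 1 0 0, quat 0 0 1 0, quat 0 0 0 1] : Fin 4 → Quaternion ℝ) m = x := by
      intro x; rw [Fin.sum_univ_four]; ext <;> simp [Quaternion.re_mul]
    exact h x

theorem re_algebraMap (β : Peirce) (r : ℝ) : β.re (algebraMap ℝ β.Scalar r) = r := by
  cases β
  · rfl
  · exact Complex.ofReal_re r
  · rfl

theorem add_star (β : Peirce) (x : β.Scalar) :
    x + star x = algebraMap ℝ β.Scalar (2 * β.re x) := by
  cases β
  · exact (two_mul (x : ℝ)).symm
  · have h : ∀ x : ℂ, x + star x = ((2 * x.re : ℝ) : ℂ) := by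
      intro x; apply Complex.ext <;> simp; ring
    exact h x
  · have h : ∀ x : Quaternion ℝ, x + star x = ((2 * x.re : ℝ) : Quaternion ℝ) := by
      intro x; ext <;> simp; ring
    exact h x

theorem eq_algebraMap_of_star (β : Peirce) {x : β.Scalar} (h : star x = x) :
    x = algebraMap ℝ β.Scalar (β.re x) := by
  have h1 := β.add_star x
  rw [h, ← two_smul ℝ x, map_mul, map_ofNat, two_smul, ← two_mul] at h1
  have h2 : (2 : β.Scalar) ≠ 0 := by
    have h3 := (map_ne_zero (algebraMap ℝ β.Scalar)).2 (two_ne_zero : (2 : ℝ) ≠ 0)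
    rwa [map_ofNat] at h3
  exact mul_left_cancel₀ h2 h1

theorem re_one (β : Peirce) : β.re 1 = 1 := by
  rw [← map_one (algebraMap ℝ β.Scalar), β.re_algebraMap]

/-- Parseval's identity for the scalar `1`; it collapses the terms with `k = l` in
`Psi_one_of_offDiag`. -/
theorem sum_re_unit_mul_self (β : Peirce) : ∑ m, β.re (β.unit m) * β.re (β.unit m) = 1 := by
  have h := congrArg β.re (β.sum_re_unit 1)
  rw [map_sum, β.re_one] at h
  simpa [β.re_star] using h

end Peirce

/-! ### Self-adjoint matrices under unitary conjugation. -/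

namespace Herm

theorem reTr_mul_comm (A B : Matrix (Fin n) (Fin n) β.Scalar) : reTr (A * B) = reTr (B * A) := by
  simp only [reTr, Matrix.trace, Matrix.diag, Matrix.mul_apply, map_sum]
  rw [Finset.sum_comm]
  simp_rw [β.re_mul_comm]

theorem mat_one : (1 : Herm β n).mat = 1 := rfl

theorem mat_sq (x : Herm β n) : (sq x).mat = x.mat * x.mat := rfl

theorem mat_conj (U : Matrix (Fin n) (Fin n) β.Scalar) (x : Herm β n) :
    (conj U x).mat = U * x.mat * star U := rfl

theorem mat_diag (v : Fin n → ℝ) : (diag v : Herm β n).mat =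
    Matrix.diagonal fun i => algebraMap ℝ β.Scalar (v i) := rfl

@[simp] theorem mat_sub (x y : Herm β n) : (x - y).mat = x.mat - y.mat := rfl

theorem mat_sum {ι : Type*} (s : Finset ι) (f : ι → Herm β n) :
    (∑ i ∈ s, f i).mat = ∑ i ∈ s, (f i).mat := map_sum (matL : Herm β n →ₗ[ℝ] _) f s

theorem ext_mat {x y : Herm β n} (h : ∀ i j, x.mat i j = y.mat i j) : x = y :=
  mat_injective (Matrix.ext h)

theorem star_apply (x : Herm β n) (i j : Fin n) : star (x.mat i j) = x.mat j i := by
  conv_rhs => rw [← star_mat x]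
  rfl

theorem inner_one_left (x : Herm β n) : inner ℝ (1 : Herm β n) x = tr x := by
  rw [inner_def, mat_one, one_mul, tr]

theorem tr_sq (x : Herm β n) : tr (sq x) = ‖x‖ ^ 2 := by
  rw [← real_inner_self_eq_norm_sq, inner_def]; rfl

theorem diag_one : (diag (fun _ => 1) : Herm β n) = 1 := by
  apply mat_injective; rw [mat_diag, mat_one]; simp

theorem conj_add (U : Matrix (Fin n) (Fin n) β.Scalar) (x y : Herm β n) :
    conj U (x + y) = conj U x + conj U y := by
  apply mat_injective; simp only [mat_conj, mat_add, mul_add, add_mul]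

theorem conj_smul (U : Matrix (Fin n) (Fin n) β.Scalar) (c : ℝ) (x : Herm β n) :
    conj U (c • x) = c • conj U x := by
  apply mat_injective; simp only [mat_conj, mat_smul, mul_smul_comm, smul_mul_assoc]

theorem conj_conj (U V : Matrix (Fin n) (Fin n) β.Scalar) (x : Herm β n) :
    conj U (conj V x) = conj (U * V) x := by
  apply mat_injective; simp only [mat_conj, star_mul, mul_assoc]

theorem conj_one (x : Herm β n) : conj 1 x = x := by
  apply mat_injective; simp [mat_conj]

theorem conj_star_conj {U : Matrix (Fin n) (Fin n) β.Scalar} (hU : U ∈ unitary _) (x : Herm β n) :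
    conj (star U) (conj U x) = x := by
  rw [conj_conj, (Unitary.mem_iff.1 hU).1, conj_one]

theorem conj_conj_star {U : Matrix (Fin n) (Fin n) β.Scalar} (hU : U ∈ unitary _) (x : Herm β n) :
    conj U (conj (star U) x) = x := by
  rw [conj_conj, (Unitary.mem_iff.1 hU).2, conj_one]

theorem conj_sq {U : Matrix (Fin n) (Fin n) β.Scalar} (hU : U ∈ unitary _) (x : Herm β n) :
    sq (conj U x) = conj U (sq x) := by
  apply mat_injective
  simp only [mat_conj, mat_sq]
  calc U * x.mat * star U * (U * x.mat * star U) = U * x.mat * (star U * U) * (x.mat * star U) := by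
        simp only [mul_assoc]
    _ = _ := by rw [(Unitary.mem_iff.1 hU).1, mul_one]; simp only [mul_assoc]

theorem conj_self_one {U : Matrix (Fin n) (Fin n) β.Scalar} (hU : U ∈ unitary _) :
    conj U (1 : Herm β n) = 1 := by
  apply mat_injective
  rw [mat_conj, mat_one, mul_one, (Unitary.mem_iff.1 hU).2]

theorem inner_conj_left (U : Matrix (Fin n) (Fin n) β.Scalar) (x y : Herm β n) :
    inner ℝ (conj U x) y = inner ℝ x (conj (star U) y) := by
  simp only [inner_def, mat_conj, star_star]
  rw [mul_assoc, mul_assoc, reTr_mul_comm]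
  simp only [mul_assoc]

theorem inner_conj_conj {U : Matrix (Fin n) (Fin n) β.Scalar} (hU : U ∈ unitary _)
    (x y : Herm β n) : inner ℝ (conj U x) (conj U y) = inner ℝ x y := by
  rw [inner_conj_left, conj_star_conj hU]

/-- Conjugation by a unitary matrix as an isometry. -/
noncomputable def conjE (U : Matrix (Fin n) (Fin n) β.Scalar) (hU : U ∈ unitary _) :
    Herm β n ≃ₗᵢ[ℝ] Herm β n where
  toFun := conj U
  map_add' := conj_add U
  map_smul' := conj_smul U
  invFun := conj (star U)
  left_inv := conj_star_conj hU
  right_inv := conj_conj_star hU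
  norm_map' x := by
    have h : ‖conj U x‖ ^ 2 = ‖x‖ ^ 2 := by
      rw [← real_inner_self_eq_norm_sq, ← real_inner_self_eq_norm_sq, inner_conj_conj hU]
    exact (sq_eq_sq₀ (norm_nonneg _) (norm_nonneg _)).1 h

@[simp] theorem conjE_apply (U : Matrix (Fin n) (Fin n) β.Scalar) (hU : U ∈ unitary _)
    (x : Herm β n) : conjE U hU x = conj U x := rfl

theorem norm_conj {U : Matrix (Fin n) (Fin n) β.Scalar} (hU : U ∈ unitary _) (x : Herm β n) :
    ‖conj U x‖ = ‖x‖ := (conjE U hU).norm_map x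

theorem continuous_conj {U : Matrix (Fin n) (Fin n) β.Scalar} (hU : U ∈ unitary _) :
    Continuous (conj U : Herm β n → Herm β n) := (conjE U hU).continuous

/-- The real diagonal matrices as a linear map. -/
noncomputable def diagL : (Fin n → ℝ) →L[ℝ] Herm β n :=
  LinearMap.toContinuousLinearMap
    { toFun := diag
      map_add' := fun v w => by
        apply mat_injective; rw [mat_add, mat_diag, mat_diag, mat_diag, Matrix.diagonal_add]; simp
      map_smul' := fun c v => by
        apply mat_injective; rw [RingHom.id_apply, mat_smul, mat_diag, mat_diag,
          ← Matrix.diagonal_smul]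
        congr 1; funext i; simp [Algebra.smul_def] }

@[simp] theorem diagL_apply (v : Fin n → ℝ) : (diagL v : Herm β n) = diag v := rfl

theorem inner_diag_left (v : Fin n → ℝ) (x : Herm β n) :
    inner ℝ (diag v) x = ∑ i, v i * β.re (x.mat i i) := by
  rw [inner_def, mat_diag, reTr, Matrix.trace, map_sum]
  refine Finset.sum_congr rfl fun i _ => ?_
  rw [Matrix.diag_apply, Matrix.diagonal_mul, ← Algebra.smul_def, map_smul, smul_eq_mul]

theorem diag_apply_same (v : Fin n → ℝ) (i : Fin n) :
    (diag v : Herm β n).mat i i = algebraMap ℝ β.Scalar (v i) := by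
  rw [mat_diag, Matrix.diagonal_apply_eq]

theorem diag_injective : Function.Injective (diag : (Fin n → ℝ) → Herm β n) := fun v w h => by
  funext i
  have := congrArg (fun x : Herm β n => β.re (x.mat i i)) h
  simpa [diag_apply_same, β.re_algebraMap] using this

theorem tr_diag (v : Fin n → ℝ) : tr (diag v : Herm β n) = ∑ i, v i := by
  rw [← inner_one_left, real_inner_comm, inner_diag_left]
  simp [mat_one, β.re_one]

theorem sq_diag (v : Fin n → ℝ) : sq (diag v : Herm β n) = diag (fun i => v i ^ 2) := by
  apply mat_injective
  rw [mat_sq, mat_diag, mat_diag, Matrix.diagonal_mul_diagonal]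
  simp [pow_two]

/-- Permutation matrices permute the entries of diagonal matrices. -/
theorem exists_conj_diag_perm (π : Equiv.Perm (Fin n)) :
    ∃ U ∈ unitary (Matrix (Fin n) (Fin n) β.Scalar),
      ∀ v : Fin n → ℝ, conj U (diag v : Herm β n) = diag (v ∘ π) := by
  set P : Matrix (Fin n) (Fin n) β.Scalar := Matrix.of fun i j => if π i = j then 1 else 0 with hP
  have h1 : P * star P = 1 := by
    ext i j
    simp [hP, Matrix.mul_apply, Matrix.one_apply, Matrix.star_apply, apply_ite star]
  have h2 : star P * P = 1 := by
    ext i j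
    simp only [hP, Matrix.mul_apply, Matrix.one_apply, Matrix.star_apply, Matrix.of_apply]
    rw [Finset.sum_eq_single (π.symm i)]
    · simp
    · intro k _ hk
      have : π k ≠ i := fun h => hk (by rw [← h]; simp)
      simp [this]
    · simp
  refine ⟨P, Unitary.mem_iff.2 ⟨h2, h1⟩, fun v => ext_mat fun i j => ?_⟩
  rw [mat_conj, mat_diag, mat_diag]
  simp only [Matrix.mul_apply, Matrix.star_apply, hP, Matrix.of_apply, apply_ite star]
  by_cases h : i = j
  · subst h; simp
  · have h' : π i ≠ π j := fun h' => h (π.injective h')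
    simp [h, h']

/-- A self-adjoint matrix that is fixed by the conjugations that fix all diagonal matrices is real
diagonal. -/
theorem eq_diag_of_conj_invariant (x : Herm β n)
    (h : ∀ U ∈ unitary (Matrix (Fin n) (Fin n) β.Scalar),
      (∀ v : Fin n → ℝ, conj U (diag v : Herm β n) = diag v) → conj U x = x) :
    x = diag fun i => β.re (x.mat i i) := by
  refine ext_mat fun i j => ?_
  by_cases hij : i = j
  · subst hij
    rw [diag_apply_same]
    exact β.eq_algebraMap_of_star (x.star_apply i i)
  rw [mat_diag, Matrix.diagonal_apply_ne _ hij]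
  -- Conjugation by this diagonal sign matrix fixes every real diagonal matrix and changes the sign
  -- of the entry `(i, j)`, which must therefore vanish.
  set s : Fin n → ℝ := fun k => if k = i then -1 else 1 with hs
  have hss : ∀ k, s k * s k = 1 := fun k => by by_cases hk : k = i <;> simp [hs, hk]
  have hstar : star (diag s : Herm β n).mat = (diag s : Herm β n).mat := star_mat _
  have hU : (diag s : Herm β n).mat * (diag s : Herm β n).mat = 1 := by
    rw [← mat_sq, sq_diag, ← mat_one, ← diag_one]
    simp only [pow_two, hss]
  have hfix : ∀ v : Fin n → ℝ, conj (diag s : Herm β n).mat (diag v : Herm β n) = diag v := by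
    intro v
    apply mat_injective
    rw [mat_conj, hstar, mat_diag, mat_diag, Matrix.diagonal_mul_diagonal,
      Matrix.diagonal_mul_diagonal]
    congr 1
    funext k
    rw [← map_mul, ← map_mul, mul_right_comm, hss, one_mul]
  have h1 := h (diag s : Herm β n).mat (Unitary.mem_iff.2 (by rw [hstar]; exact ⟨hU, hU⟩)) hfix
  have h2 := congrArg (fun y : Herm β n => y.mat i j) h1
  simp only [mat_conj, hstar] at h2
  rw [mat_diag, Matrix.mul_diagonal, Matrix.diagonal_mul, ← Algebra.smul_def,
    ← Algebra.commutes, ← Algebra.smul_def, smul_smul] at h2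
  have h3 : s j * s i = -1 := by simp [hs, Ne.symm hij]
  rw [h3, neg_smul, one_smul] at h2
  have h4 : (2 : ℝ) • x.mat i j = 0 := by rw [two_smul]; nth_rewrite 1 [← h2]; simp
  simpa using h4

/-! ### Off-diagonal directions, plane rotations and a weak spectral theorem. -/

/-- The matrix with entries `u` and `star u` in the positions `(k, l)` and `(l, k)` (their sum, if
`k = l`). -/
noncomputable def offDiag (k l : Fin n) (u : β.Scalar) : Herm β n :=
  ⟨Matrix.single k l u + Matrix.single l k (star u), by
    rw [selfAdjoint.mem_iff, star_add, Matrix.star_eq_conjTranspose, Matrix.star_eq_conjTranspose,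
      Matrix.conjTranspose_single, Matrix.conjTranspose_single, star_star, add_comm]⟩

theorem mat_offDiag (k l : Fin n) (u : β.Scalar) :
    (offDiag k l u).mat = Matrix.single k l u + Matrix.single l k (star u) := rfl

theorem inner_offDiag_left (k l : Fin n) (u : β.Scalar) (x : Herm β n) :
    inner ℝ (offDiag k l u) x = 2 * β.re (star u * x.mat k l) := by
  rw [inner_def, mat_offDiag, add_mul, reTr, Matrix.trace_add, map_add,
    Matrix.trace_single_mul, Matrix.trace_single_mul, smul_eq_mul, smul_eq_mul]
  rw [two_mul, β.re_mul_comm u, ← β.re_star (_ * u), star_mul, star_apply]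

/-- `offDiag` as a real linear map. -/
noncomputable def offDiagL (k l : Fin n) : β.Scalar →ₗ[ℝ] Herm β n where
  toFun := offDiag k l
  map_add' u v := by
    apply mat_injective
    simp only [mat_add, mat_offDiag, star_add, Matrix.single_add]
    abel
  map_smul' c u := by
    apply mat_injective
    simp only [mat_smul, mat_offDiag, star_smul, star_trivial, RingHom.id_apply, smul_add,
      Matrix.smul_single]

/-- The matrices `offDiag k l u`, with `u` in the standard basis of the scalars, form a tight
frame. -/
theorem frame (x : Herm β n) :
    x = ∑ k, ∑ l, ∑ m, (4⁻¹ : ℝ) •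
      ((inner ℝ (offDiag k l (β.unit m)) x : ℝ) • offDiag k l (β.unit m)) := by
  -- The inner product contributes a factor `2`, so the sum over `m` is half of `offDiag k l (x k
  -- l)`. Every matrix unit occurs for both `(k, l)` and `(l, k)`, which makes up for the other
  -- half.
  have h1 : ∀ k l, ∑ m, (4⁻¹ : ℝ) •
      ((inner ℝ (offDiag k l (β.unit m)) x : ℝ) • (offDiag k l (β.unit m) : Herm β n)) =
      (2⁻¹ : ℝ) • offDiag k l (x.mat k l) := by
    intro k l
    refine Eq.trans ?_ (congrArg (fun u => (2⁻¹ : ℝ) • (offDiagL k l u : Herm β n))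
      (β.sum_re_unit (x.mat k l)))
    rw [map_sum, Finset.smul_sum]
    refine Finset.sum_congr rfl fun m _ => ?_
    rw [map_smul, inner_offDiag_left, smul_smul, smul_smul]
    change _ = _ • offDiag k l (β.unit m)
    congr 1
    ring
  simp_rw [h1]
  apply mat_injective
  have h2 := Matrix.matrix_eq_sum_single x.mat
  simp only [mat_sum, mat_smul, mat_offDiag, star_apply, ← Finset.smul_sum,
    Finset.sum_add_distrib]
  rw [← h2, Finset.sum_comm, ← h2, ← two_smul ℝ, smul_smul]
  norm_num

/-- `Ψ` may be evaluated in the tight frame instead of an orthonormal basis: the frame writes `T` as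
a sum of rank-one operators, and `Ψ` sends `h ↦ ⟨y|h⟩ z` to `tripleL y z`. -/
theorem Psi_eq_sum_offDiag (T : Herm β n →ₗ[ℝ] Herm β n) :
    Psi T = ∑ k, ∑ l, ∑ m, (4⁻¹ : ℝ) •
      tripleL (offDiag k l (β.unit m)) (T (offDiag k l (β.unit m))) := by
  have h0 : ∀ y z : Herm β n, Psi ((innerₗ (Herm β n) y).smulRight z) = tripleL y z := by
    intro y z
    set e := stdOrthonormalBasis ℝ (Herm β n) with he
    change ∑ i, tripleL (e i) ((inner ℝ y (e i) : ℝ) • z) = _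
    have h2 : ∀ i, tripleL (e i) ((inner ℝ y (e i) : ℝ) • z) =
        tripleL z ((inner ℝ (e i) y : ℝ) • e i) := fun i => by
      rw [tripleL_comm, tripleL_smul_left, tripleL_comm z (_ • _), tripleL_smul_left,
          tripleL_comm z, real_inner_comm]
    simp_rw [h2]
    have h3 := (map_sum (LinearMap.mk ⟨fun x => tripleL x z, fun a b => tripleL_add_left a b z⟩
      (fun c a => tripleL_smul_left c a z) : Herm β n →ₗ[ℝ] _)
      (fun i => (inner ℝ (e i) y : ℝ) • e i) Finset.univ).symm
    simp_rw [tripleL_comm z]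
    refine h3.trans ?_
    rw [e.sum_repr' y]
    rfl
  have h1 : T = ∑ k, ∑ l, ∑ m, (4⁻¹ : ℝ) •
      (innerₗ (Herm β n) (offDiag k l (β.unit m))).smulRight (T (offDiag k l (β.unit m))) := by
    ext x : 1
    nth_rewrite 1 [frame x]
    simp [LinearMap.sum_apply]
  nth_rewrite 1 [h1]
  simp only [map_sum, map_smul, h0]

/-- The rotation by the angle `t` in the coordinates `k`, `l`, twisted by the unit `u`. The
displacement of `diag w` is `w l - w k` times a curve that does not depend on `w`, so two diagonal
matrices moved by the same rotation can be compared. -/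
theorem exists_plane_rotation {k l : Fin n} (hkl : k ≠ l) {u : β.Scalar} (hu : u * star u = 1)
    (hu' : star u * u = 1) (t : ℝ) :
    ∃ U ∈ unitary (Matrix (Fin n) (Fin n) β.Scalar), ∀ w : Fin n → ℝ,
      conj U (diag w : Herm β n) = diag w + (w l - w k) •
        (Real.sin t ^ 2 • diag (Pi.single k 1 - Pi.single l 1) +
          (Real.sin t * Real.cos t) • offDiag k l u) := by
  set s := Real.sin t
  set c := Real.cos t
  have hcs : c ^ 2 + s ^ 2 = 1 := Real.cos_sq_add_sin_sq t
  -- The four matrices `p`, `q`, `a`, `b` multiply like the units of `2 × 2` matrices. With this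
  -- table all identities below reduce to `c² + s² = 1`.
  set p : Matrix (Fin n) (Fin n) β.Scalar := Matrix.single k k 1 with hp
  set q : Matrix (Fin n) (Fin n) β.Scalar := Matrix.single l l 1 with hq
  set a : Matrix (Fin n) (Fin n) β.Scalar := Matrix.single k l u with ha
  set b : Matrix (Fin n) (Fin n) β.Scalar := Matrix.single l k (star u) with hb
  have pp : p * p = p := by simp [hp]
  have qq : q * q = q := by simp [hq]
  have pq : p * q = 0 := by simp [hp, hq, hkl]
  have qp : q * p = 0 := by simp [hp, hq, hkl.symm]
  have pa : p * a = a := by simp [hp, ha]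
  have ap : a * p = 0 := by simp [hp, ha, hkl.symm]
  have qa : q * a = 0 := by simp [hq, ha, hkl.symm]
  have aq : a * q = a := by simp [hq, ha]
  have pb : p * b = 0 := by simp [hp, hb, hkl]
  have bp : b * p = b := by simp [hp, hb]
  have qb : q * b = b := by simp [hq, hb]
  have bq : b * q = 0 := by simp [hq, hb, hkl]
  have aa : a * a = 0 := by simp [ha, hkl.symm]
  have bb : b * b = 0 := by simp [hb, hkl]
  have ab : a * b = p := by simp [ha, hb, hp, hu]
  have ba : b * a = q := by simp [ha, hb, hq, hu']
  have sp : star p = p := by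
    rw [Matrix.star_eq_conjTranspose, hp, Matrix.conjTranspose_single, star_one]
  have sq' : star q = q := by
    rw [Matrix.star_eq_conjTranspose, hq, Matrix.conjTranspose_single, star_one]
  have sa : star a = b := by
    rw [Matrix.star_eq_conjTranspose, ha, Matrix.conjTranspose_single]
  have sb : star b = a := by
    rw [Matrix.star_eq_conjTranspose, hb, Matrix.conjTranspose_single, star_star]
  set U : Matrix (Fin n) (Fin n) β.Scalar := 1 + (c - 1) • (p + q) + s • (a - b) with hU
  have hUs : star U = 1 + (c - 1) • (p + q) - s • (a - b) := by
    rw [hU]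
    simp only [star_add, star_sub, star_smul, star_one, sp, sq', sa, sb, star_trivial]
    module
  refine ⟨U, Unitary.mem_iff.2 ⟨?_, ?_⟩, fun w => mat_injective ?_⟩
  · rw [hUs, hU]
    simp only [mul_add, add_mul, mul_sub, sub_mul, smul_mul_assoc, mul_smul_comm, mul_one, one_mul,
      pp, qq, pq, qp, pa, ap, qa, aq, pb, bp, qb, bq, aa, bb, ab, ba]
    linear_combination (norm := module) hcs • (p + q)
  · rw [hUs, hU]
    simp only [mul_add, add_mul, mul_sub, sub_mul, smul_mul_assoc, mul_smul_comm, mul_one, one_mul,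
      pp, qq, pq, qp, pa, ap, qa, aq, pb, bp, qb, bq, aa, bb, ab, ba]
    linear_combination (norm := module) hcs • (p + q)
  · have hdiag : (diag (Pi.single k 1 - Pi.single l 1) : Herm β n).mat = p - q := by
      change (diagL (Pi.single k 1 - Pi.single l 1) : Herm β n).mat = _
      rw [map_sub, mat_sub, diagL_apply, diagL_apply, mat_diag, mat_diag]
      congr 1
      · ext i j
        simp [hp, Matrix.diagonal_apply, Matrix.single_apply, Pi.single_apply]
        grind
      · ext i j
        simp [hq, Matrix.diagonal_apply, Matrix.single_apply, Pi.single_apply]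
        grind
    rw [mat_conj, mat_add, mat_smul, mat_add, mat_smul, mat_smul, hdiag, mat_offDiag]
    set d := (diag w : Herm β n).mat with hd
    have dl : ∀ (i j : Fin n) (x : β.Scalar),
        d * Matrix.single i j x = w i • Matrix.single i j x := by
      intro i j x
      ext i' j'
      rw [hd, mat_diag, Matrix.diagonal_mul, ← Algebra.smul_def, Matrix.smul_apply,
        Matrix.single_apply]
      split_ifs with h
      · rw [h.1]
      · simp
    have dr : ∀ (i j : Fin n) (x : β.Scalar),
        Matrix.single i j x * d = w j • Matrix.single i j x := by
      intro i j x
      ext i' j'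
      rw [hd, mat_diag, Matrix.mul_diagonal, ← Algebra.commutes, ← Algebra.smul_def,
        Matrix.smul_apply, Matrix.single_apply]
      split_ifs with h
      · rw [h.2]
      · simp
    have dp : d * p = w k • p := dl _ _ _
    have dq : d * q = w l • q := dl _ _ _
    have da : d * a = w k • a := dl _ _ _
    have db : d * b = w l • b := dl _ _ _
    have pd : p * d = w k • p := dr _ _ _
    have qd : q * d = w l • q := dr _ _ _
    have ad : a * d = w l • a := dr _ _ _
    have bd : b * d = w k • b := dr _ _ _
    rw [hUs, hU]
    simp only [mul_add, add_mul, mul_sub, sub_mul, smul_mul_assoc, mul_smul_comm, mul_one, one_mul,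
      pp, qq, pq, qp, pa, ap, qa, aq, pb, bp, qb, bq, aa, bb, ab, ba, dp, dq, da, db, pd, qd, ad,
      bd]
    linear_combination (norm := module) hcs • (w k • p + w l • q)

theorem offDiag_eq_zero_of_inner {x : Herm β n} {k l : Fin n}
    (h : ∀ m, inner ℝ (offDiag k l (β.unit m)) x = 0) : x.mat k l = 0 := by
  rw [← β.sum_re_unit (x.mat k l)]
  refine Finset.sum_eq_zero fun m _ => ?_
  have := h m
  rw [inner_offDiag_left] at this
  rw [show β.re (star (β.unit m) * x.mat k l) = 0 by linarith, zero_smul]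

/-- A small multiple of `(0, 1, …, n - 1)` separates equal coordinates, and by continuity it does
not merge distinct ones. -/
theorem eventually_injective_add_smul (w : Fin n → ℝ) :
    ∀ᶠ t : ℝ in 𝓝[≠] 0, Function.Injective (w + t • fun i : Fin n => (i : ℝ)) := by
  have h : ∀ i j : Fin n, ∀ᶠ t : ℝ in 𝓝[≠] 0, i ≠ j → w i + t * i ≠ w j + t * j := by
    intro i j
    by_cases hij : i = j
    · simp [hij]
    have hij' : (i : ℝ) - j ≠ 0 := by
      rw [sub_ne_zero]; exact_mod_cast fun h => hij (Fin.ext h)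
    by_cases hw : w i = w j
    · filter_upwards [self_mem_nhdsWithin] with t ht _ h
      have : t * ((i : ℝ) - j) = 0 := by linarith
      rcases mul_eq_zero.1 this with h | h
      · exact ht h
      · exact hij' h
    · have hc : ContinuousAt (fun t : ℝ => w i + t * i - (w j + t * j)) 0 := by fun_prop
      have hne : (fun t : ℝ => w i + t * i - (w j + t * j)) 0 ≠ 0 := by
        simpa [sub_eq_zero] using hw
      filter_upwards [(hc.eventually_ne hne).filter_mono nhdsWithin_le_nhds] with t ht _
      exact sub_ne_zero.1 ht
  have h' := Filter.eventually_all.2 fun i => Filter.eventually_all.2 fun j => h i j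
  filter_upwards [h'] with t ht i j hij
  by_contra hne
  exact ht i j hne (by simpa using hij)

/-- A weak form of the spectral theorem. -/
theorem mem_closure_conj_diag (θ : Herm β n) :
    θ ∈ closure {x | ∃ U ∈ unitary (Matrix (Fin n) (Fin n) β.Scalar), ∃ v : Fin n → ℝ,
      Function.Injective v ∧ x = conj U (diag v)} := by
  set O : Set (Herm β n) := {x | ∃ U ∈ unitary (Matrix (Fin n) (Fin n) β.Scalar), x = conj U θ}
    with hO
  -- Working with the closure of the orbit makes compactness of the unitary group unnecessary; the
  -- maximizer found below is then only a limit of conjugates of `θ`.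
  have hOc : IsCompact (closure O) := by
    refine (isCompact_closedBall (0 : Herm β n) ‖θ‖).of_isClosed_subset isClosed_closure
      (closure_minimal ?_ Metric.isClosed_closedBall)
    rintro x ⟨U, hU, rfl⟩
    rw [mem_closedBall_zero_iff, norm_conj hU]
  have hOn : (closure O).Nonempty := ⟨θ, subset_closure ⟨1, one_mem _, (conj_one θ).symm⟩⟩
  have hOi : ∀ U ∈ unitary (Matrix (Fin n) (Fin n) β.Scalar), ∀ y ∈ closure O,
      conj U y ∈ closure O := by
    intro U hU y hy
    refine map_mem_closure (continuous_conj hU) hy ?_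
    rintro x ⟨V, hV, rfl⟩
    exact ⟨U * V, mul_mem hU hV, conj_conj U V θ⟩
  set d : Fin n → ℝ := fun i => (i : ℝ) with hd
  -- At a maximum of `⟨diag d|·⟩`, where `d` has distinct entries, the first variation along every
  -- plane rotation is zero. This variation is `(d l - d k)` times a coordinate of the entry `(k,
  -- l)`, so the maximizer is diagonal.
  obtain ⟨y, hyO, hy⟩ := hOc.exists_isMaxOn hOn
    (f := fun y => (inner ℝ (diag d : Herm β n) y : ℝ)) (by fun_prop)
  have hoff : ∀ k l, k ≠ l → y.mat k l = 0 := by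
    intro k l hkl
    refine offDiag_eq_zero_of_inner fun m => ?_
    set A : ℝ := inner ℝ (diag (Pi.single k 1 - Pi.single l 1) : Herm β n) y
    set B : ℝ := inner ℝ (offDiag k l (β.unit m) : Herm β n) y
    have hle : ∀ t, (d l - d k) * (Real.sin t ^ 2 * A + Real.sin t * Real.cos t * B) ≤ 0 := by
      intro t
      obtain ⟨U, hU, hUd⟩ := exists_plane_rotation (n := n) hkl (β.unit_mul_star m)
        (β.star_mul_unit m) t
      have h1 := hy (hOi (star U) (Unitary.star_mem hU) y hyO)
      change inner ℝ (diag d : Herm β n) (conj (star U) y) ≤ inner ℝ (diag d : Herm β n) y at h1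
      rw [← inner_conj_left, hUd, inner_add_left, real_inner_smul_left, inner_add_left,
        real_inner_smul_left, real_inner_smul_left] at h1
      linarith
    have hder : HasDerivAt (fun t => (d l - d k) *
        (Real.sin t ^ 2 * A + Real.sin t * Real.cos t * B)) ((d l - d k) * B) 0 := by
      have := ((((Real.hasDerivAt_sin 0).pow 2).mul_const A).add
        (((Real.hasDerivAt_sin 0).mul (Real.hasDerivAt_cos 0)).mul_const B)).const_mul (d l - d k)
      refine this.congr_deriv ?_
      simp
    have hmax : IsLocalMax (fun t => (d l - d k) *
        (Real.sin t ^ 2 * A + Real.sin t * Real.cos t * B)) 0 :=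
      Filter.Eventually.of_forall fun t => by simpa using hle t
    have hz := hmax.hasDerivAt_eq_zero hder
    have hdkl : d l - d k ≠ 0 := by
      rw [sub_ne_zero, hd]; exact fun h => hkl (Fin.ext (Nat.cast_injective h)).symm
    exact (mul_eq_zero.1 hz).resolve_left hdkl
  have hyd : y = diag fun i => β.re (y.mat i i) := by
    refine ext_mat fun i j => ?_
    by_cases hij : i = j
    · subst hij
      rw [diag_apply_same]
      exact β.eq_algebraMap_of_star (y.star_apply i i)
    · rw [hoff i j hij, mat_diag, Matrix.diagonal_apply_ne _ hij]
  set w : Fin n → ℝ := fun i => β.re (y.mat i i) with hw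
  rw [Metric.mem_closure_iff]
  intro ε hε
  obtain ⟨x, ⟨U, hU, rfl⟩, hx⟩ := Metric.mem_closure_iff.1 hyO (ε / 2) (half_pos hε)
  have hcont : Continuous fun t : ℝ => dist y (diagL (w + t • d)) := by fun_prop
  have h0 : dist y (diagL (w + (0 : ℝ) • d)) < ε / 2 := by
    rw [zero_smul, add_zero, diagL_apply, ← hyd, dist_self]; exact half_pos hε
  have h1 : ∀ᶠ t : ℝ in 𝓝[≠] 0, dist y (diagL (w + t • d)) < ε / 2 :=
    (hcont.continuousAt.eventually_lt continuousAt_const h0).filter_mono nhdsWithin_le_nhds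
  obtain ⟨t, ht1, ht2⟩ := (h1.and (eventually_injective_add_smul w)).exists
  refine ⟨conj (star U) (diag (w + t • d)), ⟨star U, Unitary.star_mem hU, _, ht2, rfl⟩, ?_⟩
  have h3 : dist θ (conj (star U) (diag (w + t • d))) = dist (conj U θ) (diag (w + t • d)) := by
    rw [← (conjE U hU).dist_map, conjE_apply, conjE_apply, conj_conj_star hU]
  rw [h3]
  calc dist (conj U θ) (diag (w + t • d)) ≤ dist (conj U θ) y + dist y (diag (w + t • d)) :=
        dist_triangle _ _ _
    _ < ε / 2 + ε / 2 := add_lt_add (by rwa [dist_comm]) ht1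
    _ = ε := add_halves ε

theorem sq_offDiag {k l : Fin n} (hkl : k ≠ l) {u : β.Scalar} (hu : u * star u = 1)
    (hu' : star u * u = 1) :
    sq (offDiag k l u : Herm β n) = diag (Pi.single k 1 + Pi.single l 1) := by
  apply mat_injective
  rw [mat_sq, mat_offDiag, add_mul, mul_add, mul_add]
  simp only [Matrix.single_mul_single_same, hu, hu', ne_eq, hkl, hkl.symm, not_false_eq_true,
    Matrix.single_mul_single_of_ne, zero_add, add_zero]
  rw [mat_diag]
  ext i j
  simp only [Matrix.add_apply, Matrix.single_apply, Matrix.diagonal_apply, Pi.add_apply,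
    Pi.single_apply]
  grind

theorem offDiag_self (k : Fin n) (u : β.Scalar) :
    (offDiag k k u : Herm β n) = (2 * β.re u) • diag (Pi.single k 1) := by
  rw [← diagL_apply, ← map_smul, diagL_apply]
  apply mat_injective
  rw [mat_offDiag, ← Matrix.single_add, β.add_star, mat_diag]
  ext i j
  simp only [Matrix.single_apply, Matrix.diagonal_apply, Pi.smul_apply, Pi.single_apply,
    smul_eq_mul, mul_ite, mul_one, mul_zero]
  grind

theorem tripleL_one (x y : Herm β n) :
    (tripleL x y 1).mat = (2⁻¹ : ℝ) • (x.mat * y.mat + y.mat * x.mat) := by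
  change (triple x 1 y).mat = _
  rw [mat_triple, mat_one, mul_one, mul_one]

theorem tripleL_self_one (x : Herm β n) : tripleL x x 1 = sq x := by
  apply mat_injective
  rw [tripleL_one, mat_sq]
  module

theorem tripleL_smul_right (c : ℝ) (x y : Herm β n) : tripleL x (c • y) = c • tripleL x y := by
  rw [tripleL_comm, tripleL_smul_left, tripleL_comm]

theorem tripleL_diag_one (v w : Fin n → ℝ) :
    tripleL (diag v : Herm β n) (diag w) 1 = diag (v * w) := by
  apply mat_injective
  rw [tripleL_one, mat_diag, mat_diag, Matrix.diagonal_mul_diagonal, Matrix.diagonal_mul_diagonal,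
    mat_diag]
  simp_rw [← map_mul, mul_comm (w _), Pi.mul_apply]
  module

/-- The square of `offDiag k l u` is `E_kk + E_ll` for a unit `u`. Each ordered pair `k ≠ l` thus
contributes `β/4 · λ_kl` to the entries `k` and `l`, and an index `i` is met as first and as second
member, which gives the factor `β/2`. -/
theorem Psi_one_of_offDiag (T : Herm β n →ₗ[ℝ] Herm β n) (lam : Fin n → Fin n → ℝ)
    (hsymm : ∀ k l, lam k l = lam l k)
    (hoff : ∀ k l, k ≠ l → ∀ m, T (offDiag k l (β.unit m)) = lam k l • offDiag k l (β.unit m))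
    (τ : Fin n → Fin n → ℝ) (hdiag : ∀ k, T (diag (Pi.single k 1)) = diag (τ k)) :
    Psi T 1 = diag fun i => τ i i + β.val / 2 * ∑ j ∈ Finset.univ.erase i, lam i j := by
  have h1 : ∀ k l, ∑ m, (4⁻¹ : ℝ) •
      tripleL (offDiag k l (β.unit m)) (T (offDiag k l (β.unit m))) (1 : Herm β n) =
      diagL (if k = l then Pi.single k (τ k k) else
        (β.val / 4 * lam k l) • (Pi.single k 1 + Pi.single l 1)) := by
    intro k l
    split_ifs with h
    · subst h
      have h2 : ∀ m, (4⁻¹ : ℝ) •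
          tripleL (offDiag k k (β.unit m)) (T (offDiag k k (β.unit m))) (1 : Herm β n) =
          (β.re (β.unit m) * β.re (β.unit m)) • diagL (Pi.single k (τ k k)) := by
        intro m
        rw [offDiag_self, map_smul, hdiag, tripleL_smul_left, tripleL_smul_right,
          LinearMap.smul_apply, LinearMap.smul_apply, tripleL_diag_one, smul_smul, smul_smul,
          diagL_apply]
        have h3 : (Pi.single k 1 * τ k : Fin n → ℝ) = Pi.single k (τ k k) := by
          funext i
          by_cases h : i = k
          · subst h; simp
          · simp [h]
        rw [h3]
        congr 1
        ring
      simp_rw [h2]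
      rw [← Finset.sum_smul, β.sum_re_unit_mul_self, one_smul]
    · have h2 : ∀ m, (4⁻¹ : ℝ) •
          tripleL (offDiag k l (β.unit m)) (T (offDiag k l (β.unit m))) (1 : Herm β n) =
          (4⁻¹ * lam k l) • diagL (Pi.single k 1 + Pi.single l 1) := by
        intro m
        rw [hoff k l h, tripleL_smul_right, LinearMap.smul_apply, tripleL_self_one,
          sq_offDiag h (β.unit_mul_star m) (β.star_mul_unit m), smul_smul, diagL_apply]
      simp_rw [h2]
      rw [Finset.sum_const, Finset.card_univ, Fintype.card_fin, map_smul, ← Nat.cast_smul_eq_nsmul ℝ,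
        smul_smul, β.dim_cast]
      congr 1
      ring
  rw [Psi_eq_sum_offDiag]
  simp only [LinearMap.sum_apply, LinearMap.smul_apply]
  simp_rw [h1]
  simp_rw [← map_sum]
  rw [diagL_apply]
  congr 1
  funext i
  simp only [Finset.sum_apply]
  have h2 : ∀ k l, (if k = l then Pi.single k (τ k k) else
      (β.val / 4 * lam k l) • (Pi.single k 1 + Pi.single l 1) : Fin n → ℝ) i =
      (if k = l then if k = i then τ i i else 0 else 0) +
      ((if k = i then if k ≠ l then β.val / 4 * lam i l else 0 else 0) +
       (if l = i then if k ≠ l then β.val / 4 * lam k i else 0 else 0)) := by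
    intro k l
    by_cases h : k = l
    · subst h
      by_cases h' : k = i
      · subst h'; simp
      · simp [h', Ne.symm h']
    · by_cases h' : k = i
      · subst h'; simp [h, Ne.symm h]
      · by_cases h'' : l = i
        · subst h''; simp [h]
        · simp [h, h', h'', Ne.symm h', Ne.symm h'']
  simp_rw [h2]
  simp only [Finset.sum_add_distrib]
  have e1 : ∑ k : Fin n, ∑ l : Fin n, (if k = l then if k = i then τ i i else 0 else 0) = τ i i := by
    simp
  have e2 : ∑ k : Fin n, ∑ l : Fin n,
      (if k = i then if k ≠ l then β.val / 4 * lam i l else 0 else 0) =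
      β.val / 4 * ∑ j ∈ Finset.univ.erase i, lam i j := by
    rw [Finset.sum_eq_single i]
    · simp only [if_true, Finset.mul_sum]
      rw [← Finset.sum_filter]
      congr 1
      ext j; simp [eq_comm]
    · intro k _ hk; simp [hk]
    · simp
  have e3 : ∑ k : Fin n, ∑ l : Fin n,
      (if l = i then if k ≠ l then β.val / 4 * lam k i else 0 else 0) =
      β.val / 4 * ∑ j ∈ Finset.univ.erase i, lam i j := by
    rw [Finset.sum_comm, Finset.sum_eq_single i]
    · simp only [if_true, Finset.mul_sum, hsymm _ i]
      rw [← Finset.sum_filter]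
      congr 1
      ext j; simp
    · intro k _ hk; simp [hk]
    · simp
  rw [e1, e2, e3]
  ring

/-! ### Derivatives of equivariant fields. -/

variable {Θ : Set (Herm β n)} {g : Herm β n → Herm β n}

/-- The value of an equivariant field is fixed by every unitary that fixes the point. -/
theorem equivariant_diag
    (hg : ∀ U ∈ unitary (Matrix (Fin n) (Fin n) β.Scalar), ∀ θ ∈ Θ, g (conj U θ) = conj U (g θ))
    {w : Fin n → ℝ} (hw : diag w ∈ Θ) :
    g (diag w) = diag fun i => β.re ((g (diag w)).mat i i) :=
  eq_diag_of_conj_invariant _ fun U hU h => by rw [← hg U hU _ hw, h]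

/-- Differentiating `g(U y U*) = U g(y) U*` at a point fixed by `U` shows that the derivative
commutes with the conjugation. -/
theorem equivariant_fderiv (hΘ : IsOpen Θ)
    (hg : ∀ U ∈ unitary (Matrix (Fin n) (Fin n) β.Scalar), ∀ θ ∈ Θ, g (conj U θ) = conj U (g θ))
    {x : Herm β n} (hx : x ∈ Θ) {T : Herm β n →L[ℝ] Herm β n} (hT : HasFDerivAt g T x)
    {U : Matrix (Fin n) (Fin n) β.Scalar} (hU : U ∈ unitary _) (hUx : conj U x = x)
    (h : Herm β n) : T (conj U h) = conj U (T h) := by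
  let C : Herm β n →L[ℝ] Herm β n := (conjE U hU).toContinuousLinearEquiv
  have hC : ∀ y, C y = conj U y := fun _ => rfl
  have h1 : HasFDerivAt (g ∘ C) (T.comp C) x := by
    refine HasFDerivAt.comp x ?_ C.hasFDerivAt
    rw [hC, hUx]; exact hT
  have h2 : HasFDerivAt (C ∘ g) (C.comp T) x := C.hasFDerivAt.comp x hT
  have h3 : g ∘ C =ᶠ[𝓝 x] C ∘ g := by
    filter_upwards [hΘ.mem_nhds hx] with y hy
    exact hg U hU y hy
  have h4 := (h1.congr_of_eventuallyEq h3.symm).unique h2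
  exact congrArg (fun L : Herm β n →L[ℝ] Herm β n => L h) h4

/-- The derivative of an equivariant field at a diagonal matrix acts on off-diagonal matrices by
divided differences. -/
theorem equivariant_fderiv_offDiag
    (hg : ∀ U ∈ unitary (Matrix (Fin n) (Fin n) β.Scalar), ∀ θ ∈ Θ, g (conj U θ) = conj U (g θ))
    {v : Fin n → ℝ} (hv : diag v ∈ Θ) {T : Herm β n →L[ℝ] Herm β n}
    (hT : HasFDerivAt g T (diag v)) {γ : Fin n → ℝ} (hγ : g (diag v) = diag γ)
    {k l : Fin n} (hkl : k ≠ l) (m : Fin β.dim) :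
    (v l - v k) • T (offDiag k l (β.unit m)) = (γ l - γ k) • offDiag k l (β.unit m) := by
  set X : Herm β n := offDiag k l (β.unit m)
  set D : Herm β n := diag (Pi.single k 1 - Pi.single l 1)
  have hcurve : ∀ c : ℝ, ∀ y : Herm β n, HasDerivAt (fun t : ℝ => y + c •
      (Real.sin t ^ 2 • D + (Real.sin t * Real.cos t) • X)) (c • X) 0 := by
    intro c y
    have := (((((Real.hasDerivAt_sin 0).pow 2).smul_const D).add
        (((Real.hasDerivAt_sin 0).mul (Real.hasDerivAt_cos 0)).smul_const X)).const_smul c).const_add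
        y
    refine this.congr_deriv ?_
    simp
  -- The point and its image are both diagonal, so one rotation moves them along the same curve,
  -- scaled by `v l - v k` and `γ l - γ k`. Derivatives at `t = 0` are then compared.
  have heq : ∀ t : ℝ, g (diag v + (v l - v k) •
      (Real.sin t ^ 2 • D + (Real.sin t * Real.cos t) • X)) = diag γ + (γ l - γ k) •
      (Real.sin t ^ 2 • D + (Real.sin t * Real.cos t) • X) := by
    intro t
    obtain ⟨U, hU, hUd⟩ := exists_plane_rotation (n := n) hkl (β.unit_mul_star m)
        (β.star_mul_unit m) t
    rw [← hUd, ← hUd, hg U hU _ hv, hγ]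
  have h1 := hcurve (v l - v k) (diag v)
  have h2 : HasDerivAt (fun t : ℝ => g (diag v + (v l - v k) •
      (Real.sin t ^ 2 • D + (Real.sin t * Real.cos t) • X))) (T ((v l - v k) • X)) 0 := by
    refine HasFDerivAt.comp_hasDerivAt (0 : ℝ) ?_ h1
    simpa using hT
  simp_rw [heq] at h2
  rw [← map_smul]
  exact h2.unique (hcurve (γ l - γ k) (diag γ))

/-- The derivative commutes with the stabilizer of `diag v`, hence maps diagonal matrices to
diagonal ones; in off-diagonal directions it is multiplication by a divided difference. This is the
situation of `Psi_one_of_offDiag`. -/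
theorem Psi_fderiv_equivariant (hΘ : IsOpen Θ)
    (hg : ∀ U ∈ unitary (Matrix (Fin n) (Fin n) β.Scalar), ∀ θ ∈ Θ, g (conj U θ) = conj U (g θ))
    {v : Fin n → ℝ} (hv : diag v ∈ Θ) (hinj : Function.Injective v) {T : Herm β n →L[ℝ] Herm β n}
    (hT : HasFDerivAt g T (diag v)) {γ : Fin n → ℝ} (hγ : g (diag v) = diag γ) :
    Psi (T : Herm β n →ₗ[ℝ] Herm β n) 1 = diag fun i =>
      inner ℝ (diag (Pi.single i 1)) (T (diag (Pi.single i 1))) +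
        β.val / 2 * ∑ j ∈ Finset.univ.erase i, (γ i - γ j) / (v i - v j) := by
  have hd : ∀ k, T (diag (Pi.single k 1)) =
      diag fun i => β.re ((T (diag (Pi.single k 1))).mat i i) := by
    intro k
    refine eq_diag_of_conj_invariant _ fun U hU h => ?_
    rw [← equivariant_fderiv hΘ hg hv hT hU (h v), h]
  refine (Psi_one_of_offDiag _ (fun k l => (γ k - γ l) / (v k - v l)) ?_ ?_
    (fun k i => β.re ((T (diag (Pi.single k 1))).mat i i)) hd).trans ?_
  · intro k l
    rw [← neg_sub (γ l), ← neg_sub (v l), neg_div_neg_eq]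
  · intro k l hkl m
    have h1 := equivariant_fderiv_offDiag hg hv hT hγ hkl m
    have hne : v l - v k ≠ 0 := sub_ne_zero.2 fun h => hkl (hinj h).symm
    rw [← neg_sub (γ l), ← neg_sub (v l), neg_div_neg_eq, div_eq_inv_mul, mul_smul, ← h1,
      smul_smul, inv_mul_cancel₀ hne, one_smul]
    rfl
  · congr 1
    funext i
    congr 1
    rw [inner_diag_left]
    simp [Pi.single_apply]

end Herm

/-! ### Elementary symmetric functions with some variables omitted. -/

section SymmetricFunctions

/-- The `m`-th elementary symmetric function of the numbers `v k`, `k ∈ T`; it is `0` for `m < 0`. -/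
noncomputable def esub (v : Fin n → ℝ) (T : Finset (Fin n)) (m : ℤ) : ℝ :=
  if 0 ≤ m then (T.val.map v).esymm m.toNat else 0

theorem esub_neg (v : Fin n → ℝ) (T : Finset (Fin n)) {m : ℤ} (hm : m < 0) : esub v T m = 0 :=
  if_neg (not_le.2 hm)

theorem esub_natCast (v : Fin n → ℝ) (T : Finset (Fin n)) (m : ℕ) :
    esub v T m = (T.val.map v).esymm m := by
  simp [esub]

theorem esub_zero (v : Fin n → ℝ) (T : Finset (Fin n)) : esub v T 0 = 1 := by
  simp [esub, Multiset.esymm]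

theorem esub_of_card_lt (v : Fin n → ℝ) (T : Finset (Fin n)) {m : ℤ} (hm : (T.card : ℤ) < m) :
    esub v T m = 0 := by
  have h0 : 0 ≤ m := by omega
  lift m to ℕ using h0
  rw [esub_natCast, Multiset.esymm, Multiset.powersetCard_eq_empty]
  · simp
  · rw [Multiset.card_map]
    exact_mod_cast hm

theorem esub_insert (v : Fin n → ℝ) {T : Finset (Fin n)} {j : Fin n} (hj : j ∉ T) (m : ℤ) :
    esub v (insert j T) m = esub v T m + v j * esub v T (m - 1) := by
  rcases lt_trichotomy m 0 with hm | rfl | hm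
  · rw [esub_neg v _ hm, esub_neg v _ hm, esub_neg v _ (by omega)]; ring
  · rw [esub_zero, esub_zero, esub_neg v _ (by omega)]; ring
  · obtain ⟨k, rfl⟩ : ∃ k : ℕ, m = k + 1 := ⟨(m - 1).toNat, by omega⟩
    rw [add_sub_cancel_right, show ((k : ℤ) + 1) = ((k + 1 : ℕ) : ℤ) by push_cast; rfl,
      esub_natCast, esub_natCast, esub_natCast, Finset.insert_val_of_notMem hj, Multiset.map_cons,
      Multiset.esymm, Multiset.powersetCard_cons, Multiset.map_add, Multiset.sum_add,
      Multiset.map_map, Multiset.esymm, Multiset.esymm]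
    congr 1
    simp [Multiset.sum_map_mul_left]

theorem esub_eq_erase (v : Fin n → ℝ) {T : Finset (Fin n)} {j : Fin n} (hj : j ∈ T) (m : ℤ) :
    esub v T m = esub v (T.erase j) m + v j * esub v (T.erase j) (m - 1) := by
  conv_lhs => rw [← Finset.insert_erase hj]
  exact esub_insert v (Finset.notMem_erase j T) m

theorem esub_congr {v w : Fin n → ℝ} {T : Finset (Fin n)} (h : ∀ k ∈ T, v k = w k) (m : ℤ) :
    esub v T m = esub w T m := by
  unfold esub
  rw [Multiset.map_congr rfl fun k hk => h k hk]

theorem esub_smul (t : ℝ) (v : Fin n → ℝ) (T : Finset (Fin n)) (m : ℕ) :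
    esub (t • v) T m = t ^ m * esub v T m := by
  induction T using Finset.induction_on generalizing m with
  | empty =>
    rcases m with _ | m
    · simp [esub_zero]
    · rw [esub_of_card_lt _ _ (by simp), esub_of_card_lt _ _ (by simp), mul_zero]
  | insert a T ha ih =>
    rw [esub_insert _ ha, esub_insert _ ha, ih]
    rcases m with _ | m
    · simp [esub_neg]
    · rw [show ((m + 1 : ℕ) : ℤ) - 1 = (m : ℤ) by push_cast; ring, ih, Pi.smul_apply, smul_eq_mul]
      ring

/-- A monomial of degree `m` survives the removal of `j` precisely for the `|T| - m` indices `j`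
that it does not contain. -/
theorem sum_esub_erase (v : Fin n → ℝ) (T : Finset (Fin n)) (m : ℤ) :
    ∑ j ∈ T, esub v (T.erase j) m = (T.card - m) * esub v T m := by
  induction T using Finset.induction_on generalizing m with
  | empty =>
    rcases lt_trichotomy m 0 with hm | rfl | hm
    · simp [esub_neg v _ hm]
    · simp
    · simp [esub_of_card_lt v ∅ (m := m) (by simpa using hm)]
  | insert a T ha ih =>
    rw [Finset.sum_insert ha, Finset.erase_insert ha, Finset.card_insert_of_notMem ha,
      esub_insert v ha]
    have h1 : ∀ j ∈ T, esub v ((insert a T).erase j) m =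
        esub v (T.erase j) m + v a * esub v (T.erase j) (m - 1) := by
      intro j hj
      have hja : a ≠ j := fun h => ha (h ▸ hj)
      rw [Finset.erase_insert_of_ne hja, esub_insert v]
      exact fun h => ha (Finset.mem_of_mem_erase h)
    rw [Finset.sum_congr rfl h1, Finset.sum_add_distrib, ← Finset.mul_sum, ih, ih]
    push_cast
    ring

/-- Newton's identity for the second power sum. It is used to see that `σ → 0` forces all
eigenvalues to `0`. -/
theorem sum_sq_eq_esub (v : Fin n → ℝ) (T : Finset (Fin n)) :
    ∑ k ∈ T, v k ^ 2 = esub v T 1 ^ 2 - 2 * esub v T 2 := by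
  induction T using Finset.induction_on with
  | empty =>
    rw [esub_of_card_lt v ∅ (by simp), esub_of_card_lt v ∅ (by simp)]
    simp
  | insert a T ha ih =>
    rw [Finset.sum_insert ha, esub_insert v ha, esub_insert v ha, ih]
    norm_num [esub_zero]
    ring

theorem prod_add_eq_esub (v : Fin n → ℝ) (T : Finset (Fin n)) (x : ℝ) :
    ∏ k ∈ T, (x + v k) = ∑ j ∈ Finset.range (T.card + 1), esub v T j * x ^ (T.card - j) := by
  have h := congrArg (Polynomial.eval x) (Multiset.prod_X_add_C_eq_sum_esymm (T.val.map v))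
  rw [Polynomial.eval_finsetSum, Multiset.card_map] at h
  simp only [Polynomial.eval_mul, Polynomial.eval_C, Polynomial.eval_pow, Polynomial.eval_X,
    Multiset.map_map, Function.comp_def] at h
  have h2 : (Multiset.map (fun i => (Polynomial.X + Polynomial.C (v i))) T.val).prod =
      ∏ k ∈ T, (Polynomial.X + Polynomial.C (v k)) := rfl
  rw [h2, Polynomial.eval_prod] at h
  simp only [Polynomial.eval_add, Polynomial.eval_X, Polynomial.eval_C] at h
  simp_rw [esub_natCast]
  exact h

theorem elemSymm_apply (v : Fin n → ℝ) (i : Fin n) :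
    elemSymm v i = esub v Finset.univ ((i : ℤ) + 1) := by
  rw [show ((i : ℤ) + 1) = ((i.val + 1 : ℕ) : ℤ) by push_cast; rfl, esub_natCast]
  rfl

theorem coord_elemSymm (v : Fin n → ℝ) (m : ℤ) :
    coord (elemSymm v) m = esub v Finset.univ m := by
  unfold coord
  split_ifs with h
  · rw [h, esub_zero]
  by_cases hm : 1 ≤ m ∧ m ≤ n
  · rw [Finset.sum_eq_single (⟨(m - 1).toNat, by omega⟩ : Fin n)]
    · rw [if_pos (by simp; omega), elemSymm_apply]
      congr 1
      simp; omega
    · intro i _ hi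
      rw [if_neg]
      intro h'
      apply hi
      ext
      simp; omega
    · simp
  · rw [Finset.sum_eq_zero]
    · rcases not_and_or.1 hm with h1 | h1
      · rw [esub_neg v _ (by omega)]
      · rw [esub_of_card_lt v _ (by simp; omega)]
    · intro i _
      rw [if_neg]
      have := i.2
      omega

/-- The elementary symmetric functions are the coefficients of `∏ (x + v k)`, so each `v i` is one
of the `w j`; distinctness of the `v i` makes the matching injective, hence bijective. -/
theorem exists_perm_of_elemSymm_eq {v w : Fin n → ℝ} (hv : Function.Injective v)
    (h : elemSymm v = elemSymm w) : ∃ π : Equiv.Perm (Fin n), v = w ∘ π := by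
  have h1 : ∀ x : ℝ, ∏ k, (x + v k) = ∏ k, (x + w k) := by
    intro x
    rw [prod_add_eq_esub, prod_add_eq_esub]
    simp_rw [← coord_elemSymm, h]
  have h2 : ∀ i, ∃ j, w j = v i := by
    intro i
    have h3 := h1 (-v i)
    rw [Finset.prod_eq_zero (Finset.mem_univ i) (by ring)] at h3
    obtain ⟨j, _, hj⟩ := Finset.prod_eq_zero_iff.1 h3.symm
    exact ⟨j, by linarith⟩
  choose π hπ using h2
  have hinj : Function.Injective π := fun i j hij => hv (by rw [← hπ, ← hπ, hij])
  exact ⟨Equiv.ofBijective π (Finite.injective_iff_bijective.1 hinj), funext fun i => (hπ i).symm⟩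

theorem esub_comp_perm (v : Fin n → ℝ) (π : Equiv.Perm (Fin n)) (T : Finset (Fin n)) (m : ℤ) :
    esub (v ∘ π) T m = esub v (T.map π.toEmbedding) m := by
  unfold esub
  simp

theorem elemSymm_comp_perm (v : Fin n → ℝ) (π : Equiv.Perm (Fin n)) :
    elemSymm (v ∘ π) = elemSymm v := by
  funext i
  rw [elemSymm_apply, elemSymm_apply, esub_comp_perm]
  simp

/-- The Jacobian matrix of the elementary symmetric functions, transposed. -/
noncomputable def esymmJacobian (v : Fin n → ℝ) : Matrix (Fin n) (Fin n) ℝ :=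
  Matrix.of fun i r => esub v (Finset.univ.erase i) r

/-- A left null vector `w` makes the polynomial `∑ₖ wₖ ∏_{l≠k} (x + v l)` vanish identically, since
its coefficients are the components of `w J`. Evaluation at `x = -v i` isolates `w i`. -/
theorem det_esymmJacobian_ne_zero {v : Fin n → ℝ} (hv : Function.Injective v) :
    (esymmJacobian v).det ≠ 0 := by
  intro h0
  obtain ⟨w, hw, hw0⟩ := Matrix.exists_vecMul_eq_zero_iff.2 h0
  apply hw
  funext i
  have h1 : ∀ x : ℝ, ∑ k, w k * ∏ l ∈ Finset.univ.erase k, (x + v l) = 0 := by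
    intro x
    have h2 : ∀ k : Fin n, ∏ l ∈ Finset.univ.erase k, (x + v l) =
        ∑ j ∈ Finset.range n, esub v (Finset.univ.erase k) j * x ^ (n - 1 - j) := by
      intro k
      rw [prod_add_eq_esub, Finset.card_erase_of_mem (Finset.mem_univ k), Finset.card_univ,
        Fintype.card_fin, Nat.sub_add_cancel (Fin.pos k)]
    simp_rw [h2, Finset.mul_sum]
    rw [Finset.sum_comm]
    refine Finset.sum_eq_zero fun j hj => ?_
    have h3 := congrFun hw0 ⟨j, Finset.mem_range.1 hj⟩
    rw [Matrix.vecMul, dotProduct] at h3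
    simp only [esymmJacobian, Matrix.of_apply, Pi.zero_apply] at h3
    simp_rw [← mul_assoc]
    rw [← Finset.sum_mul, h3, zero_mul]
  have h4 := h1 (-v i)
  rw [Finset.sum_eq_single i] at h4
  · refine (mul_eq_zero.1 h4).resolve_right (Finset.prod_ne_zero_iff.2 fun l hl => ?_)
    have : v l ≠ v i := fun h => (Finset.mem_erase.1 hl).1 (hv h)
    intro h; apply this; linarith
  · intro k _ hk
    rw [Finset.prod_eq_zero (Finset.mem_erase.2 ⟨hk.symm, Finset.mem_univ i⟩) (by ring), mul_zero]
  · simp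

theorem sum_Icc_eq_sum_fin (F : ℕ → ℝ) : ∑ j ∈ Finset.Icc 1 n, F j = ∑ r : Fin n, F (r + 1) := by
  rw [Fin.sum_univ_eq_sum_range (fun r => F (r + 1)), Finset.range_eq_Ico,
    Finset.sum_Ico_add' F 0 n 1]
  rfl

/-- Comparison of coefficients: this is how one equation per eigenvalue becomes one equation per
component of `𝔻(g)`. -/
theorem eq_of_sum_esub_eq {v : Fin n → ℝ} (hv : Function.Injective v) {a b : ℕ → ℝ}
    (h : ∀ i, ∑ j ∈ Finset.Icc 1 n, a j * esub v (Finset.univ.erase i) ((j : ℤ) - 1) =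
      ∑ j ∈ Finset.Icc 1 n, b j * esub v (Finset.univ.erase i) ((j : ℤ) - 1)) :
    ∀ j ∈ Finset.Icc 1 n, a j = b j := by
  have h1 : (esymmJacobian v).mulVec (fun r : Fin n => a (r + 1) - b (r + 1)) = 0 := by
    funext i
    have h2 := h i
    rw [sum_Icc_eq_sum_fin, sum_Icc_eq_sum_fin, ← sub_eq_zero, ← Finset.sum_sub_distrib] at h2
    rw [Matrix.mulVec, dotProduct, Pi.zero_apply, ← h2]
    refine Finset.sum_congr rfl fun r _ => ?_
    simp [esymmJacobian]
    ring
  have h3 := Matrix.eq_zero_of_mulVec_eq_zero (det_esymmJacobian_ne_zero hv) h1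
  intro j hj
  rw [Finset.mem_Icc] at hj
  have h4 := congrFun h3 ⟨j - 1, by omega⟩
  simp only [Pi.zero_apply, Nat.sub_add_cancel hj.1] at h4
  linarith

/-- In the part without `x`, the reflection `j ↦ r + s - j` matches the terms `j > s` with the terms
`j < r`, so only `j = s` is left. In the part with `x`, the reflection `j ↦ r + s - 1 - j` matches
everything. -/
theorem sum_Icc_convolution_aux (c : ℤ → ℝ) (hneg : ∀ m < 0, c m = 0)
    (hbig : ∀ m, (n : ℤ) ≤ m → c m = 0) (x : ℝ) {r s : ℕ} (hr : 1 ≤ r) (hrs : r ≤ s)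
    (hs : s ≤ n) :
    ∑ j ∈ Finset.Icc s n, c (j - 1) * (c ((r : ℤ) + s - 1 - j) + x * c ((r : ℤ) + s - 2 - j)) -
      ∑ j ∈ Finset.Icc 1 (r - 1),
        c (j - 1) * (c ((r : ℤ) + s - 1 - j) + x * c ((r : ℤ) + s - 2 - j)) =
      c (r - 1) * c (s - 1) := by
  simp only [mul_add, Finset.sum_add_distrib]
  have h1 : ∑ j ∈ Finset.Icc s n, c (j - 1) * c ((r : ℤ) + s - 1 - j) =
      c (r - 1) * c (s - 1) + ∑ j ∈ Finset.Icc 1 (r - 1), c (j - 1) * c ((r : ℤ) + s - 1 - j) := by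
    rw [← Finset.add_sum_Ioc_eq_sum_Icc hs]
    congr 1
    · rw [show (r : ℤ) + s - 1 - s = r - 1 by ring, mul_comm]
    · have e1 : ∑ j ∈ Finset.Ioc s n, c (j - 1) * c ((r : ℤ) + s - 1 - j) =
          ∑ j ∈ Finset.Ioc s (n + r + s), c (j - 1) * c ((r : ℤ) + s - 1 - j) := by
        refine Finset.sum_subset (Finset.Ioc_subset_Ioc_right (by omega)) fun j hj hj' => ?_
        rw [Finset.mem_Ioc] at hj hj'
        rw [hbig _ (by omega), zero_mul]
      have e2 : ∑ j ∈ Finset.Ioc s (r + s - 1), c (j - 1) * c ((r : ℤ) + s - 1 - j) =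
          ∑ j ∈ Finset.Ioc s (n + r + s), c (j - 1) * c ((r : ℤ) + s - 1 - j) := by
        refine Finset.sum_subset (Finset.Ioc_subset_Ioc_right (by omega)) fun j hj hj' => ?_
        rw [Finset.mem_Ioc] at hj hj'
        rw [hneg ((r : ℤ) + s - 1 - j) (by omega), mul_zero]
      rw [e1, ← e2]
      refine Finset.sum_nbij' (fun j => r + s - j) (fun j => r + s - j) ?_ ?_ ?_ ?_ ?_
      · intro j hj; rw [Finset.mem_Ioc] at hj; rw [Finset.mem_Icc]; omega
      · intro j hj; rw [Finset.mem_Icc] at hj; rw [Finset.mem_Ioc]; omega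
      · intro j hj; rw [Finset.mem_Ioc] at hj; omega
      · intro j hj; rw [Finset.mem_Icc] at hj; omega
      · intro j hj
        rw [Finset.mem_Ioc] at hj
        rw [mul_comm]
        congr 2 <;> omega
  have h2 : ∑ j ∈ Finset.Icc s n, c (j - 1) * (x * c ((r : ℤ) + s - 2 - j)) =
      ∑ j ∈ Finset.Icc 1 (r - 1), c (j - 1) * (x * c ((r : ℤ) + s - 2 - j)) := by
    have e1 : ∑ j ∈ Finset.Icc s n, c (j - 1) * (x * c ((r : ℤ) + s - 2 - j)) =
        ∑ j ∈ Finset.Icc s (n + r + s), c (j - 1) * (x * c ((r : ℤ) + s - 2 - j)) := by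
      refine Finset.sum_subset (Finset.Icc_subset_Icc_right (by omega)) fun j hj hj' => ?_
      rw [Finset.mem_Icc] at hj hj'
      rw [hbig _ (by omega), zero_mul]
    have e2 : ∑ j ∈ Finset.Icc s (r + s - 2), c (j - 1) * (x * c ((r : ℤ) + s - 2 - j)) =
        ∑ j ∈ Finset.Icc s (n + r + s), c (j - 1) * (x * c ((r : ℤ) + s - 2 - j)) := by
      refine Finset.sum_subset (Finset.Icc_subset_Icc_right (by omega)) fun j hj hj' => ?_
      rw [Finset.mem_Icc] at hj hj'
      rw [hneg ((r : ℤ) + s - 2 - j) (by omega), mul_zero, mul_zero]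
    rw [e1, ← e2]
    refine Finset.sum_nbij' (fun j => r + s - 1 - j) (fun j => r + s - 1 - j) ?_ ?_ ?_ ?_ ?_
    · intro j hj; rw [Finset.mem_Icc] at hj ⊢; omega
    · intro j hj; rw [Finset.mem_Icc] at hj ⊢; omega
    · intro j hj; rw [Finset.mem_Icc] at hj; omega
    · intro j hj; rw [Finset.mem_Icc] at hj; omega
    · intro j hj
      rw [Finset.mem_Icc] at hj
      rw [show ((r + s - 1 - j : ℕ) : ℤ) - 1 = (r : ℤ) + s - 2 - j by omega,
        show (r : ℤ) + s - 2 - ((r + s - 1 - j : ℕ) : ℤ) = (j : ℤ) - 1 by omega]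
      ring
  rw [h1, h2]
  ring

/-- To be used with `c m = e_m` of the eigenvalues other than `x = v i`; then `c m + x c (m - 1)` is
`σ_m`. The product `e_{r-1} e_{s-1}`, the coefficient of `g_rs` in `∂ᵢ²`, is re-expanded in the
`e_{j-1}`, and the two indicators become the two double sums of `𝔻`. -/
theorem sum_Icc_convolution (c : ℤ → ℝ) (hneg : ∀ m < 0, c m = 0)
    (hbig : ∀ m, (n : ℤ) ≤ m → c m = 0) (x : ℝ) {r s : ℕ} (hr : r ∈ Finset.Icc 1 n)
    (hs : s ∈ Finset.Icc 1 n) :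
    ∑ j ∈ Finset.Icc 1 n, c (j - 1) * (((if r ≤ j ∧ s ≤ j then 1 else 0) -
        (if j < r ∧ j < s then 1 else 0)) *
        (c ((r : ℤ) + s - 1 - j) + x * c ((r : ℤ) + s - 2 - j))) = c (r - 1) * c (s - 1) := by
  wlog hrs : r ≤ s generalizing r s
  · have h := this hs hr (by omega)
    rw [mul_comm (c (r - 1)), ← h]
    refine Finset.sum_congr rfl fun j _ => ?_
    simp only [and_comm, add_comm (r : ℤ)]
  rw [Finset.mem_Icc] at hr hs
  rw [← sum_Icc_convolution_aux c hneg hbig x hr.1 hrs hs.2]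
  set F : ℕ → ℝ := fun j =>
    c (j - 1) * (c ((r : ℤ) + s - 1 - j) + x * c ((r : ℤ) + s - 2 - j)) with hF
  have e1 : Finset.Icc s n = (Finset.Icc 1 n).filter (fun j => r ≤ j ∧ s ≤ j) := by
    ext j; simp only [Finset.mem_Icc, Finset.mem_filter]; omega
  have e2 : Finset.Icc 1 (r - 1) = (Finset.Icc 1 n).filter (fun j => j < r ∧ j < s) := by
    ext j; simp only [Finset.mem_Icc, Finset.mem_filter]; omega
  change _ = ∑ j ∈ Finset.Icc s n, F j - ∑ j ∈ Finset.Icc 1 (r - 1), F j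
  rw [e1, e2, Finset.sum_filter, Finset.sum_filter, ← Finset.sum_sub_distrib]
  refine Finset.sum_congr rfl fun j _ => ?_
  simp only [hF]
  split_ifs <;> ring

end SymmetricFunctions

/-! ### The operator on eigenvalues and its form in the coordinates `σ`. -/

section Calculus

/-- The `i`-th partial derivative of `G`. -/
noncomputable def partialD (i : Fin n) (G : (Fin n → ℝ) → ℝ) (v : Fin n → ℝ) : ℝ :=
  fderiv ℝ G v (Pi.single i 1)

/-- The operator `∂ᵢ² + (β / 2) ∑_{j ≠ i} (∂ᵢ - ∂ⱼ) / (vᵢ - vⱼ)`. -/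
noncomputable def muirhead (β : Peirce) (G : (Fin n → ℝ) → ℝ) (v : Fin n → ℝ) (i : Fin n) : ℝ :=
  partialD i (partialD i G) v +
    β.val / 2 * ∑ j ∈ Finset.univ.erase i, (partialD i G v - partialD j G v) / (v i - v j)

theorem partialD_congr {G H : (Fin n → ℝ) → ℝ} {v : Fin n → ℝ} (h : G =ᶠ[𝓝 v] H) (i : Fin n) :
    partialD i G v = partialD i H v := by
  rw [partialD, partialD, h.fderiv_eq]

theorem partialD_eventuallyEq {G H : (Fin n → ℝ) → ℝ} {v : Fin n → ℝ} (h : G =ᶠ[𝓝 v] H)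
    (i : Fin n) : partialD i G =ᶠ[𝓝 v] partialD i H := by
  filter_upwards [h.eventuallyEq_nhds] with w hw
  exact partialD_congr hw i

theorem muirhead_congr {G H : (Fin n → ℝ) → ℝ} {v : Fin n → ℝ} (h : G =ᶠ[𝓝 v] H) (i : Fin n) :
    muirhead β G v i = muirhead β H v i := by
  simp only [muirhead, partialD_congr (partialD_eventuallyEq h i) i, partialD_congr h]

theorem partialD_eq_of_hasDerivAt {G : (Fin n → ℝ) → ℝ} {v : Fin n → ℝ} {i : Fin n} {d : ℝ}
    (hG : DifferentiableAt ℝ G v)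
    (h : HasDerivAt (fun t : ℝ => G (v + t • Pi.single i 1)) d 0) : partialD i G v = d := by
  have h1 : HasDerivAt (fun t : ℝ => v + t • (Pi.single i 1 : Fin n → ℝ)) (Pi.single i 1) 0 := by
    simpa using ((hasDerivAt_id (0 : ℝ)).smul_const (Pi.single i 1 : Fin n → ℝ)).const_add v
  have h2 : HasDerivAt (fun t : ℝ => G (v + t • Pi.single i 1))
      (fderiv ℝ G v (Pi.single i 1)) 0 := by
    refine HasFDerivAt.comp_hasDerivAt (0 : ℝ) ?_ h1
    simpa using hG.hasFDerivAt
  exact h2.unique h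

theorem contDiff_esub (T : Finset (Fin n)) (m : ℤ) {k : WithTop ℕ∞} :
    ContDiff ℝ k fun v : Fin n → ℝ => esub v T m := by
  induction T using Finset.induction_on generalizing m with
  | empty =>
    have : (fun v : Fin n → ℝ => esub v ∅ m) = fun _ => esub (0 : Fin n → ℝ) ∅ m := by
      funext v
      exact esub_congr (by simp) m
    rw [this]
    exact contDiff_const
  | insert a T ha ih =>
    simp_rw [esub_insert _ ha]
    exact (ih m).add ((contDiff_apply ℝ ℝ a).mul (ih (m - 1)))

theorem differentiable_esub (T : Finset (Fin n)) (m : ℤ) :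
    Differentiable ℝ fun v : Fin n → ℝ => esub v T m :=
  (contDiff_esub T m (k := 1)).differentiable one_ne_zero

theorem partialD_esub_of_notMem (v : Fin n → ℝ) {T : Finset (Fin n)} {i : Fin n} (hi : i ∉ T)
    (m : ℤ) : partialD i (fun w => esub w T m) v = 0 := by
  refine partialD_eq_of_hasDerivAt (differentiable_esub T m v) ?_
  have : (fun t : ℝ => esub (v + t • Pi.single i 1) T m) = fun _ => esub v T m := by
    funext t
    refine esub_congr (fun k hk => ?_) m
    have : k ≠ i := fun h => hi (h ▸ hk)
    simp [this]
  rw [this]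
  exact hasDerivAt_const _ _

theorem partialD_esub_of_mem (v : Fin n → ℝ) {T : Finset (Fin n)} {i : Fin n} (hi : i ∈ T)
    (m : ℤ) : partialD i (fun w => esub w T m) v = esub v (T.erase i) (m - 1) := by
  refine partialD_eq_of_hasDerivAt (differentiable_esub T m v) ?_
  have : (fun t : ℝ => esub (v + t • Pi.single i 1) T m) =
      fun t => esub v (T.erase i) m + (v i + t) * esub v (T.erase i) (m - 1) := by
    funext t
    have h1 : ∀ m, esub (v + t • Pi.single i 1) (T.erase i) m = esub v (T.erase i) m := by
      refine esub_congr (fun k hk => ?_)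
      have : k ≠ i := (Finset.mem_erase.1 hk).1
      simp [this]
    rw [esub_eq_erase _ hi, h1, h1]
    simp
  rw [this]
  have := ((((hasDerivAt_id (0 : ℝ)).const_add (v i)).mul_const
    (esub v (T.erase i) (m - 1))).const_add (esub v (T.erase i) m))
  simpa using this

theorem contDiff_elemSymm {k : WithTop ℕ∞} :
    ContDiff ℝ k (elemSymm : (Fin n → ℝ) → Fin n → ℝ) := by
  rw [contDiff_pi]
  intro i
  simp_rw [elemSymm_apply]
  exact contDiff_esub _ _

theorem fderiv_elemSymm_single (v : Fin n → ℝ) (i r : Fin n) :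
    fderiv ℝ elemSymm v (Pi.single i 1) r = esub v (Finset.univ.erase i) r := by
  have h1 : HasFDerivAt (fun w : Fin n → ℝ => elemSymm w r)
      ((ContinuousLinearMap.proj r).comp (fderiv ℝ elemSymm v)) v :=
    (ContinuousLinearMap.proj (R := ℝ) (φ := fun _ : Fin n => ℝ) r).hasFDerivAt.comp v
      ((contDiff_elemSymm (k := 1)).differentiable one_ne_zero v).hasFDerivAt
  have h2 := partialD_esub_of_mem v (Finset.mem_univ i) ((r : ℤ) + 1)
  simp_rw [← elemSymm_apply] at h2
  rw [partialD, h1.fderiv, add_sub_cancel_right] at h2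
  exact h2

theorem fderiv_elemSymm (v w : Fin n → ℝ) :
    fderiv ℝ elemSymm v w = (esymmJacobian v).vecMul w := by
  have h : w = ∑ i, w i • (Pi.single i 1 : Fin n → ℝ) := by
    simp [← Pi.single_smul, Finset.univ_sum_single]
  funext r
  conv_lhs => rw [h, map_sum]
  rw [Finset.sum_apply, Matrix.vecMul, dotProduct]
  refine Finset.sum_congr rfl fun i _ => ?_
  rw [map_smul, Pi.smul_apply, fderiv_elemSymm_single, smul_eq_mul]
  rfl

theorem exists_equiv_fderiv_elemSymm {v : Fin n → ℝ} (hv : Function.Injective v) :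
    ∃ e : (Fin n → ℝ) ≃L[ℝ] (Fin n → ℝ),
      (e : (Fin n → ℝ) →L[ℝ] (Fin n → ℝ)) = fderiv ℝ elemSymm v := by
  have hinj : Function.Injective (fderiv ℝ elemSymm v : (Fin n → ℝ) →ₗ[ℝ] (Fin n → ℝ)) := by
    rw [injective_iff_map_eq_zero]
    intro w hw
    exact Matrix.eq_zero_of_vecMul_eq_zero (det_esymmJacobian_ne_zero hv)
      ((fderiv_elemSymm v w).symm.trans hw)
  refine ⟨(LinearEquiv.ofInjectiveEndo _ hinj).toContinuousLinearEquiv, ?_⟩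
  ext w : 1
  rfl

theorem isOpen_image_elemSymm {W : Set (Fin n → ℝ)} (hW : IsOpen W)
    (hinj : ∀ v ∈ W, Function.Injective v) : IsOpen (elemSymm '' W) := by
  rw [isOpen_iff_mem_nhds]
  rintro _ ⟨v, hv, rfl⟩
  obtain ⟨e, he⟩ := exists_equiv_fderiv_elemSymm (hinj v hv)
  have h1 : HasStrictFDerivAt elemSymm (e : (Fin n → ℝ) →L[ℝ] (Fin n → ℝ)) v := by
    rw [he]
    exact (contDiff_elemSymm (k := 1)).contDiffAt.hasStrictFDerivAt one_ne_zero
  rw [← h1.map_nhds_eq_of_equiv]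
  exact Filter.image_mem_map (hW.mem_nhds hv)

/-- Near `elemSymm v` the function `g` is `G` composed with a local inverse of `elemSymm`, which the
inverse function theorem supplies because the Jacobian is invertible at distinct entries. -/
theorem contDiffOn_of_comp_elemSymm {W : Set (Fin n → ℝ)} (hW : IsOpen W)
    (hinj : ∀ v ∈ W, Function.Injective v) {g G : (Fin n → ℝ) → ℝ} {k : WithTop ℕ∞}
    (hk : k ≠ 0) (hG : ContDiffOn ℝ k G W)
    (hg : ∀ v ∈ W, g (elemSymm v) = G v) : ContDiffOn ℝ k g (elemSymm '' W) := by
  rintro _ ⟨v, hv, rfl⟩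
  refine ContDiffAt.contDiffWithinAt ?_
  obtain ⟨e, he⟩ := exists_equiv_fderiv_elemSymm (hinj v hv)
  have h0 : ContDiffAt ℝ k elemSymm v := contDiff_elemSymm.contDiffAt
  have h1 : HasFDerivAt elemSymm (e : (Fin n → ℝ) →L[ℝ] (Fin n → ℝ)) v := by
    rw [he]
    exact ((contDiff_elemSymm (k := 1)).differentiable one_ne_zero v).hasFDerivAt
  set ψ := h0.localInverse h1 hk
  have hψ : ContDiffAt ℝ k ψ (elemSymm v) := h0.to_localInverse h1 hk
  have hψv : ψ (elemSymm v) = v := h0.localInverse_apply_image h1 hk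
  have h2 : ∀ᶠ s in 𝓝 (elemSymm v), elemSymm (ψ s) = s :=
    (h0.hasStrictFDerivAt' h1 hk).eventually_right_inverse
  have h3 : ∀ᶠ s in 𝓝 (elemSymm v), ψ s ∈ W := by
    refine hψ.continuousAt.eventually_mem ?_
    rw [hψv]; exact hW.mem_nhds hv
  have h4 : g =ᶠ[𝓝 (elemSymm v)] G ∘ ψ := by
    filter_upwards [h2, h3] with s hs hs'
    rw [Function.comp_apply, ← hg _ hs', hs]
  refine ContDiffAt.congr_of_eventuallyEq ?_ h4
  refine ContDiffAt.comp _ ?_ hψ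
  rw [hψv]
  exact hG.contDiffAt (hW.mem_nhds hv)

theorem partialD_comp_elemSymm {h : (Fin n → ℝ) → ℝ} {v : Fin n → ℝ}
    (hh : DifferentiableAt ℝ h (elemSymm v)) (i : Fin n) :
    partialD i (h ∘ elemSymm) v = ∑ q ∈ Finset.Icc 1 n,
      pderiv q h (elemSymm v) * esub v (Finset.univ.erase i) ((q : ℤ) - 1) := by
  have h0 := (contDiff_elemSymm (n := n) (k := 1)).differentiable one_ne_zero v
  rw [partialD, fderiv_comp v hh h0, ContinuousLinearMap.comp_apply, sum_Icc_eq_sum_fin]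
  set w := fderiv ℝ elemSymm v (Pi.single i 1) with hw
  have h1 : w = ∑ r, w r • (Pi.single r 1 : Fin n → ℝ) := by
    simp [← Pi.single_smul, Finset.univ_sum_single]
  rw [h1, map_sum]
  refine Finset.sum_congr rfl fun r _ => ?_
  rw [map_smul, hw, fderiv_elemSymm_single, smul_eq_mul, mul_comm, pderiv]
  congr 2
  · funext j
    simp [Pi.single_apply, Fin.ext_iff]
  · push_cast; ring

/-- The factor `v i - v j` cancels the denominators of the divided differences. -/
theorem esub_erase_sub (v : Fin n → ℝ) {i j : Fin n} (hij : i ≠ j) (m : ℤ) :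
    esub v (Finset.univ.erase i) m - esub v (Finset.univ.erase j) m =
      -(v i - v j) * esub v ((Finset.univ.erase i).erase j) (m - 1) := by
  rw [esub_eq_erase v (Finset.mem_erase.2 ⟨hij.symm, Finset.mem_univ j⟩) m,
    esub_eq_erase v (Finset.mem_erase.2 ⟨hij, Finset.mem_univ i⟩) m, Finset.erase_right_comm]
  ring

/-- The chain rule has weights `e_{q-1}(v without v i)`, which do not depend on `v i`. Hence `∂ᵢ²`
produces second derivatives of `g` only, with weights `e_{p-1} e_{q-1}`, and these are re-expanded
by `sum_Icc_convolution`. The divided differences produce first derivatives with weights `e_{q-2}`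
in `n - 2` variables, and `sum_esub_erase` sums them over `j`. -/
theorem muirhead_comp_elemSymm {S : Set (Fin n → ℝ)} (hS : IsOpen S) {g : (Fin n → ℝ) → ℝ}
    (hg : ContDiffOn ℝ 2 g S) {v : Fin n → ℝ} (hv : elemSymm v ∈ S) (hinj : Function.Injective v)
    (i : Fin n) :
    muirhead β (g ∘ elemSymm) v i = ∑ j ∈ Finset.Icc 1 n,
      opD β g (elemSymm v) j * esub v (Finset.univ.erase i) ((j : ℤ) - 1) := by
  set c : ℤ → ℝ := fun m => esub v (Finset.univ.erase i) m with hc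
  have hcard : (Finset.univ.erase i).card = n - 1 := by simp
  have hn : 0 < n := Fin.pos i
  have hneg : ∀ m < 0, c m = 0 := fun m hm => esub_neg v _ hm
  have hbig : ∀ m, (n : ℤ) ≤ m → c m = 0 := fun m hm =>
    esub_of_card_lt v _ (by rw [hcard]; omega)
  have hσ : ∀ m, coord (elemSymm v) m = c m + v i * c (m - 1) := by
    intro m
    rw [coord_elemSymm, esub_eq_erase v (Finset.mem_univ i)]
  have hd : ∀ s ∈ S, DifferentiableAt ℝ g s := fun s hs =>
    (hg.contDiffAt (hS.mem_nhds hs)).differentiableAt two_ne_zero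
  have hdp : ∀ q, DifferentiableAt ℝ (pderiv q g) (elemSymm v) := by
    intro q
    have h1 : ContDiffAt ℝ 1 (fderiv ℝ g) (elemSymm v) :=
      (hg.contDiffAt (hS.mem_nhds hv)).fderiv_right (by norm_num)
    exact (h1.differentiableAt one_ne_zero).clm_apply (differentiableAt_const _)
  have hev : ∀ᶠ w in 𝓝 v, elemSymm w ∈ S :=
    (contDiff_elemSymm (k := 1)).continuous.continuousAt.eventually_mem (hS.mem_nhds hv)
  have hfirst : partialD i (g ∘ elemSymm) =ᶠ[𝓝 v] fun w => ∑ q ∈ Finset.Icc 1 n,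
      (pderiv q g ∘ elemSymm) w * esub w (Finset.univ.erase i) ((q : ℤ) - 1) := by
    filter_upwards [hev] with w hw
    exact partialD_comp_elemSymm (hd _ hw) i
  have hσd : DifferentiableAt ℝ (elemSymm : (Fin n → ℝ) → _) v :=
    (contDiff_elemSymm (k := 1)).differentiable one_ne_zero v
  have hsecond : partialD i (partialD i (g ∘ elemSymm)) v = ∑ p ∈ Finset.Icc 1 n,
      ∑ q ∈ Finset.Icc 1 n, pderiv p (pderiv q g) (elemSymm v) * (c (p - 1) * c (q - 1)) := by
    rw [partialD_congr hfirst, partialD, fderiv_fun_sum]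
    · rw [_root_.sum_apply, Finset.sum_comm]
      refine Finset.sum_congr rfl fun q _ => ?_
      rw [fderiv_fun_mul ((hdp q).comp v hσd) (differentiable_esub _ _ v)]
      have e1 := partialD_comp_elemSymm (hdp q) i
      have e2 := partialD_esub_of_notMem v (Finset.notMem_erase i Finset.univ) ((q : ℤ) - 1)
      rw [partialD] at e1 e2
      rw [_root_.add_apply, _root_.smul_apply,
        _root_.smul_apply, e1, e2, smul_zero, zero_add, smul_eq_mul, Finset.mul_sum]
      refine Finset.sum_congr rfl fun p _ => ?_
      simp only [hc]; ring
    · intro q _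
      exact ((hdp q).comp v hσd).mul (differentiable_esub _ _ v)
  have hquot : ∀ j ∈ Finset.univ.erase i,
      (partialD i (g ∘ elemSymm) v - partialD j (g ∘ elemSymm) v) / (v i - v j) =
      -∑ q ∈ Finset.Icc 1 n, pderiv q g (elemSymm v) *
        esub v ((Finset.univ.erase i).erase j) ((q : ℤ) - 2) := by
    intro j hj
    have hij : i ≠ j := (Finset.mem_erase.1 hj).1.symm
    rw [partialD_comp_elemSymm (hd _ hv), partialD_comp_elemSymm (hd _ hv),
      ← Finset.sum_sub_distrib, div_eq_iff (sub_ne_zero.2 fun h => hij (hinj h)), neg_mul,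
      Finset.sum_mul, ← Finset.sum_neg_distrib]
    refine Finset.sum_congr rfl fun q _ => ?_
    rw [← mul_sub, esub_erase_sub v hij, show (q : ℤ) - 1 - 1 = q - 2 by ring]
    ring
  have hsum : ∑ j ∈ Finset.univ.erase i,
      (partialD i (g ∘ elemSymm) v - partialD j (g ∘ elemSymm) v) / (v i - v j) =
      -∑ j ∈ Finset.Icc 1 n, ((n : ℝ) - j) * pderiv (j + 1) g (elemSymm v) * c (j - 1) := by
    rw [Finset.sum_congr rfl hquot, Finset.sum_neg_distrib, Finset.sum_comm]
    congr 1
    simp_rw [← Finset.mul_sum, sum_esub_erase]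
    rw [hcard]
    obtain ⟨N, rfl⟩ : ∃ N, n = N + 1 := ⟨n - 1, by omega⟩
    -- The index is shifted by `q = j + 1`. The two unmatched terms vanish: `q = 1` because of
    -- `e_{-1} = 0`, and `j = n` because of the factor `n - j`.
    rw [sum_Icc_eq_sum_fin, sum_Icc_eq_sum_fin, Fin.sum_univ_succ, Fin.sum_univ_castSucc]
    have z1 : esub v (Finset.univ.erase i) (((0 : ℕ) + 1 : ℕ) - 2 : ℤ) = 0 := esub_neg v _ (by simp)
    simp only [Fin.val_zero, Fin.val_last]
    rw [z1]
    push_cast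
    rw [sub_self, zero_mul, zero_mul, add_zero, mul_zero, mul_zero, zero_add]
    refine Finset.sum_congr rfl fun r _ => ?_
    simp only [Fin.val_succ, Fin.val_castSucc, hc]
    push_cast
    rw [show ((r : ℤ) + 1 + 1 - 2) = (r : ℤ) + 1 - 1 by ring]
    ring
  rw [muirhead, hsecond, hsum]
  have hop : ∀ j ∈ Finset.Icc 1 n, opD β g (elemSymm v) j * c (j - 1) =
      (∑ p ∈ Finset.Icc 1 n, ∑ q ∈ Finset.Icc 1 n, pderiv p (pderiv q g) (elemSymm v) *
        (c (j - 1) * (((if p ≤ j ∧ q ≤ j then 1 else 0) - (if j < p ∧ j < q then 1 else 0)) *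
        (c ((p : ℤ) + q - 1 - j) + v i * c ((p : ℤ) + q - 2 - j))))) -
      β.val / 2 * (((n : ℝ) - j) * pderiv (j + 1) g (elemSymm v) * c (j - 1)) := by
    intro j hj
    rw [Finset.mem_Icc] at hj
    have e1 : Finset.Icc 1 j = (Finset.Icc 1 n).filter (fun p => p ≤ j) := by
      ext p; simp only [Finset.mem_Icc, Finset.mem_filter]; omega
    have e2 : Finset.Icc (j + 1) n = (Finset.Icc 1 n).filter (fun p => j < p) := by
      ext p; simp only [Finset.mem_Icc, Finset.mem_filter]; omega
    rw [opD, e1, e2]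
    simp only [Finset.sum_filter, hσ]
    rw [sub_mul]
    congr 1
    · rw [← Finset.sum_sub_distrib, Finset.sum_mul]
      refine Finset.sum_congr rfl fun p _ => ?_
      have e3 : ∀ (P : Prop) [Decidable P] (F : ℕ → ℝ), (if P then ∑ q ∈ Finset.Icc 1 n, F q else 0)
          = ∑ q ∈ Finset.Icc 1 n, if P then F q else 0 := by
        intro P _ F; split_ifs <;> simp
      rw [e3, e3, ← Finset.sum_sub_distrib, Finset.sum_mul]
      refine Finset.sum_congr rfl fun q _ => ?_
      rw [show (p : ℤ) + q - 1 - j - 1 = (p : ℤ) + q - 2 - j by ring]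
      simp only [← not_le]
      by_cases h1 : p ≤ j <;> by_cases h2 : q ≤ j <;> simp [h1, h2] <;> ring
    · ring
  rw [Finset.sum_congr rfl hop, Finset.sum_sub_distrib, ← Finset.mul_sum,
    mul_neg, ← sub_eq_add_neg]
  congr 1
  symm
  rw [Finset.sum_comm]
  refine Finset.sum_congr rfl fun p hp => ?_
  rw [Finset.sum_comm]
  refine Finset.sum_congr rfl fun q hq => ?_
  rw [← Finset.mul_sum, sum_Icc_convolution c hneg hbig (v i) hp hq]

end Calculus

/-! ### Smoothness of Laplace transforms and derivatives of `k`. -/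

section Laplace

variable {μ : Measure (Herm β n)} {E : Type} [NormedAddCommGroup E]

theorem continuous_exp_inner (θ : Herm β n) :
    Continuous fun x : Herm β n => Real.exp (inner ℝ θ x) := by fun_prop

theorem convex_integrableExp (μ : Measure (Herm β n)) :
    Convex ℝ {θ | Integrable (fun x : Herm β n => Real.exp (inner ℝ θ x)) μ} := by
  intro θ hθ η hη a b ha hb hab
  change Integrable _ _
  refine ((hθ.const_mul a).add (hη.const_mul b)).mono'
    (continuous_exp_inner _).aestronglyMeasurable (Eventually.of_forall fun x => ?_)
  rw [Real.norm_eq_abs, Real.abs_exp, inner_add_left, real_inner_smul_left, real_inner_smul_left]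
  exact convexOn_exp.2 (Set.mem_univ _) (Set.mem_univ _) ha hb hab

theorem isOpen_laplaceDomain (μ : Measure (Herm β n)) : IsOpen (laplaceDomain μ) := isOpen_interior

theorem convex_laplaceDomain (μ : Measure (Herm β n)) : Convex ℝ (laplaceDomain μ) :=
  (convex_integrableExp μ).interior

theorem integrable_exp_of_mem {θ : Herm β n} (hθ : θ ∈ laplaceDomain μ) :
    Integrable (fun x => Real.exp (inner ℝ θ x)) μ := by
  have h : θ ∈ {θ | Integrable (fun x : Herm β n => Real.exp (inner ℝ θ x)) μ} :=
    interior_subset hθ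
  exact h

/-- The transform is finite at the origin, but the origin may lie on the boundary of `Θ`. Convexity
still keeps the half-open segment from `θ` towards the origin inside `Θ`; this is why limits at `0`
are taken with `t ↓ 0` along such segments. -/
theorem smul_mem_laplaceDomain [IsFiniteMeasure μ] {θ : Herm β n} (hθ : θ ∈ laplaceDomain μ)
    {t : ℝ} (ht0 : 0 < t) (ht1 : t ≤ 1) : t • θ ∈ laplaceDomain μ := by
  have h0 : (0 : Herm β n) ∈ {θ | Integrable (fun x : Herm β n => Real.exp (inner ℝ θ x)) μ} := by
    change Integrable _ _
    simp
  have := (convex_integrableExp μ).combo_interior_self_mem_interior hθ h0 ht0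
    (sub_nonneg.2 ht1) (by ring)
  rw [smul_zero, add_zero] at this
  exact this

theorem norm_le_sum_abs_inner (x : Herm β n) :
    ‖x‖ ≤ ∑ i, |(inner ℝ (stdOrthonormalBasis ℝ (Herm β n) i) x : ℝ)| := by
  conv_lhs => rw [← (stdOrthonormalBasis ℝ (Herm β n)).sum_repr' x]
  refine (norm_sum_le _ _).trans (Finset.sum_le_sum fun i _ => ?_)
  rw [norm_smul, (stdOrthonormalBasis ℝ (Herm β n)).norm_eq_one, mul_one, Real.norm_eq_abs]

/-- Some coordinate of `x` has absolute value at least `‖x‖ / N`, with `N` the dimension, so an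
exponential of `±cN` times that coordinate dominates. The summand `1` covers `x = 0`, also for `N =
0`. -/
theorem exp_norm_le (c : ℝ) (hc : 0 ≤ c) (x : Herm β n) :
    Real.exp (c * ‖x‖) ≤ 1 + ∑ i, (Real.exp (inner ℝ ((c * Module.finrank ℝ (Herm β n)) •
      stdOrthonormalBasis ℝ (Herm β n) i) x) +
      Real.exp (inner ℝ (-(c * Module.finrank ℝ (Herm β n)) •
      stdOrthonormalBasis ℝ (Herm β n) i) x)) := by
  set N := Module.finrank ℝ (Herm β n)
  set e := stdOrthonormalBasis ℝ (Herm β n)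
  by_cases hx : x = 0
  · subst hx
    simp only [norm_zero, mul_zero, Real.exp_zero, inner_zero_right]
    have : (0 : ℝ) ≤ ∑ i : Fin N, (1 + 1 : ℝ) := Finset.sum_nonneg fun _ _ => by norm_num
    linarith
  have h1 : ∃ i, ‖x‖ ≤ N * |(inner ℝ (e i) x : ℝ)| := by
    by_contra hcon
    push Not at hcon
    have hN : Nonempty (Fin N) := by
      by_contra hne
      rw [not_nonempty_iff] at hne
      have := norm_le_sum_abs_inner x
      rw [Finset.univ_eq_empty, Finset.sum_empty] at this
      exact hx (norm_le_zero_iff.1 this)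
    have h2 : ∑ i : Fin N, N * |(inner ℝ (e i) x : ℝ)| < ∑ _i : Fin N, ‖x‖ :=
      Finset.sum_lt_sum_of_nonempty Finset.univ_nonempty fun i _ => hcon i
    rw [← Finset.mul_sum, Finset.sum_const, Finset.card_univ, Fintype.card_fin, nsmul_eq_mul] at h2
    exact absurd (norm_le_sum_abs_inner x) (not_le.2 (lt_of_mul_lt_mul_left h2 (Nat.cast_nonneg _)))
  obtain ⟨i, hi⟩ := h1
  have h3 : Real.exp (c * ‖x‖) ≤ Real.exp (inner ℝ ((c * N) • e i) x) +
      Real.exp (inner ℝ (-(c * N) • e i) x) := by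
    rw [real_inner_smul_left, real_inner_smul_left]
    have h4 : c * ‖x‖ ≤ c * N * |(inner ℝ (e i) x : ℝ)| := by
      rw [mul_assoc]; exact mul_le_mul_of_nonneg_left hi hc
    rcases abs_choice (inner ℝ (e i) x : ℝ) with h5 | h5 <;> rw [h5] at h4
    · exact (Real.exp_le_exp.2 h4).trans (le_add_of_nonneg_right (Real.exp_nonneg _))
    · refine (Real.exp_le_exp.2 (h4.trans (le_of_eq ?_))).trans
        (le_add_of_nonneg_left (Real.exp_nonneg _))
      ring
  refine h3.trans (le_trans ?_ (le_add_of_nonneg_left zero_le_one))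
  exact Finset.single_le_sum (f := fun i => Real.exp (inner ℝ ((c * N) • e i) x) +
      Real.exp (inner ℝ (-(c * N) • e i) x)) (fun j _ => by positivity) (Finset.mem_univ i)

theorem exists_integrable_exp_norm {θ : Herm β n} (hθ : θ ∈ laplaceDomain μ) :
    ∃ δ > 0, Integrable (fun x => Real.exp (inner ℝ θ x + δ * ‖x‖)) μ := by
  obtain ⟨ε, hε, hball⟩ := Metric.isOpen_iff.1 (isOpen_laplaceDomain μ) θ hθ
  set N := Module.finrank ℝ (Herm β n)
  set e := stdOrthonormalBasis ℝ (Herm β n)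
  have hN : (0 : ℝ) < N + 1 := by positivity
  -- Division by `N + 1` instead of `N` makes `cN < ε` strict, so the shifted points `θ ± cN eᵢ`
  -- stay in the open ball, and it covers `N = 0`.
  refine ⟨ε / (N + 1), by positivity, ?_⟩
  set c := ε / (N + 1) with hc
  have hcN : c * N < ε := by
    rw [hc, div_mul_eq_mul_div, div_lt_iff₀ hN]
    nlinarith
  have hc0 : 0 ≤ c := by positivity
  have hint : ∀ i, ∀ s : ℝ, |s| < ε →
      Integrable (fun x => Real.exp (inner ℝ (θ + s • e i) x)) μ := by
    intro i s hs
    refine integrable_exp_of_mem (hball ?_)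
    rw [Metric.mem_ball, dist_eq_norm, add_sub_cancel_left, norm_smul, e.norm_eq_one, mul_one]
    exact hs
  have hb : Integrable (fun x => Real.exp (inner ℝ θ x) + ∑ i,
      (Real.exp (inner ℝ (θ + (c * N) • e i) x) + Real.exp (inner ℝ (θ + -(c * N) • e i) x))) μ := by
    refine (integrable_exp_of_mem hθ).add (integrable_finsetSum _ fun i _ => ?_)
    refine (hint i _ ?_).add (hint i _ ?_)
    · rwa [abs_of_nonneg (by positivity)]
    · rwa [abs_neg, abs_of_nonneg (by positivity)]
  refine hb.mono' (by fun_prop) (Eventually.of_forall fun x => ?_)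
  rw [Real.norm_eq_abs, Real.abs_exp, Real.exp_add]
  refine (mul_le_mul_of_nonneg_left (exp_norm_le c hc0 x) (Real.exp_nonneg _)).trans (le_of_eq ?_)
  simp only [inner_add_left, Real.exp_add, mul_add, mul_one, Finset.mul_sum]
  rfl

/-- A continuous function that grows more slowly than all exponentials of the norm. -/
structure SubExponential (P : Herm β n → E) : Prop where
  continuous : Continuous P
  bound : ∀ δ > 0, ∃ C, 0 ≤ C ∧ ∀ x, ‖P x‖ ≤ C * Real.exp (δ * ‖x‖)

theorem SubExponential.of_norm_le {P : Herm β n → E} (hP : Continuous P) {C : ℝ} (hC : 0 ≤ C)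
    {m : ℕ} (h : ∀ x, ‖P x‖ ≤ C * ‖x‖ ^ m) : SubExponential P := by
  refine ⟨hP, fun δ hδ => ⟨C * (m.factorial / δ ^ m), by positivity, fun x => (h x).trans ?_⟩⟩
  have h1 := Real.pow_div_factorial_le_exp (δ * ‖x‖) (by positivity) m
  rw [div_le_iff₀ (by positivity), mul_pow] at h1
  rw [mul_assoc]
  refine mul_le_mul_of_nonneg_left ?_ hC
  rw [div_mul_eq_mul_div, le_div_iff₀ (by positivity)]
  linarith

theorem SubExponential.const (c : E) : SubExponential fun _ : Herm β n => c :=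
  .of_norm_le continuous_const (norm_nonneg c) (m := 0) fun x => by simp

variable [NormedSpace ℝ E]

theorem SubExponential.id : SubExponential fun x : Herm β n => x :=
  .of_norm_le continuous_id zero_le_one (m := 1) fun x => by simp

/-- Each derivative of `expInt` in `θ` inserts a factor `⟨x|·⟩`; stability under this operation
permits unlimited differentiation. -/
theorem SubExponential.smulRight {P : Herm β n → E} (hP : SubExponential P) :
    SubExponential fun x => (innerSL ℝ x).smulRight (P x) := by
  refine ⟨?_, fun δ hδ => ?_⟩
  · have h1 : Continuous fun x : Herm β n => ContinuousLinearMap.smulRightL ℝ (Herm β n) E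
        (innerSL ℝ x) (P x) := by
      have := hP.continuous
      fun_prop
    exact h1
  · obtain ⟨C, hC, h⟩ := hP.bound (δ / 2) (half_pos hδ)
    refine ⟨C * (2 / δ), by positivity, fun x => ?_⟩
    rw [ContinuousLinearMap.norm_smulRight_apply, innerSL_apply_norm]
    have h1 : ‖x‖ ≤ 2 / δ * Real.exp (δ / 2 * ‖x‖) := by
      have := Real.add_one_le_exp (δ / 2 * ‖x‖)
      rw [div_mul_eq_mul_div, le_div_iff₀ hδ]
      linarith
    calc ‖x‖ * ‖P x‖ ≤ (2 / δ * Real.exp (δ / 2 * ‖x‖)) * (C * Real.exp (δ / 2 * ‖x‖)) :=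
          mul_le_mul h1 (h x) (norm_nonneg _) (by positivity)
      _ = C * (2 / δ) * (Real.exp (δ / 2 * ‖x‖) * Real.exp (δ / 2 * ‖x‖)) := by ring
      _ = _ := by rw [← Real.exp_add]; ring_nf

/-- `∫ exp ⟨θ, x⟩ P(x) μ(dx)`. -/
noncomputable def expInt (μ : Measure (Herm β n)) (P : Herm β n → E) (θ : Herm β n) : E :=
  ∫ x, Real.exp (inner ℝ θ x) • P x ∂μ

theorem SubExponential.integrable {P : Herm β n → E} (hP : SubExponential P) {θ : Herm β n}
    (hθ : θ ∈ laplaceDomain μ) : Integrable (fun x => Real.exp (inner ℝ θ x) • P x) μ := by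
  obtain ⟨δ, hδ, hint⟩ := exists_integrable_exp_norm hθ
  obtain ⟨C, hC, h⟩ := hP.bound δ hδ
  refine (hint.const_mul C).mono'
    ((continuous_exp_inner θ).smul hP.continuous).aestronglyMeasurable
    (Eventually.of_forall fun x => ?_)
  rw [norm_smul, Real.norm_eq_abs, Real.abs_exp, Real.exp_add]
  calc Real.exp (inner ℝ θ x) * ‖P x‖ ≤ Real.exp (inner ℝ θ x) * (C * Real.exp (δ * ‖x‖)) := by
        gcongr; exact h x
    _ = _ := by ring

theorem hasFDerivAt_expInt {P : Herm β n → E} (hP : SubExponential P)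
    {θ : Herm β n} (hθ : θ ∈ laplaceDomain μ) :
    HasFDerivAt (expInt μ P) (expInt μ (fun x => (innerSL ℝ x).smulRight (P x)) θ) θ := by
  obtain ⟨δ, hδ, hint⟩ := exists_integrable_exp_norm hθ
  -- Half of `δ` pays for the growth of the integrand, the other half for letting `η` range over the
  -- ball of radius `δ / 2` around `θ`.
  obtain ⟨C, hC, h⟩ := hP.smulRight.bound (δ / 2) (half_pos hδ)
  refine hasFDerivAt_integral_of_dominated_of_fderiv_le
    (bound := fun x => C * Real.exp (inner ℝ θ x + δ * ‖x‖))
    (F' := fun θ x => Real.exp (inner ℝ θ x) • (innerSL ℝ x).smulRight (P x))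
    (Metric.ball_mem_nhds θ (half_pos hδ)) ?_ (hP.integrable hθ) ?_ ?_ (hint.const_mul C) ?_
  · exact Eventually.of_forall fun η =>
      ((continuous_exp_inner η).smul hP.continuous).aestronglyMeasurable
  · exact ((continuous_exp_inner θ).smul hP.smulRight.continuous).aestronglyMeasurable
  · refine Eventually.of_forall fun x η hη => ?_
    rw [norm_smul, Real.norm_eq_abs, Real.abs_exp]
    have h1 : (inner ℝ η x : ℝ) ≤ inner ℝ θ x + δ / 2 * ‖x‖ := by
      have h2 : (inner ℝ (η - θ) x : ℝ) ≤ δ / 2 * ‖x‖ :=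
        (real_inner_le_norm _ _).trans (by
          gcongr; rw [← dist_eq_norm]; exact (Metric.mem_ball.1 hη).le)
      rw [inner_sub_left] at h2
      linarith
    calc Real.exp (inner ℝ η x) * ‖(innerSL ℝ x).smulRight (P x)‖
        ≤ Real.exp (inner ℝ θ x + δ / 2 * ‖x‖) * (C * Real.exp (δ / 2 * ‖x‖)) :=
          mul_le_mul (Real.exp_le_exp.2 h1) (h x) (norm_nonneg _) (Real.exp_nonneg _)
      _ = C * (Real.exp (inner ℝ θ x + δ / 2 * ‖x‖) * Real.exp (δ / 2 * ‖x‖)) := by ring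
      _ = _ := by rw [← Real.exp_add]; ring_nf
  · refine Eventually.of_forall fun x η _ => ?_
    have h1 : HasFDerivAt (fun η : Herm β n => (inner ℝ η x : ℝ)) (innerSL ℝ x) η := by
      have : (fun η : Herm β n => (inner ℝ η x : ℝ)) = innerSL ℝ x := by
        funext η; exact real_inner_comm _ _
      rw [this]
      exact (innerSL ℝ x).hasFDerivAt
    refine (h1.exp.smul_const (P x)).congr_fderiv ?_
    ext h
    simp [smul_smul]

/-- The derivative is again of the form `expInt`, but with values in a space of linear maps; the
target space must therefore vary in the induction. -/
theorem contDiffOn_expInt_nat (m : ℕ) : ∀ {E : Type} [NormedAddCommGroup E] [NormedSpace ℝ E]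
    {P : Herm β n → E}, SubExponential P → ContDiffOn ℝ m (expInt μ P) (laplaceDomain μ) := by
  induction m with
  | zero =>
    intro E _ _ P hP
    rw [Nat.cast_zero, contDiffOn_zero]
    exact fun θ hθ => (hasFDerivAt_expInt hP hθ).continuousAt.continuousWithinAt
  | succ m ih =>
    intro E _ _ P hP
    rw [Nat.cast_add, Nat.cast_one, contDiffOn_succ_iff_fderiv_of_isOpen (isOpen_laplaceDomain μ)]
    refine ⟨fun θ hθ => (hasFDerivAt_expInt hP hθ).differentiableAt.differentiableWithinAt,
      by simp, (ih hP.smulRight).congr fun θ hθ => (hasFDerivAt_expInt hP hθ).fderiv⟩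

theorem contDiffOn_expInt {P : Herm β n → E} (hP : SubExponential P) :
    ContDiffOn ℝ ∞ (expInt μ P) (laplaceDomain μ) :=
  contDiffOn_infty.2 fun m => contDiffOn_expInt_nat m hP

theorem laplace_eq_expInt : laplace μ = expInt μ fun _ => (1 : ℝ) := by
  funext θ
  simp [laplace, expInt]

theorem laplace_pos [IsProbabilityMeasure μ] {θ : Herm β n} (hθ : θ ∈ laplaceDomain μ) :
    0 < laplace μ θ :=
  integral_exp_pos (integrable_exp_of_mem hθ)

/-- The expectation of `P` under the tilted law `exp ⟨θ, x⟩ μ(dx) / L(θ)`. -/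
noncomputable def tilt (μ : Measure (Herm β n)) (P : Herm β n → E) (θ : Herm β n) : E :=
  (laplace μ θ)⁻¹ • expInt μ P θ

theorem hasFDerivAt_laplace {θ : Herm β n} (hθ : θ ∈ laplaceDomain μ) :
    HasFDerivAt (laplace μ) (innerSL ℝ (expInt μ (fun x => x) θ)) θ := by
  rw [laplace_eq_expInt]
  refine (hasFDerivAt_expInt (.const 1) hθ).congr_fderiv ?_
  ext h
  rw [innerSL_apply_apply, expInt, expInt, ContinuousLinearMap.integral_apply
    ((SubExponential.const (1 : ℝ)).smulRight.integrable hθ), real_inner_comm,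
    ← integral_inner (SubExponential.id.integrable hθ)]
  refine integral_congr_ae (Eventually.of_forall fun x => ?_)
  simp [real_inner_smul_right, real_inner_comm]

theorem hasGradientAt_logLaplace [IsProbabilityMeasure μ] {θ : Herm β n}
    (hθ : θ ∈ laplaceDomain μ) : HasGradientAt (logLaplace μ) (tilt μ (fun x => x) θ) θ := by
  rw [hasGradientAt_iff_hasFDerivAt]
  refine ((hasFDerivAt_laplace hθ).log (laplace_pos hθ).ne').congr_fderiv ?_
  ext h
  simp [tilt]

theorem gradient_logLaplace [IsProbabilityMeasure μ] {θ : Herm β n} (hθ : θ ∈ laplaceDomain μ) :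
    gradient (logLaplace μ) θ = tilt μ (fun x => x) θ :=
  (hasGradientAt_logLaplace hθ).gradient

theorem contDiffOn_laplace : ContDiffOn ℝ ∞ (laplace μ) (laplaceDomain μ) := by
  rw [laplace_eq_expInt]
  exact contDiffOn_expInt (.const 1)

theorem contDiffOn_logLaplace [IsProbabilityMeasure μ] :
    ContDiffOn ℝ ∞ (logLaplace μ) (laplaceDomain μ) :=
  contDiffOn_laplace.log fun _ hθ => (laplace_pos hθ).ne'

theorem contDiffOn_tilt [IsProbabilityMeasure μ] {P : Herm β n → E} (hP : SubExponential P) :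
    ContDiffOn ℝ ∞ (tilt μ P) (laplaceDomain μ) :=
  (contDiffOn_laplace.inv fun _ hθ => (laplace_pos hθ).ne').smul (contDiffOn_expInt hP)

/-- The Hessian of `k` is the covariance operator of the tilted law, by the product rule for `L⁻¹ ·
∫ exp⟨θ|x⟩ x`. -/
theorem hasFDerivAt_gradient_logLaplace [IsProbabilityMeasure μ] {θ : Herm β n}
    (hθ : θ ∈ laplaceDomain μ) :
    HasFDerivAt (gradient (logLaplace μ)) (tilt μ (fun x => (innerSL ℝ x).smulRight x) θ -
      (innerSL ℝ (tilt μ (fun x => x) θ)).smulRight (tilt μ (fun x => x) θ)) θ := by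
  have h1 : gradient (logLaplace μ) =ᶠ[𝓝 θ] tilt μ (fun x => x) := by
    filter_upwards [(isOpen_laplaceDomain μ).mem_nhds hθ] with η hη
    exact gradient_logLaplace hη
  have hL := (laplace_pos hθ).ne'
  have h2 := ((hasDerivAt_inv hL).comp_hasFDerivAt θ (hasFDerivAt_laplace hθ)).smul (hasFDerivAt_expInt .id hθ)
  refine (h2.congr_fderiv ?_).congr_of_eventuallyEq h1
  ext h
  simp only [tilt, _root_.add_apply, _root_.smul_apply, _root_.sub_apply,
    ContinuousLinearMap.smulRight_apply, innerSL_apply_apply, map_smul, smul_eq_mul]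
  rw [smul_smul, sub_eq_add_neg, ← neg_smul]
  congr 2
  field_simp

/-- `T ↦ Ψ(T)(I)` is linear and continuous, so it passes under the integral, where it sends `x ⊗ x`
to `x²`. -/
theorem Psi_fderiv_gradient_logLaplace [IsProbabilityMeasure μ] {θ : Herm β n}
    (hθ : θ ∈ laplaceDomain μ) :
    Psi (fderiv ℝ (gradient (logLaplace μ)) θ : Herm β n →ₗ[ℝ] Herm β n) 1 =
      tilt μ sq θ - sq (tilt μ (fun x => x) θ) := by
  set Φ : (Herm β n →L[ℝ] Herm β n) →ₗ[ℝ] Herm β n :=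
    { toFun := fun T => Psi (T : Herm β n →ₗ[ℝ] Herm β n) 1
      map_add' := fun S T => by simp
      map_smul' := fun c T => by simp } with hΦ
  have h1 : ∀ x, Φ ((innerSL ℝ x).smulRight x) = sq x := by
    intro x
    have h2 : (((innerSL ℝ x).smulRight x : Herm β n →L[ℝ] Herm β n) : Herm β n →ₗ[ℝ] Herm β n) =
        tensor x := by
      ext h
      simp [tensor_apply]
    change Psi _ 1 = _
    rw [h2, Psi_tensor]
    apply mat_injective
    change x.mat * (1 : Herm β n).mat * x.mat = _
    rw [mat_one, mul_one, mat_sq]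
  have h3 : ∀ T, LinearMap.toContinuousLinearMap Φ T = Φ T := fun T => rfl
  change Φ _ = _
  rw [(hasFDerivAt_gradient_logLaplace hθ).fderiv, map_sub, h1, tilt, tilt, map_smul, expInt,
    ← h3, ← ContinuousLinearMap.integral_comp_comm _ (SubExponential.id.smulRight.integrable hθ)]
  simp only [map_smul, h3, h1]
  rfl

end Laplace

/-! ### Equivariance of the transforms and limits along rays. -/

section Invariance

variable {μ : Measure (Herm β n)} {E : Type} [NormedAddCommGroup E] [NormedSpace ℝ E]

theorem IsRotationInvariant.measurePreserving (hμ : IsRotationInvariant μ)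
    {U : Matrix (Fin n) (Fin n) β.Scalar} (hU : U ∈ unitary _) :
    MeasurePreserving (conj U) μ μ :=
  ⟨(continuous_conj hU).measurable, hμ U hU⟩

theorem measurableEmbedding_conj {U : Matrix (Fin n) (Fin n) β.Scalar} (hU : U ∈ unitary _) :
    MeasurableEmbedding (conj U : Herm β n → Herm β n) :=
  (conjE U hU).toHomeomorph.measurableEmbedding

theorem expInt_conj (hμ : IsRotationInvariant μ) {U : Matrix (Fin n) (Fin n) β.Scalar}
    (hU : U ∈ unitary _) (P : Herm β n → E) (θ : Herm β n) :
    expInt μ P (conj U θ) = expInt μ (fun x => P (conj U x)) θ := by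
  rw [expInt, expInt, ← (hμ.measurePreserving hU).integral_comp (measurableEmbedding_conj hU)]
  simp_rw [inner_conj_conj hU]

theorem laplace_conj (hμ : IsRotationInvariant μ) {U : Matrix (Fin n) (Fin n) β.Scalar}
    (hU : U ∈ unitary _) (θ : Herm β n) : laplace μ (conj U θ) = laplace μ θ := by
  rw [laplace_eq_expInt, expInt_conj hμ hU]

theorem logLaplace_conj (hμ : IsRotationInvariant μ) {U : Matrix (Fin n) (Fin n) β.Scalar}
    (hU : U ∈ unitary _) (θ : Herm β n) : logLaplace μ (conj U θ) = logLaplace μ θ := by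
  rw [logLaplace, laplace_conj hμ hU, logLaplace]

theorem conj_mem_laplaceDomain (hμ : IsRotationInvariant μ)
    {U : Matrix (Fin n) (Fin n) β.Scalar} (hU : U ∈ unitary _) {θ : Herm β n}
    (hθ : θ ∈ laplaceDomain μ) : conj U θ ∈ laplaceDomain μ := by
  have h1 : ∀ η : Herm β n, Integrable (fun x => Real.exp (inner ℝ η x)) μ →
      Integrable (fun x => Real.exp (inner ℝ (conj U η) x)) μ := by
    intro η hη
    rw [← (hμ.measurePreserving hU).integrable_comp_emb (measurableEmbedding_conj hU)]
    simpa [Function.comp_def, inner_conj_conj hU] using hη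
  have h2 : IsOpen (conj U '' laplaceDomain μ) :=
    (conjE U hU).toHomeomorph.isOpenMap _ (isOpen_laplaceDomain μ)
  refine interior_maximal ?_ h2 (Set.mem_image_of_mem _ hθ)
  rintro _ ⟨η, hη, rfl⟩
  exact h1 η (integrable_exp_of_mem hη)

theorem conj_mem_laplaceDomain_iff (hμ : IsRotationInvariant μ)
    {U : Matrix (Fin n) (Fin n) β.Scalar} (hU : U ∈ unitary _) {θ : Herm β n} :
    conj U θ ∈ laplaceDomain μ ↔ θ ∈ laplaceDomain μ := by
  refine ⟨fun h => ?_, conj_mem_laplaceDomain hμ hU⟩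
  rw [← conj_star_conj hU θ]
  exact conj_mem_laplaceDomain hμ (Unitary.star_mem hU) h

theorem tilt_id_conj (hμ : IsRotationInvariant μ) {U : Matrix (Fin n) (Fin n) β.Scalar}
    (hU : U ∈ unitary _) (θ : Herm β n) :
    tilt μ (fun x => x) (conj U θ) = conj U (tilt μ (fun x => x) θ) := by
  have h := (conjE U hU).toLinearIsometry.integral_comp_comm (μ := μ)
    (φ := fun x => Real.exp (inner ℝ θ x) • x)
  rw [tilt, tilt, laplace_conj hμ hU, expInt_conj hμ hU, conj_smul, expInt, expInt]
  congr 1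
  refine Eq.trans ?_ h
  refine integral_congr_ae (Eventually.of_forall fun x => ?_)
  exact (conj_smul U _ x).symm

theorem gradient_logLaplace_conj [IsProbabilityMeasure μ] (hμ : IsRotationInvariant μ)
    {U : Matrix (Fin n) (Fin n) β.Scalar} (hU : U ∈ unitary _) {θ : Herm β n}
    (hθ : θ ∈ laplaceDomain μ) :
    gradient (logLaplace μ) (conj U θ) = conj U (gradient (logLaplace μ) θ) := by
  rw [gradient_logLaplace hθ, gradient_logLaplace (conj_mem_laplaceDomain hμ hU hθ),
    tilt_id_conj hμ hU]

/-- Dominated convergence with `exp(ts) ≤ 1 + exp(s)` for `0 < t < 1`. Integrability of `P` itself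
is a separate hypothesis because the origin need not belong to `Θ`. -/
theorem tendsto_expInt_smul {P : Herm β n → E} (hP : SubExponential P) (hint : Integrable P μ)
    {θ : Herm β n} (hθ : θ ∈ laplaceDomain μ) :
    Tendsto (fun t : ℝ => expInt μ P (t • θ)) (𝓝[>] 0) (𝓝 (∫ x, P x ∂μ)) := by
  refine tendsto_integral_filter_of_dominated_convergence
    (fun x => ‖P x‖ + ‖Real.exp (inner ℝ θ x) • P x‖) ?_ ?_ ?_ ?_
  · exact Eventually.of_forall fun t =>
      ((continuous_exp_inner _).smul hP.continuous).aestronglyMeasurable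
  · filter_upwards [Ioo_mem_nhdsGT (zero_lt_one (α := ℝ))] with t ht
    refine Eventually.of_forall fun x => ?_
    rw [norm_smul, norm_smul, Real.norm_eq_abs, Real.norm_eq_abs, Real.abs_exp, Real.abs_exp,
      real_inner_smul_left]
    have h1 : Real.exp (t * inner ℝ θ x) ≤ 1 + Real.exp (inner ℝ θ x) := by
      rcases le_total 0 (inner ℝ θ x : ℝ) with h | h
      · have : t * inner ℝ θ x ≤ inner ℝ θ x := mul_le_of_le_one_left h ht.2.le
        linarith [Real.exp_le_exp.2 this]
      · have : Real.exp (t * inner ℝ θ x) ≤ 1 :=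
          Real.exp_le_one_iff.2 (mul_nonpos_of_nonneg_of_nonpos ht.1.le h)
        linarith [Real.exp_pos (inner ℝ θ x : ℝ)]
    calc Real.exp (t * inner ℝ θ x) * ‖P x‖ ≤ (1 + Real.exp (inner ℝ θ x)) * ‖P x‖ := by gcongr
      _ = _ := by ring
  · exact hint.norm.add (hP.integrable hθ).norm
  · refine Eventually.of_forall fun x => ?_
    have h1 : Continuous fun t : ℝ => Real.exp (inner ℝ (t • θ) x) • P x := by
      simp_rw [real_inner_smul_left]; fun_prop
    have h2 := (h1.tendsto 0).mono_left (nhdsWithin_le_nhds (s := Set.Ioi 0))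
    simpa using h2

end Invariance

/-! ### The square and the Jordan product. -/

section Square

/-- The Jordan product as a continuous bilinear map. -/
noncomputable def jordanL : Herm β n →L[ℝ] Herm β n →L[ℝ] Herm β n :=
  LinearMap.toContinuousLinearMap
    { toFun := fun x => LinearMap.toContinuousLinearMap
        { toFun := fun y => tripleL x y 1
          map_add' := fun y z => by
            rw [tripleL_comm, tripleL_add_left, LinearMap.add_apply, tripleL_comm y,
              tripleL_comm z]
          map_smul' := fun c y => by
            rw [tripleL_smul_right, LinearMap.smul_apply, RingHom.id_apply] }
      map_add' := fun x y => by
        ext z : 1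
        change tripleL (x + y) z 1 = tripleL x z 1 + tripleL y z 1
        rw [tripleL_add_left, LinearMap.add_apply]
      map_smul' := fun c x => by
        ext z : 1
        change tripleL (c • x) z 1 = c • tripleL x z 1
        rw [tripleL_smul_left, LinearMap.smul_apply] }

theorem jordanL_apply (x y : Herm β n) : jordanL x y = tripleL x y 1 := rfl

theorem jordanL_self (x : Herm β n) : jordanL x x = sq x := tripleL_self_one x

theorem jordanL_comm (x y : Herm β n) : jordanL x y = jordanL y x := by
  rw [jordanL_apply, jordanL_apply, tripleL_comm]

theorem sq_add (x y : Herm β n) : sq (x + y) = sq x + sq y + (2 : ℝ) • jordanL x y := by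
  rw [← jordanL_self, ← jordanL_self, ← jordanL_self, map_add, map_add, _root_.add_apply,
    _root_.add_apply, jordanL_comm y x]
  module

theorem sq_sub (x y : Herm β n) : sq (x - y) = sq x + sq y - (2 : ℝ) • jordanL x y := by
  rw [← jordanL_self, ← jordanL_self, ← jordanL_self, map_sub, map_sub, _root_.sub_apply,
    _root_.sub_apply, jordanL_comm y x]
  module

theorem sq_smul (c : ℝ) (x : Herm β n) : sq (c • x) = c ^ 2 • sq x := by
  rw [← jordanL_self, ← jordanL_self, map_smul, map_smul, _root_.smul_apply, smul_smul, pow_two]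

theorem contDiff_sq {k : WithTop ℕ∞} : ContDiff ℝ k (sq : Herm β n → Herm β n) := by
  have : (sq : Herm β n → Herm β n) = fun x => jordanL x x := funext fun x => (jordanL_self x).symm
  rw [this]
  exact jordanL.contDiff.clm_apply contDiff_id

theorem continuous_sq : Continuous (sq : Herm β n → Herm β n) :=
  (contDiff_sq (k := 0)).continuous

theorem exists_norm_sq_le : ∃ C, 0 ≤ C ∧ ∀ x : Herm β n, ‖sq x‖ ≤ C * ‖x‖ ^ 2 := by
  obtain ⟨C, hC⟩ := (isCompact_closedBall (0 : Herm β n) 1).exists_bound_of_continuousOn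
    (f := sq) continuous_sq.continuousOn
  have hC0 : 0 ≤ C := (norm_nonneg _).trans (hC 0 (by simp))
  refine ⟨C, hC0, fun x => ?_⟩
  have h1 := hC ((‖x‖)⁻¹ • x) (by
    rw [mem_closedBall_zero_iff, norm_smul, norm_inv, norm_norm]
    exact inv_mul_le_one)
  by_cases hx : x = 0
  · subst hx
    have h2 : sq (0 : Herm β n) = 0 := by rw [← jordanL_self, map_zero]
    simp [h2]
  · rw [sq_smul, norm_smul, norm_pow, norm_inv, norm_norm, inv_pow, inv_mul_le_iff₀ (by positivity),
      mul_comm] at h1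
    exact h1

theorem SubExponential.sq : SubExponential (sq : Herm β n → Herm β n) := by
  obtain ⟨C, hC, h⟩ := exists_norm_sq_le (β := β) (n := n)
  exact .of_norm_le continuous_sq hC h

end Square

/-! ### Affine and exponential substitutions in the eigenvalue operator. -/

section Muirhead

/-- The trace has all first partial derivatives equal to `1`, so it cancels in the divided
differences and in `∂ᵢ²`. -/
theorem muirhead_affine {f : (Fin n → ℝ) → ℝ} {v : Fin n → ℝ} (hf : ContDiffAt ℝ 2 f v)
    (α c : ℝ) (i : Fin n) :
    partialD i (fun w => α * f w + c * ∑ k, w k) v = α * partialD i f v + c ∧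
    muirhead β (fun w => α * f w + c * ∑ k, w k) v i = α * muirhead β f v i := by
  have hl : ∀ (w : Fin n → ℝ) , HasFDerivAt (fun w : Fin n → ℝ => ∑ k, w k)
      (∑ k, ContinuousLinearMap.proj (R := ℝ) (φ := fun _ : Fin n => ℝ) k) w := by
    intro w
    exact HasFDerivAt.fun_sum fun k _ => hasFDerivAt_apply k w
  have h1 : ∀ w, DifferentiableAt ℝ f w → ∀ i,
      partialD i (fun w => α * f w + c * ∑ k, w k) w = α * partialD i f w + c := by
    intro w hw i
    have := (hw.hasFDerivAt.const_mul α).fun_add ((hl w).const_mul c)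
    rw [partialD, this.fderiv]
    simp [partialD, Pi.single_apply]
  have h2 : ∀ᶠ w in 𝓝 v, DifferentiableAt ℝ f w :=
    (hf.eventually (by simp)).mono fun w hw => hw.differentiableAt two_ne_zero
  have h3 : partialD i (fun w => α * f w + c * ∑ k, w k) =ᶠ[𝓝 v]
      fun w => α * partialD i f w + c := h2.mono fun w hw => h1 w hw i
  have h4 : DifferentiableAt ℝ (partialD i f) v := by
    have h1 : ContDiffAt ℝ 1 (fderiv ℝ f) v := hf.fderiv_right (by norm_num)
    exact (h1.differentiableAt one_ne_zero).clm_apply (differentiableAt_const _)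
  refine ⟨h1 v h2.self_of_nhds i, ?_⟩
  rw [muirhead, partialD_congr h3, partialD, (h4.hasFDerivAt.const_mul α |>.add_const c).fderiv]
  simp_rw [h1 v h2.self_of_nhds]
  have h5 : ∀ j, (α * partialD i f v + c - (α * partialD j f v + c)) / (v i - v j) =
      α * ((partialD i f v - partialD j f v) / (v i - v j)) := fun j => by ring
  simp_rw [h5]
  rw [← Finset.mul_sum, muirhead, _root_.smul_apply, smul_eq_mul, ← partialD]
  ring

/-- This is the substitution that linearizes a Riccati equation: the square of the first derivative
is absorbed by the exponential. -/
theorem muirhead_exp {f : (Fin n → ℝ) → ℝ} {v : Fin n → ℝ} (hf : ContDiffAt ℝ 2 f v)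
    (i : Fin n) :
    partialD i (fun w => Real.exp (f w)) v = Real.exp (f v) * partialD i f v ∧
    muirhead β (fun w => Real.exp (f w)) v i =
      Real.exp (f v) * (muirhead β f v i + partialD i f v ^ 2) := by
  have h1 : ∀ w, DifferentiableAt ℝ f w → ∀ i,
      partialD i (fun w => Real.exp (f w)) w = Real.exp (f w) * partialD i f w := by
    intro w hw i
    rw [partialD, hw.hasFDerivAt.exp.fderiv]
    simp [partialD]
  have h2 : ∀ᶠ w in 𝓝 v, DifferentiableAt ℝ f w :=
    (hf.eventually (by simp)).mono fun w hw => hw.differentiableAt two_ne_zero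
  have h3 : partialD i (fun w => Real.exp (f w)) =ᶠ[𝓝 v]
      fun w => Real.exp (f w) * partialD i f w := h2.mono fun w hw => h1 w hw i
  have h4 : DifferentiableAt ℝ (partialD i f) v := by
    have h1 : ContDiffAt ℝ 1 (fderiv ℝ f) v := hf.fderiv_right (by norm_num)
    exact (h1.differentiableAt one_ne_zero).clm_apply (differentiableAt_const _)
  have hv := h2.self_of_nhds
  refine ⟨h1 v hv i, ?_⟩
  rw [muirhead, partialD_congr h3, partialD, (hv.hasFDerivAt.exp.fun_mul h4.hasFDerivAt).fderiv]
  simp_rw [h1 v hv]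
  have h5 : ∀ j, (Real.exp (f v) * partialD i f v - Real.exp (f v) * partialD j f v) / (v i - v j) =
      Real.exp (f v) * ((partialD i f v - partialD j f v) / (v i - v j)) := fun j => by ring
  simp_rw [h5]
  rw [← Finset.mul_sum, muirhead]
  simp only [_root_.add_apply, _root_.smul_apply, smul_eq_mul]
  rw [← partialD, ← partialD]
  ring

end Muirhead

/-! ### The cumulant equation in terms of eigenvalues. -/

section RegularDomain

variable {μ : Measure (Herm β n)}

/-- The vectors with distinct entries whose diagonal matrix lies in the Laplace domain. -/
def regularDomain (μ : Measure (Herm β n)) : Set (Fin n → ℝ) :=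
  {v | Function.Injective v ∧ (diag v : Herm β n) ∈ laplaceDomain μ}

theorem isOpen_diag_preimage (μ : Measure (Herm β n)) :
    IsOpen {v : Fin n → ℝ | (diag v : Herm β n) ∈ laplaceDomain μ} :=
  (isOpen_laplaceDomain μ).preimage diagL.continuous

theorem isOpen_regularDomain (μ : Measure (Herm β n)) : IsOpen (regularDomain μ) := by
  refine IsOpen.inter ?_ (isOpen_diag_preimage μ)
  have : {v : Fin n → ℝ | Function.Injective v} =
      ⋂ i : Fin n, ⋂ j : Fin n, {v | i ≠ j → v i ≠ v j} := by
    ext v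
    simp only [Set.mem_iInter]
    exact ⟨fun h i j hij hv => hij (h hv), fun h i j hv => by_contra fun hij => h i j hij hv⟩
  change IsOpen {v : Fin n → ℝ | Function.Injective v}
  rw [this]
  refine isOpen_iInter_of_finite fun i => isOpen_iInter_of_finite fun j => ?_
  by_cases hij : i = j
  · simp [hij]
  · simp only [ne_eq, hij, not_false_eq_true, forall_const]
    exact isOpen_ne_fun (continuous_apply i) (continuous_apply j)

theorem isOpen_sigmaDomain (μ : Measure (Herm β n)) : IsOpen (sigmaDomain μ) :=
  isOpen_image_elemSymm (isOpen_regularDomain μ) fun _ hv => hv.1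

theorem tilt_sq_conj (hμ : IsRotationInvariant μ) {U : Matrix (Fin n) (Fin n) β.Scalar}
    (hU : U ∈ unitary _) (θ : Herm β n) : tilt μ sq (conj U θ) = conj U (tilt μ sq θ) := by
  have h := (conjE U hU).toLinearIsometry.integral_comp_comm (μ := μ)
    (φ := fun x => Real.exp (inner ℝ θ x) • sq x)
  rw [tilt, tilt, laplace_conj hμ hU, expInt_conj hμ hU, conj_smul, expInt, expInt]
  congr 1
  refine Eq.trans ?_ h
  refine integral_congr_ae (Eventually.of_forall fun x => ?_)
  change Real.exp _ • sq (conj U x) = conj U _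
  rw [conj_smul, conj_sq hU]

/-- Conjugates of diagonal matrices with distinct entries are dense by `mem_closure_conj_diag`, so
equivariance and continuity carry the vanishing to all of `Θ`. -/
theorem eq_zero_of_diag (hμ : IsRotationInvariant μ) {F : Herm β n → Herm β n}
    (hFc : ContinuousOn F (laplaceDomain μ))
    (hF : ∀ U ∈ unitary (Matrix (Fin n) (Fin n) β.Scalar), ∀ θ, F (conj U θ) = conj U (F θ))
    (h0 : ∀ v ∈ regularDomain μ, F (diag v) = 0) {θ : Herm β n} (hθ : θ ∈ laplaceDomain μ) :
    F θ = 0 := by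
  by_contra hne
  have h1 : ∀ᶠ η in 𝓝 θ, F η ≠ 0 :=
    (hFc.continuousAt ((isOpen_laplaceDomain μ).mem_nhds hθ)).eventually_ne hne
  obtain ⟨x, ⟨hx1, hx2⟩, U, hU, v, hv, rfl⟩ := mem_closure_iff_nhds.1 (mem_closure_conj_diag θ) _
    (h1.and ((isOpen_laplaceDomain μ).mem_nhds hθ))
  have hv' : v ∈ regularDomain μ := ⟨hv, (conj_mem_laplaceDomain_iff hμ hU).1 hx2⟩
  apply hx1
  rw [hF U hU, h0 v hv', ← conjE_apply U hU, map_zero]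

/-- `k` as a function of the eigenvalues. -/
noncomputable def eigenLog (μ : Measure (Herm β n)) (v : Fin n → ℝ) : ℝ := logLaplace μ (diag v)

variable [IsProbabilityMeasure μ]

theorem contDiffOn_eigenLog :
    ContDiffOn ℝ ∞ (eigenLog μ) {v : Fin n → ℝ | (diag v : Herm β n) ∈ laplaceDomain μ} :=
  contDiffOn_logLaplace.comp diagL.contDiff.contDiffOn fun _ h => h

theorem contDiffAt_eigenLog {v : Fin n → ℝ} (hv : (diag v : Herm β n) ∈ laplaceDomain μ)
    {k : ℕ} : ContDiffAt ℝ k (eigenLog μ) v :=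
  (contDiffOn_eigenLog.contDiffAt ((isOpen_diag_preimage μ).mem_nhds hv)).of_le
    (by exact_mod_cast le_top)

theorem partialD_eigenLog {v : Fin n → ℝ} (hv : (diag v : Herm β n) ∈ laplaceDomain μ)
    (i : Fin n) : partialD i (eigenLog μ) v =
      inner ℝ (diag (Pi.single i 1)) (gradient (logLaplace μ) (diag v)) := by
  have h1 := (hasGradientAt_logLaplace hv).hasFDerivAt
  rw [← diagL_apply] at h1
  have h2 : HasFDerivAt (eigenLog μ) _ v := HasFDerivAt.comp v h1 diagL.hasFDerivAt
  rw [partialD, h2.fderiv, gradient_logLaplace hv, real_inner_comm]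
  simp

theorem gradient_logLaplace_diag (hμ : IsRotationInvariant μ) {v : Fin n → ℝ}
    (hv : (diag v : Herm β n) ∈ laplaceDomain μ) :
    gradient (logLaplace μ) (diag v) = diag fun i => partialD i (eigenLog μ) v := by
  rw [equivariant_diag (fun U hU θ hθ => gradient_logLaplace_conj hμ hU hθ) hv]
  congr 1
  funext i
  rw [partialD_eigenLog hv, inner_diag_left]
  simp [Pi.single_apply]

theorem Psi_hessian_diag (hμ : IsRotationInvariant μ) {v : Fin n → ℝ}
    (hv : v ∈ regularDomain μ) :
    Psi (fderiv ℝ (gradient (logLaplace μ)) (diag v) : Herm β n →ₗ[ℝ] Herm β n) 1 =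
      diag fun i => muirhead β (eigenLog μ) v i := by
  have hT := (hasFDerivAt_gradient_logLaplace hv.2).differentiableAt.hasFDerivAt
  rw [Psi_fderiv_equivariant (isOpen_laplaceDomain μ)
    (fun U hU θ hθ => gradient_logLaplace_conj hμ hU hθ) hv.2 hv.1 hT
    (gradient_logLaplace_diag hμ hv.2)]
  congr 1
  funext i
  rw [muirhead]
  congr 1
  have h1 : partialD i (eigenLog μ) =ᶠ[𝓝 v] fun w =>
      inner ℝ (diag (Pi.single i 1)) (gradient (logLaplace μ) (diag w)) := by
    filter_upwards [(isOpen_diag_preimage μ).mem_nhds hv.2] with w hw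
    exact partialD_eigenLog hw i
  rw [partialD_congr h1, partialD]
  rw [← diagL_apply] at hT
  have h2 : HasFDerivAt (fun w => gradient (logLaplace μ) (diag w)) _ v :=
    HasFDerivAt.comp (g := gradient (logLaplace μ)) (f := fun w : Fin n → ℝ => (diag w : Herm β n))
      v hT diagL.hasFDerivAt
  have h3 : HasFDerivAt (fun w => (inner ℝ (diag (Pi.single i 1) : Herm β n)
    (gradient (logLaplace μ) (diag w)) : ℝ)) _ v :=
    (innerSL ℝ (diag (Pi.single i 1) : Herm β n)).hasFDerivAt.comp v h2
  rw [h3.fderiv]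
  simp

theorem cumulantEquation_diag_iff (hμ : IsRotationInvariant μ) {v : Fin n → ℝ}
    (hv : v ∈ regularDomain μ) (a b : ℝ) :
    Psi (fderiv ℝ (gradient (logLaplace μ)) (diag v) : Herm β n →ₗ[ℝ] Herm β n) 1 =
      1 + (2 * b) • gradient (logLaplace μ) (diag v) +
        (4 * a) • sq (gradient (logLaplace μ) (diag v)) ↔
    ∀ i, muirhead β (eigenLog μ) v i =
      1 + 2 * b * partialD i (eigenLog μ) v + 4 * a * partialD i (eigenLog μ) v ^ 2 := by
  rw [Psi_hessian_diag hμ hv, gradient_logLaplace_diag hμ hv.2, sq_diag, ← diag_one,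
    ← diagL_apply, ← diagL_apply, ← diagL_apply, ← diagL_apply, ← map_smul, ← map_smul, ← map_add,
    ← map_add, diagL_apply, diagL_apply, diag_injective.eq_iff, funext_iff]
  rfl

/-- In terms of tilted moments the defect of the equation is visibly continuous and equivariant, so
`eq_zero_of_diag` applies. -/
theorem satisfiesCumulantEquation_of_diag (hμ : IsRotationInvariant μ) {a b : ℝ}
    (h : ∀ v ∈ regularDomain μ, ∀ i, muirhead β (eigenLog μ) v i =
      1 + 2 * b * partialD i (eigenLog μ) v + 4 * a * partialD i (eigenLog μ) v ^ 2) :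
    SatisfiesCumulantEquation μ a b := by
  have hmc : ContinuousOn (tilt μ fun x => x) (laplaceDomain μ) := (contDiffOn_tilt .id).continuousOn
  have hmsq : ContinuousOn (fun θ => sq (tilt μ (fun x => x) θ)) (laplaceDomain μ) :=
    continuous_sq.comp_continuousOn hmc
  intro θ hθ
  rw [Psi_fderiv_gradient_logLaplace hθ, gradient_logLaplace hθ, ← sub_eq_zero]
  set F : Herm β n → Herm β n := fun θ => tilt μ sq θ - sq (tilt μ (fun x => x) θ) -
    (1 + (2 * b) • tilt μ (fun x => x) θ + (4 * a) • sq (tilt μ (fun x => x) θ)) with hF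
  have hFc : ContinuousOn F (laplaceDomain μ) := by
    have h1 := (contDiffOn_tilt (μ := μ) .sq).continuousOn
    fun_prop
  have hFU : ∀ U ∈ unitary (Matrix (Fin n) (Fin n) β.Scalar), ∀ θ, F (conj U θ) = conj U (F θ) := by
    intro U hU θ
    have h1 : ∀ x y : Herm β n, conj U (x - y) = conj U x - conj U y := (conjE U hU).map_sub
    simp only [hF]
    rw [tilt_id_conj hμ hU, tilt_sq_conj hμ hU, conj_sq hU, h1, h1, conj_add, conj_add,
      conj_self_one hU, conj_smul, conj_smul]
  refine eq_zero_of_diag hμ hFc hFU (fun v hv => ?_) hθ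
  have h2 := (cumulantEquation_diag_iff hμ hv a b).2 (h v hv)
  rw [Psi_fderiv_gradient_logLaplace hv.2, gradient_logLaplace hv.2] at h2
  simp only [hF]
  rw [h2, sub_self]

theorem satisfiesCumulantEquation_iff (hμ : IsRotationInvariant μ) (a b : ℝ) :
    SatisfiesCumulantEquation μ a b ↔
      ∀ v ∈ regularDomain μ, ∀ i, muirhead β (eigenLog μ) v i =
        1 + 2 * b * partialD i (eigenLog μ) v + 4 * a * partialD i (eigenLog μ) v ^ 2 :=
  ⟨fun h _ hv => (cumulantEquation_diag_iff hμ hv a b).1 (h _ hv.2),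
    satisfiesCumulantEquation_of_diag hμ⟩

end RegularDomain

/-! ### Functions of the elementary symmetric functions and the three systems. -/

section Represents

theorem two_le_infty : (2 : WithTop ℕ∞) ≤ ∞ := by
  have h : ((2 : ℕ∞) : WithTop ℕ∞) ≤ ∞ := WithTop.coe_le_coe.2 le_top
  exact h

variable {μ : Measure (Herm β n)}

theorem conj_one_left (x : Herm β n) : conj 1 x = x :=
  mat_injective (by rw [mat_conj, star_one, one_mul, mul_one])

theorem represents_iff (hμ : IsRotationInvariant μ) {f : Herm β n → ℝ}
    (hf : ∀ U ∈ unitary (Matrix (Fin n) (Fin n) β.Scalar), ∀ θ, f (conj U θ) = f θ)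
    {g : (Fin n → ℝ) → ℝ} :
    Represents μ f g ↔ ∀ v ∈ regularDomain μ, g (elemSymm v) = f (diag v) := by
  refine ⟨fun h v hv => h _ hv.2 v hv.1 ⟨1, one_mem _, (conj_one_left _).symm⟩, ?_⟩
  rintro h θ hθ v hv ⟨U, hU, rfl⟩
  rw [hf U hU, h v ⟨hv, (conj_mem_laplaceDomain_iff hμ hU).1 hθ⟩]

/-- Any choice of a preimage serves: two vectors with distinct entries and the same `σ` differ by a
permutation, which a unitary conjugation realizes. -/
theorem exists_represents (hμ : IsRotationInvariant μ) {f : Herm β n → ℝ}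
    (hf : ∀ U ∈ unitary (Matrix (Fin n) (Fin n) β.Scalar), ∀ θ, f (conj U θ) = f θ) :
    ∃ g, Represents μ f g := by
  classical
  refine ⟨fun s => if h : ∃ v : Fin n → ℝ, Function.Injective v ∧ elemSymm v = s then
    f (diag h.choose) else 0, (represents_iff hμ hf).2 fun v hv => ?_⟩
  have h : ∃ w : Fin n → ℝ, Function.Injective w ∧ elemSymm w = elemSymm v := ⟨v, hv.1, rfl⟩
  rw [dif_pos h]
  obtain ⟨π, hπ⟩ := exists_perm_of_elemSymm_eq h.choose_spec.1 h.choose_spec.2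
  obtain ⟨U, hU, hc⟩ := exists_conj_diag_perm (β := β) π
  rw [hπ, ← hc, hf U hU]

/-- A function on the eigenvalues together with the function of the elementary symmetric functions
which it defines. -/
structure EigenRep (μ : Measure (Herm β n)) (G g : (Fin n → ℝ) → ℝ) : Prop where
  smooth : ContDiffOn ℝ ∞ G (regularDomain μ)
  eq : ∀ v ∈ regularDomain μ, g (elemSymm v) = G v

namespace EigenRep

variable {G g : (Fin n → ℝ) → ℝ}

theorem contDiffOn (h : EigenRep μ G g) : ContDiffOn ℝ 2 g (sigmaDomain μ) :=
  contDiffOn_of_comp_elemSymm (isOpen_regularDomain μ) (fun _ hv => hv.1) two_ne_zero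
    (h.smooth.of_le two_le_infty) h.eq

theorem eventuallyEq (h : EigenRep μ G g) {v : Fin n → ℝ} (hv : v ∈ regularDomain μ) :
    g ∘ elemSymm =ᶠ[𝓝 v] G := by
  filter_upwards [(isOpen_regularDomain μ).mem_nhds hv] with w hw
  exact h.eq w hw

theorem partialD_eq (h : EigenRep μ G g) {v : Fin n → ℝ} (hv : v ∈ regularDomain μ) (i : Fin n) :
    partialD i G v = ∑ q ∈ Finset.Icc 1 n,
      pderiv q g (elemSymm v) * esub v (Finset.univ.erase i) ((q : ℤ) - 1) := by
  rw [← partialD_congr (h.eventuallyEq hv), partialD_comp_elemSymm]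
  exact ((h.contDiffOn.contDiffAt ((isOpen_sigmaDomain μ).mem_nhds
    (Set.mem_image_of_mem _ hv))).differentiableAt two_ne_zero)

theorem muirhead_eq (h : EigenRep μ G g) {v : Fin n → ℝ} (hv : v ∈ regularDomain μ) (i : Fin n) :
    muirhead β G v i = ∑ j ∈ Finset.Icc 1 n,
      opD β g (elemSymm v) j * esub v (Finset.univ.erase i) ((j : ℤ) - 1) := by
  rw [← muirhead_congr (h.eventuallyEq hv), muirhead_comp_elemSymm (isOpen_sigmaDomain μ)
    h.contDiffOn (Set.mem_image_of_mem _ hv) hv.1]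

theorem opD_eq_iff (h : EigenRep μ G g) (R : (Fin n → ℝ) → ℕ → ℝ) :
    (∀ s ∈ sigmaDomain μ, ∀ j ∈ Finset.Icc 1 n, opD β g s j = R s j) ↔
    ∀ v ∈ regularDomain μ, ∀ i, muirhead β G v i = ∑ j ∈ Finset.Icc 1 n,
      R (elemSymm v) j * esub v (Finset.univ.erase i) ((j : ℤ) - 1) := by
  constructor
  · intro hs v hv i
    rw [h.muirhead_eq hv]
    exact Finset.sum_congr rfl fun j hj => by rw [hs _ (Set.mem_image_of_mem _ hv) j hj]
  · rintro hv _ ⟨v, hvm, rfl⟩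
    exact eq_of_sum_esub_eq hvm.1 fun i => by rw [← h.muirhead_eq hvm, hv v hvm]

theorem sum_ite_esub (v : Fin n → ℝ) (i : Fin n) (c : ℝ) :
    ∑ j ∈ Finset.Icc 1 n, (if j = 1 then c else 0) *
      esub v (Finset.univ.erase i) ((j : ℤ) - 1) = c := by
  rw [Finset.sum_eq_single 1]
  · simp [esub_zero]
  · intro j _ hj
    rw [if_neg hj, zero_mul]
  · intro h
    exact absurd (Finset.mem_Icc.2 ⟨le_rfl, Fin.pos i⟩) h

theorem opD_eq_ite_iff (h : EigenRep μ G g) (c : (Fin n → ℝ) → ℝ) :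
    (∀ s ∈ sigmaDomain μ, ∀ j ∈ Finset.Icc 1 n, opD β g s j = if j = 1 then c s else 0) ↔
    ∀ v ∈ regularDomain μ, ∀ i, muirhead β G v i = c (elemSymm v) := by
  rw [h.opD_eq_iff]
  simp_rw [sum_ite_esub]

end EigenRep

variable [IsProbabilityMeasure μ]

theorem contDiffOn_eigenLog_affine (α c : ℝ) :
    ContDiffOn ℝ ∞ (fun v => α * eigenLog μ v + c * ∑ k, v k)
      {v : Fin n → ℝ | (diag v : Herm β n) ∈ laplaceDomain μ} := by
  have h := contDiffOn_eigenLog (μ := μ)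
  fun_prop

theorem tr_conj {U : Matrix (Fin n) (Fin n) β.Scalar} (hU : U ∈ unitary _) (x : Herm β n) :
    tr (conj U x) = tr x := by
  rw [← inner_one_left, ← inner_one_left, ← inner_conj_conj hU 1 x, conj_self_one hU]

theorem systemI_rep (hμ : IsRotationInvariant μ) (a b : ℝ) {g : (Fin n → ℝ) → ℝ}
    (hg : Represents μ (fun θ => Real.exp (-4 * a * logLaplace μ θ - b * tr θ)) g) :
    EigenRep μ (fun v => Real.exp (-4 * a * eigenLog μ v + -b * ∑ k, v k)) g := by
  refine ⟨((contDiffOn_eigenLog_affine _ _).mono fun v hv => hv.2).exp, fun v hv => ?_⟩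
  rw [(represents_iff hμ fun U hU θ => ?_).1 hg v hv]
  · simp only [tr_diag, eigenLog]
    ring_nf
  · simp only [logLaplace_conj hμ hU, tr_conj hU]

theorem systemII_rep (hμ : IsRotationInvariant μ) (b : ℝ) {g : (Fin n → ℝ) → ℝ}
    (hg : Represents μ (fun θ => logLaplace μ θ + 1 / (2 * b) * tr θ) g) :
    EigenRep μ (fun v => 1 * eigenLog μ v + 1 / (2 * b) * ∑ k, v k) g := by
  refine ⟨(contDiffOn_eigenLog_affine _ _).mono fun v hv => hv.2, fun v hv => ?_⟩
  rw [(represents_iff hμ fun U hU θ => ?_).1 hg v hv]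
  · simp only [tr_diag, eigenLog, one_mul]
  · simp only [logLaplace_conj hμ hU, tr_conj hU]

theorem systemIII_rep (hμ : IsRotationInvariant μ) {g : (Fin n → ℝ) → ℝ}
    (hg : Represents μ (logLaplace μ) g) : EigenRep μ (eigenLog μ) g :=
  ⟨contDiffOn_eigenLog.mono fun _ hv => hv.2, fun v hv =>
    (represents_iff hμ fun _ hU θ => logLaplace_conj hμ hU θ).1 hg v hv⟩

/-- Let `p = ∂ᵢk` and let `m` be the value of the eigenvalue operator on `k`. The system reads `-4a
m + (4a p + b)² = b² - 4a`, and division by `-4a` gives `m = 1 + 2b p + 4a p²`. -/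
theorem systemI_iff (hμ : IsRotationInvariant μ) {a : ℝ} (ha : a ≠ 0) (b : ℝ)
    {g : (Fin n → ℝ) → ℝ} : SystemI μ a b g ↔
    Represents μ (fun θ => Real.exp (-4 * a * logLaplace μ θ - b * tr θ)) g ∧
      SatisfiesCumulantEquation μ a b := by
  refine and_congr_right fun hg => ?_
  have hr := systemI_rep hμ a b hg
  rw [hr.opD_eq_ite_iff, satisfiesCumulantEquation_iff hμ]
  refine forall₂_congr fun v hv => forall_congr' fun i => ?_
  have h1 := contDiffAt_eigenLog (k := 2) hv.2
  have h2 : ContDiffAt ℝ 2 (fun v => -4 * a * eigenLog μ v + -b * ∑ k, v k) v :=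
    ((contDiffOn_eigenLog_affine _ _).contDiffAt ((isOpen_diag_preimage μ).mem_nhds hv.2)).of_le two_le_infty
  rw [(muirhead_exp h2 i).2, (muirhead_affine (β := β) h1 _ _ i).1, (muirhead_affine h1 _ _ i).2, hr.eq v hv,
    mul_comm (b ^ 2 - 4 * a), mul_right_inj' (Real.exp_ne_zero _)]
  constructor
  · intro h
    have h3 : -4 * a * (muirhead β (eigenLog μ) v i) = -4 * a *
      (1 + 2 * b * partialD i (eigenLog μ) v + 4 * a * partialD i (eigenLog μ) v ^ 2) := by
      linear_combination h
    exact mul_left_cancel₀ (by simpa using ha) h3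
  · intro h
    rw [h]
    ring

/-- The summand `tr / (2b)` adds `1 / (2b)` to each `∂ᵢ`, and `2b · 1/(2b)` is the constant `1` of
the cumulant equation. The right side `2b (g₁, …, gₙ)` is `2b ∂ᵢ` by the chain rule. -/
theorem systemII_iff (hμ : IsRotationInvariant μ) {b : ℝ} (hb : b ≠ 0)
    {g : (Fin n → ℝ) → ℝ} : SystemII μ b g ↔
    Represents μ (fun θ => logLaplace μ θ + 1 / (2 * b) * tr θ) g ∧
      SatisfiesCumulantEquation μ 0 b := by
  refine and_congr_right fun hg => ?_
  have hr := systemII_rep hμ b hg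
  rw [hr.opD_eq_iff fun s j => 2 * b * pderiv j g s, satisfiesCumulantEquation_iff hμ]
  refine forall₂_congr fun v hv => forall_congr' fun i => ?_
  have h1 := contDiffAt_eigenLog (k := 2) hv.2
  simp_rw [mul_assoc (2 * b)]
  rw [← Finset.mul_sum, ← hr.partialD_eq hv, (muirhead_affine (β := β) h1 _ _ i).1,
    (muirhead_affine h1 _ _ i).2]
  have h2 : 2 * b * (1 / (2 * b)) = 1 := by field_simp
  constructor <;> intro h
  · linear_combination h + h2
  · linear_combination h - h2

theorem systemIII_iff (hμ : IsRotationInvariant μ) {g : (Fin n → ℝ) → ℝ} :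
    SystemIII μ g ↔ Represents μ (logLaplace μ) g ∧ SatisfiesCumulantEquation μ 0 0 := by
  refine and_congr_right fun hg => ?_
  have hr := systemIII_rep hμ hg
  rw [hr.opD_eq_ite_iff, satisfiesCumulantEquation_iff hμ]
  simp

end Represents

/-! ### Points of the domain near the origin and scalar points. -/

section Closure

variable {μ : Measure (Herm β n)}

theorem regularDomain_nonempty (hμ : IsRotationInvariant μ) (h : (laplaceDomain μ).Nonempty) :
    (regularDomain μ).Nonempty := by
  obtain ⟨θ, hθ⟩ := h
  obtain ⟨x, hx, U, hU, v, hv, rfl⟩ := mem_closure_iff_nhds.1 (mem_closure_conj_diag θ) _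
    ((isOpen_laplaceDomain μ).mem_nhds hθ)
  exact ⟨v, hv, (conj_mem_laplaceDomain_iff hμ hU).1 hx⟩

/-- The Laplace domain contains nonzero multiples of the identity matrix. -/
theorem exists_smul_one_mem (hn : 1 ≤ n) (hμ : IsRotationInvariant μ)
    (h : (laplaceDomain μ).Nonempty) : ∃ c : ℝ, c ≠ 0 ∧ c • (1 : Herm β n) ∈ laplaceDomain μ := by
  obtain ⟨v, hv⟩ := regularDomain_nonempty hμ h
  have h1 : ∀ π : Equiv.Perm (Fin n), (diag (v ∘ π) : Herm β n) ∈ laplaceDomain μ := by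
    intro π
    obtain ⟨U, hU, hc⟩ := exists_conj_diag_perm (β := β) π
    rw [← hc]
    exact conj_mem_laplaceDomain hμ hU hv.2
  have : NeZero n := ⟨by omega⟩
  -- The average of `v` over cyclic shifts of its entries is constant, equal to the mean `c0`; it
  -- lies in `Θ` by convexity. If the mean is zero, openness gives a nonzero multiple of the
  -- identity nearby.
  set c0 : ℝ := (Fintype.card (Fin n) : ℝ)⁻¹ * ∑ k, v k with hc0
  have h2 : c0 • (1 : Herm β n) ∈ laplaceDomain μ := by
    have h3 : ∑ k : Fin n, (Fintype.card (Fin n) : ℝ)⁻¹ •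
        (diag (v ∘ Equiv.addRight k) : Herm β n) ∈ laplaceDomain μ := by
      refine (convex_laplaceDomain μ).sum_mem (fun k _ => by positivity) ?_ fun k _ => h1 _
      rw [Finset.sum_const, Finset.card_univ, nsmul_eq_mul, mul_inv_cancel₀]
      simp [NeZero.ne n]
    convert h3 using 1
    rw [← Finset.smul_sum]
    simp_rw [← diagL_apply]
    rw [← map_sum, ← map_smul, ← diag_one, ← diagL_apply, ← map_smul]
    congr 1
    funext i
    simp only [Pi.smul_apply, Finset.sum_apply, Function.comp_apply, Equiv.coe_addRight,
      smul_eq_mul, mul_one, hc0]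
    congr 1
    exact (Equiv.sum_comp (Equiv.addLeft i) v).symm
  have h3 : Continuous fun c : ℝ => c • (1 : Herm β n) := by fun_prop
  have h4 : ∀ᶠ c in 𝓝[≠] c0, c • (1 : Herm β n) ∈ laplaceDomain μ :=
    (h3.continuousAt.eventually ((isOpen_laplaceDomain μ).mem_nhds h2)).filter_mono
      nhdsWithin_le_nhds
  by_cases h0 : c0 = 0
  · obtain ⟨c, hc, hc2⟩ := (h4.and eventually_mem_nhdsWithin).exists
    exact ⟨c, fun h => hc2 (h.trans h0.symm), hc⟩
  · exact ⟨c0, h0, h2⟩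

variable [IsProbabilityMeasure μ]

theorem smul_mem_regularDomain {v : Fin n → ℝ} (hv : v ∈ regularDomain μ) {t : ℝ} (ht0 : 0 < t)
    (ht1 : t ≤ 1) : t • v ∈ regularDomain μ := by
  refine ⟨fun i j hij => hv.1 (mul_left_cancel₀ ht0.ne' hij), ?_⟩
  rw [← diagL_apply, map_smul]
  exact smul_mem_laplaceDomain hv.2 ht0 ht1

theorem elemSymm_zero : elemSymm (0 : Fin n → ℝ) = 0 := by
  funext i
  have h := esub_smul 0 (0 : Fin n → ℝ) Finset.univ (i + 1)
  rw [elemSymm_apply]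
  simpa using h

theorem tendsto_smul_regularDomain {v : Fin n → ℝ} (hv : v ∈ regularDomain μ) :
    Tendsto (fun t : ℝ => elemSymm (t • v)) (𝓝[>] 0) (𝓝[sigmaDomain μ] 0) := by
  refine tendsto_nhdsWithin_iff.2 ⟨?_, ?_⟩
  · have h1 : Continuous fun t : ℝ => elemSymm (t • v) :=
      (contDiff_elemSymm (k := 0)).continuous.comp (by fun_prop)
    have h2 := (h1.tendsto 0).mono_left (nhdsWithin_le_nhds (s := Set.Ioi 0))
    rwa [zero_smul, elemSymm_zero] at h2
  · filter_upwards [Ioo_mem_nhdsGT (zero_lt_one (α := ℝ))] with t ht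
    exact Set.mem_image_of_mem _ (smul_mem_regularDomain hv ht.1 ht.2.le)

theorem zero_mem_closure_sigmaDomain (hμ : IsRotationInvariant μ)
    (h : (laplaceDomain μ).Nonempty) : (0 : Fin n → ℝ) ∈ closure (sigmaDomain μ) := by
  obtain ⟨v, hv⟩ := regularDomain_nonempty hμ h
  exact mem_closure_iff_nhdsWithin_neBot.2 (tendsto_smul_regularDomain hv).neBot

end Closure

/-! ### Uniqueness of Laplace transforms on an open set. -/

section Uniqueness

/-- For fixed `t` the functions `z ↦ ∫ exp(z⟨x|t⟩)` are holomorphic on a strip around the imaginary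
axis and agree on a real interval, hence also at `z = i`, where they are the characteristic
functions at `t`. -/
theorem ext_of_integral_exp_inner_eq {ρ₁ ρ₂ : Measure (Herm β n)} [IsFiniteMeasure ρ₁]
    [IsFiniteMeasure ρ₂] {δ : ℝ} (hδ : 0 < δ)
    (h₁ : ∀ η : Herm β n, ‖η‖ < δ → Integrable (fun x => Real.exp (inner ℝ η x)) ρ₁)
    (h₂ : ∀ η : Herm β n, ‖η‖ < δ → Integrable (fun x => Real.exp (inner ℝ η x)) ρ₂)
    (h : ∀ η : Herm β n, ‖η‖ < δ →
      ∫ x, Real.exp (inner ℝ η x) ∂ρ₁ = ∫ x, Real.exp (inner ℝ η x) ∂ρ₂) : ρ₁ = ρ₂ := by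
  refine Measure.ext_of_charFun (funext fun t => ?_)
  set X : Herm β n → ℝ := fun x => inner ℝ x t with hX
  set r : ℝ := δ / (‖t‖ + 1) with hr
  have ht : 0 < ‖t‖ + 1 := by positivity
  have hr0 : 0 < r := by positivity
  have hball : ∀ s ∈ Set.Ioo (-r) r, ‖s • t‖ < δ := by
    intro s hs
    rw [norm_smul, Real.norm_eq_abs]
    calc |s| * ‖t‖ ≤ |s| * (‖t‖ + 1) := by gcongr; linarith
      _ < r * (‖t‖ + 1) := by gcongr; exact abs_lt.2 hs
      _ = δ := by rw [hr]; field_simp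
  have hexp : ∀ s : ℝ, (fun x => Real.exp (s * X x)) = fun x => Real.exp (inner ℝ (s • t) x) := by
    intro s
    funext x
    rw [real_inner_smul_left, hX, real_inner_comm]
  have hset : ∀ ρ : Measure (Herm β n),
      (∀ η : Herm β n, ‖η‖ < δ → Integrable (fun x => Real.exp (inner ℝ η x)) ρ) →
      {z : ℂ | z.re ∈ Set.Ioo (-r) r} ⊆
        {z | z.re ∈ interior (ProbabilityTheory.integrableExpSet X ρ)} := by
    intro ρ hρ z hz
    refine interior_maximal (fun s hs => ?_) isOpen_Ioo hz
    change Integrable _ _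
    rw [hexp]
    exact hρ _ (hball s hs)
  have hA₁ := (ProbabilityTheory.analyticOnNhd_complexMGF (X := X) (μ := ρ₁)).mono (hset ρ₁ h₁)
  have hA₂ := (ProbabilityTheory.analyticOnNhd_complexMGF (X := X) (μ := ρ₂)).mono (hset ρ₂ h₂)
  have hconn : IsPreconnected {z : ℂ | z.re ∈ Set.Ioo (-r) r} :=
    ((convex_Ioo (-r) r).linear_preimage Complex.reLm).isPreconnected
  have h0 : (((0 : ℝ) : ℂ)) ∈ {z : ℂ | z.re ∈ Set.Ioo (-r) r} := by
    change (0 : ℝ) ∈ Set.Ioo (-r) r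
    exact ⟨neg_lt_zero.2 hr0, hr0⟩
  have hreal : ∀ᶠ s : ℝ in 𝓝[≠] 0, ProbabilityTheory.complexMGF X ρ₁ s =
      ProbabilityTheory.complexMGF X ρ₂ s := by
    refine nhdsWithin_le_nhds ?_
    filter_upwards [Ioo_mem_nhds (neg_lt_zero.2 hr0) hr0] with s hs
    rw [ProbabilityTheory.complexMGF_ofReal, ProbabilityTheory.complexMGF_ofReal,
      ProbabilityTheory.mgf, ProbabilityTheory.mgf, hexp, h _ (hball s hs)]
  have hfreq : ∃ᶠ z : ℂ in 𝓝[≠] ((0 : ℝ) : ℂ), ProbabilityTheory.complexMGF X ρ₁ z =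
      ProbabilityTheory.complexMGF X ρ₂ z := by
    have hT : Tendsto (fun s : ℝ => (s : ℂ)) (𝓝[≠] 0) (𝓝[≠] ((0 : ℝ) : ℂ)) := by
      refine tendsto_nhdsWithin_iff.2 ⟨(Complex.continuous_ofReal.tendsto 0).mono_left
        nhdsWithin_le_nhds, ?_⟩
      filter_upwards [eventually_mem_nhdsWithin] with s hs
      simpa using hs
    exact hT.frequently hreal.frequently
  have hEq := hA₁.eqOn_of_preconnected_of_frequently_eq hA₂ hconn h0 hfreq
  have hI : Complex.I ∈ {z : ℂ | z.re ∈ Set.Ioo (-r) r} := by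
    change Complex.I.re ∈ Set.Ioo (-r) r
    rw [Complex.I_re]
    exact ⟨neg_lt_zero.2 hr0, hr0⟩
  have := hEq hI
  rw [ProbabilityTheory.complexMGF, ProbabilityTheory.complexMGF] at this
  rw [charFun_apply, charFun_apply]
  simp_rw [mul_comm _ Complex.I]
  exact this

variable {Ω : Type} [MeasurableSpace Ω] {ν : Measure Ω}

/-- The image of the measure with density `u⁺` under `S`. -/
noncomputable def densityMap (ν : Measure Ω) (u : Ω → ℝ) (S : Ω → Herm β n) :
    Measure (Herm β n) := (ν.withDensity fun ξ => ENNReal.ofReal (u ξ)).map S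

theorem integral_densityMap {u : Ω → ℝ} (hu : Measurable u) {S : Ω → Herm β n}
    (hS : Measurable S) {f : Herm β n → ℝ} (hf : Measurable f) :
    ∫ x, f x ∂(densityMap ν u S) = ∫ ξ, max (u ξ) 0 * f (S ξ) ∂ν := by
  rw [densityMap, integral_map hS.aemeasurable hf.aestronglyMeasurable,
    integral_withDensity_eq_integral_toReal_smul (by fun_prop) (by simp)]
  simp [ENNReal.toReal_ofReal']

theorem integrable_densityMap_iff {u : Ω → ℝ} (hu : Measurable u) {S : Ω → Herm β n}
    (hS : Measurable S) {f : Herm β n → ℝ} (hf : Measurable f) :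
    Integrable f (densityMap ν u S) ↔ Integrable (fun ξ => max (u ξ) 0 * f (S ξ)) ν := by
  rw [densityMap, integrable_map_measure hf.aestronglyMeasurable hS.aemeasurable,
    integrable_withDensity_iff_integrable_smul' (by fun_prop) (by simp)]
  simp [ENNReal.toReal_ofReal']

/-- Tilt `w` by some `θ ∈ Θ`. The positive and the negative part of the tilted density, mapped by
`S`, are finite measures whose transforms exist and agree near the origin, so the measures are
equal. -/
theorem setIntegral_eq_zero_of_integral_exp_eq_zero {Θ : Set (Herm β n)} (hΘ : IsOpen Θ)
    (hne : Θ.Nonempty) {w : Ω → ℝ} (hw : Measurable w) (hwi : Integrable w ν)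
    {S : Ω → Herm β n} (hS : Measurable S)
    (hint : ∀ θ ∈ Θ, Integrable (fun ξ => Real.exp (inner ℝ θ (S ξ)) * w ξ) ν)
    (h0 : ∀ θ ∈ Θ, ∫ ξ, Real.exp (inner ℝ θ (S ξ)) * w ξ ∂ν = 0) {B : Set (Herm β n)}
    (hB : MeasurableSet B) : ∫ ξ in S ⁻¹' B, w ξ ∂ν = 0 := by
  obtain ⟨θ, hθ⟩ := hne
  obtain ⟨δ, hδ, hball⟩ := Metric.isOpen_iff.1 hΘ θ hθ
  set u : Ω → ℝ := fun ξ => Real.exp (inner ℝ θ (S ξ)) * w ξ with hu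
  have hum : Measurable u := by fun_prop
  have hmem : ∀ η : Herm β n, ‖η‖ < δ → θ + η ∈ Θ := fun η hη => hball (by simpa using hη)
  have hmul : ∀ (σ : ℝ) (η : Herm β n) (ξ : Ω), max (σ * u ξ) 0 * Real.exp (inner ℝ η (S ξ)) =
      max (σ * (Real.exp (inner ℝ (θ + η) (S ξ)) * w ξ)) 0 := by
    intro σ η ξ
    rw [max_mul_of_nonneg _ _ (Real.exp_nonneg _), zero_mul, inner_add_left, Real.exp_add]
    simp only [hu]
    ring_nf
  have hexpm : ∀ η : Herm β n, Measurable fun x : Herm β n => Real.exp (inner ℝ η x) :=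
    fun η => (continuous_exp_inner η).measurable
  have hI : ∀ (σ : ℝ) (η : Herm β n), ‖η‖ < δ →
      Integrable (fun x => Real.exp (inner ℝ η x)) (densityMap ν (fun ξ => σ * u ξ) S) := by
    intro σ η hη
    rw [integrable_densityMap_iff (by fun_prop) hS (hexpm η)]
    simp_rw [hmul]
    exact ((hint _ (hmem η hη)).const_mul σ).pos_part
  have hfin : ∀ σ : ℝ, IsFiniteMeasure (densityMap ν (fun ξ => σ * u ξ) S) := by
    intro σ
    have h := hI σ 0 (by simpa using hδ)
    simp only [inner_zero_left, Real.exp_zero] at h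
    exact (integrable_const_iff_isFiniteMeasure one_ne_zero).1 h
  have := hfin 1
  have := hfin (-1)
  have hsub : ∀ r : ℝ, max (1 * r) 0 - max (-1 * r) 0 = r := by
    intro r
    rcases le_total 0 r with hr | hr
    · rw [one_mul, max_eq_left hr, max_eq_right (by linarith), sub_zero]
    · rw [one_mul, max_eq_right hr, max_eq_left (by linarith)]; ring
  have hEq : densityMap ν (fun ξ => 1 * u ξ) S = densityMap ν (fun ξ => -1 * u ξ) S := by
    refine ext_of_integral_exp_inner_eq hδ (hI 1) (hI (-1)) fun η hη => ?_
    rw [integral_densityMap (by fun_prop) hS (hexpm η),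
      integral_densityMap (by fun_prop) hS (hexpm η), ← sub_eq_zero]
    simp_rw [hmul]
    rw [← integral_sub ((hint _ (hmem η hη)).const_mul 1).pos_part
      ((hint _ (hmem η hη)).const_mul (-1)).pos_part]
    simp_rw [hsub]
    exact h0 _ (hmem η hη)
  -- Integrating this function against the two equal measures removes the tilt and localizes to `B`.
  set f : Herm β n → ℝ := B.indicator fun x => Real.exp (inner ℝ (-θ) x) with hf
  have hfm : Measurable f := (hexpm (-θ)).indicator hB
  have hfu : ∀ (σ : ℝ) ξ, max (σ * u ξ) 0 * f (S ξ) =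
      (S ⁻¹' B).indicator (fun ξ => max (σ * w ξ) 0) ξ := by
    intro σ ξ
    by_cases hξ : S ξ ∈ B
    · rw [hf, Set.indicator_of_mem hξ, Set.indicator_of_mem (show ξ ∈ S ⁻¹' B from hξ), hmul]
      simp
    · rw [hf, Set.indicator_of_notMem hξ, Set.indicator_of_notMem (show ξ ∉ S ⁻¹' B from hξ),
        mul_zero]
  have h1 := congrArg (fun ρ => ∫ x, f x ∂ρ) hEq
  rw [integral_densityMap (by fun_prop) hS hfm, integral_densityMap (by fun_prop) hS hfm] at h1
  simp_rw [hfu] at h1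
  rw [integral_indicator (hS hB), integral_indicator (hS hB), ← sub_eq_zero,
    ← integral_sub (hwi.const_mul 1).pos_part.integrableOn
      (hwi.const_mul (-1)).pos_part.integrableOn] at h1
  simp_rw [hsub] at h1
  exact h1

end Uniqueness

/-! ### Exponential integrals of the regression residual. -/

section Residual

variable {μ : Measure (Herm β n)} [IsProbabilityMeasure μ]

/-- `exp⟨θ|x + y⟩` splits into a function of `x` and one of `y`, so Fubini's theorem applies to each
bilinear term of the residual. -/
theorem integrable_integral_exp_bilin {E F G : Type} [NormedAddCommGroup E] [NormedSpace ℝ E]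
    [NormedAddCommGroup F] [NormedSpace ℝ F] [NormedAddCommGroup G] [NormedSpace ℝ G]
    [CompleteSpace E] [CompleteSpace F] [CompleteSpace G]
    (B : E →L[ℝ] F →L[ℝ] G) {P : Herm β n → E} {Q : Herm β n → F} (hP : SubExponential P)
    (hQ : SubExponential Q) {θ : Herm β n} (hθ : θ ∈ laplaceDomain μ) :
    Integrable (fun p : Herm β n × Herm β n =>
      Real.exp (inner ℝ θ (p.1 + p.2)) • B (P p.1) (Q p.2)) (μ.prod μ) ∧
    ∫ p : Herm β n × Herm β n, Real.exp (inner ℝ θ (p.1 + p.2)) • B (P p.1) (Q p.2) ∂(μ.prod μ) =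
      B (expInt μ P θ) (expInt μ Q θ) := by
  have h1 : ∀ p : Herm β n × Herm β n, Real.exp (inner ℝ θ (p.1 + p.2)) • B (P p.1) (Q p.2) =
      B (Real.exp (inner ℝ θ p.1) • P p.1) (Real.exp (inner ℝ θ p.2) • Q p.2) := by
    intro p
    rw [inner_add_right, Real.exp_add, map_smul, map_smul, _root_.smul_apply, smul_smul, mul_comm]
  simp_rw [h1]
  exact ⟨(hP.integrable hθ).op_fst_snd (op := fun x y => B x y) (by fun_prop)
    ⟨‖B‖, B.le_opNorm₂⟩ (hQ.integrable hθ),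
    integral_prod_bilin B (hP.integrable hθ) (hQ.integrable hθ)⟩

/-- The difference of `(X - Y)²` and `A S² + B S + C I`. -/
noncomputable def residual (A B C : ℝ) (p : Herm β n × Herm β n) : Herm β n :=
  sq (p.1 - p.2) - (A • sq (p.1 + p.2) + B • (p.1 + p.2) + C • (1 : Herm β n))

theorem residual_eq (A B C : ℝ) (p : Herm β n × Herm β n) : residual A B C p =
    (1 - A) • (sq p.1 + sq p.2) - (2 * (1 + A)) • jordanL p.1 p.2 - B • (p.1 + p.2)
      - C • (1 : Herm β n) := by
  rw [residual, sq_add, sq_sub]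
  module

theorem integrable_integral_exp_residual (A B C : ℝ) {θ : Herm β n} (hθ : θ ∈ laplaceDomain μ) :
    Integrable (fun p : Herm β n × Herm β n =>
      Real.exp (inner ℝ θ (p.1 + p.2)) • residual A B C p) (μ.prod μ) ∧
    ∫ p : Herm β n × Herm β n, Real.exp (inner ℝ θ (p.1 + p.2)) • residual A B C p ∂(μ.prod μ) =
      (2 * laplace μ θ ^ 2) • ((1 - A) • tilt μ sq θ - (1 + A) • sq (tilt μ (fun x => x) θ) -
        B • tilt μ (fun x => x) θ - (C / 2) • (1 : Herm β n)) := by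
  set L := laplace μ θ with hL
  have hL0 : L ≠ 0 := (laplace_pos hθ).ne'
  have hone : expInt μ (fun _ => (1 : ℝ)) θ = L := by rw [← laplace_eq_expInt]
  have hLQ : ∀ {E : Type} [NormedAddCommGroup E] [NormedSpace ℝ E] (P : Herm β n → E),
      expInt μ P θ = L • tilt μ P θ := by
    intro E _ _ P
    rw [tilt, smul_smul, mul_inv_cancel₀ hL0, one_smul]
  obtain ⟨i1, e1⟩ := integrable_integral_exp_bilin (μ := μ)
    (ContinuousLinearMap.lsmul ℝ ℝ : ℝ →L[ℝ] Herm β n →L[ℝ] Herm β n).flip .sq (.const 1) hθ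
  obtain ⟨i2, e2⟩ := integrable_integral_exp_bilin (μ := μ)
    (ContinuousLinearMap.lsmul ℝ ℝ : ℝ →L[ℝ] Herm β n →L[ℝ] Herm β n) (.const 1) .sq hθ
  obtain ⟨i3, e3⟩ := integrable_integral_exp_bilin (μ := μ) jordanL .id .id hθ
  obtain ⟨i4, e4⟩ := integrable_integral_exp_bilin (μ := μ)
    (ContinuousLinearMap.lsmul ℝ ℝ : ℝ →L[ℝ] Herm β n →L[ℝ] Herm β n).flip .id (.const 1) hθ
  obtain ⟨i5, e5⟩ := integrable_integral_exp_bilin (μ := μ)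
    (ContinuousLinearMap.lsmul ℝ ℝ : ℝ →L[ℝ] Herm β n →L[ℝ] Herm β n) (.const 1) .id hθ
  obtain ⟨i6, e6⟩ := integrable_integral_exp_bilin (μ := μ)
    (ContinuousLinearMap.lsmul ℝ ℝ : ℝ →L[ℝ] Herm β n →L[ℝ] Herm β n) (.const 1)
      (.const (1 : Herm β n)) hθ
  simp only [ContinuousLinearMap.flip_apply, ContinuousLinearMap.lsmul_apply, one_smul, hone]
    at i1 i2 i4 i5 i6 e1 e2 e4 e5 e6
  have hc : expInt μ (fun _ => (1 : Herm β n)) θ = L • 1 := by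
    rw [expInt, integral_smul_const]
    rfl
  rw [hc] at e6
  rw [hLQ] at e1 e2 e3 e4 e5
  have hfun : ∀ p : Herm β n × Herm β n, Real.exp (inner ℝ θ (p.1 + p.2)) • residual A B C p =
      (1 - A) • (Real.exp (inner ℝ θ (p.1 + p.2)) • sq p.1 +
        Real.exp (inner ℝ θ (p.1 + p.2)) • sq p.2) -
      (2 * (1 + A)) • (Real.exp (inner ℝ θ (p.1 + p.2)) • jordanL p.1 p.2) -
      B • (Real.exp (inner ℝ θ (p.1 + p.2)) • p.1 + Real.exp (inner ℝ θ (p.1 + p.2)) • p.2) -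
      C • (Real.exp (inner ℝ θ (p.1 + p.2)) • (1 : Herm β n)) := by
    intro p
    rw [residual_eq]
    module
  simp_rw [hfun]
  have j12 := (i1.fun_add i2).fun_smul (1 - A)
  have j3 := i3.fun_smul (2 * (1 + A))
  have j45 := (i4.fun_add i5).fun_smul B
  have j6 := i6.fun_smul C
  refine ⟨((j12.sub' j3).sub' j45).sub' j6, ?_⟩
  rw [integral_sub ((j12.sub' j3).sub' j45) j6, integral_sub (j12.sub' j3) j45,
    integral_sub j12 j3, integral_smul, integral_smul, integral_smul, integral_smul,
    integral_add i1 i2, integral_add i4 i5, e1, e2,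
    e3, e4, e5, e6, map_smul, map_smul, _root_.smul_apply, jordanL_self]
  module

/-- For `A = 2a/(1+2a)` one has `1 - A = 1/(1+2a)` and `1 + A = (1+4a)/(1+2a)`. The common factor
comes out, and what remains is the defect of the cumulant equation. -/
theorem integral_exp_residual_meixner {a : ℝ} (b : ℝ) (ha : 1 + 2 * a ≠ 0) {θ : Herm β n}
    (hθ : θ ∈ laplaceDomain μ) :
    ∫ p : Herm β n × Herm β n, Real.exp (inner ℝ θ (p.1 + p.2)) •
      residual (2 * a / (1 + 2 * a)) (2 * b / (1 + 2 * a)) (2 / (1 + 2 * a)) p ∂(μ.prod μ) =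
    (2 * laplace μ θ ^ 2 / (1 + 2 * a)) • (tilt μ sq θ - sq (tilt μ (fun x => x) θ) -
      (1 + (2 * b) • tilt μ (fun x => x) θ + (4 * a) • sq (tilt μ (fun x => x) θ))) := by
  rw [(integrable_integral_exp_residual _ _ _ hθ).2]
  have h1 : 1 - 2 * a / (1 + 2 * a) = 1 / (1 + 2 * a) := by field_simp; ring
  have h2 : 1 + 2 * a / (1 + 2 * a) = (1 + 4 * a) / (1 + 2 * a) := by field_simp; ring
  rw [h1, h2]
  have h3 : ∀ x y z w : Herm β n, (1 / (1 + 2 * a)) • x - ((1 + 4 * a) / (1 + 2 * a)) • y -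
      (2 * b / (1 + 2 * a)) • z - (2 / (1 + 2 * a) / 2) • w =
      (1 / (1 + 2 * a)) • (x - y - (w + (2 * b) • z + (4 * a) • y)) := by
    intro x y z w
    module
  rw [h3, smul_smul]
  congr 1
  ring

end Residual

/-! ### The Meixner property and the cumulant equation. -/

section Meixner

variable {μ : Measure (Herm β n)} [IsProbabilityMeasure μ]

theorem integrable_sq_of_memLp {Ω : Type} [MeasurableSpace Ω] {ν : Measure Ω} {f : Ω → Herm β n}
    (hf : MemLp f 2 ν) : Integrable (fun ξ => sq (f ξ)) ν := by
  obtain ⟨C, hC, h⟩ := exists_norm_sq_le (β := β) (n := n)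
  refine ((hf.integrable_norm_pow two_ne_zero).const_mul C).mono'
    (continuous_sq.comp_aestronglyMeasurable hf.1) (Eventually.of_forall fun ξ => h _)

theorem memLp_fst (h : MemLp id 2 μ) :
    MemLp (fun p : Herm β n × Herm β n => p.1) 2 (μ.prod μ) :=
  h.comp_measurePreserving measurePreserving_fst

theorem memLp_snd (h : MemLp id 2 μ) :
    MemLp (fun p : Herm β n × Herm β n => p.2) 2 (μ.prod μ) :=
  h.comp_measurePreserving measurePreserving_snd

theorem integrable_sq_sub (h : MemLp id 2 μ) :
    Integrable (fun p : Herm β n × Herm β n => sq (p.1 - p.2)) (μ.prod μ) :=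
  integrable_sq_of_memLp ((memLp_fst h).sub (memLp_snd h))

theorem integrable_quadratic (h : MemLp id 2 μ) (A B C : ℝ) :
    Integrable (fun p : Herm β n × Herm β n =>
      A • sq (p.1 + p.2) + B • (p.1 + p.2) + C • (1 : Herm β n)) (μ.prod μ) := by
  have h1 := (memLp_fst h).add (memLp_snd h)
  have h2 : Integrable (fun p : Herm β n × Herm β n => sq (p.1 + p.2)) (μ.prod μ) :=
    integrable_sq_of_memLp h1
  have h3 : Integrable (fun p : Herm β n × Herm β n => p.1 + p.2) (μ.prod μ) :=
    h1.integrable one_le_two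
  exact ((h2.fun_smul A).fun_add (h3.fun_smul B)).fun_add (integrable_const _)

theorem comap_add_le : MeasurableSpace.comap (fun p : Herm β n × Herm β n => p.1 + p.2)
    inferInstance ≤ (inferInstance : MeasurableSpace (Herm β n × Herm β n)) :=
  (measurable_fst.add measurable_snd).comap_le

/-- The regression property may be tested against functions of the sum. -/
theorem IsMeixner.integral_smul_residual {A B C : ℝ} (h : IsMeixner μ A B C) {f : Herm β n → ℝ}
    (hf : Measurable f)
    (h1 : Integrable (fun p : Herm β n × Herm β n => f (p.1 + p.2) • sq (p.1 - p.2)) (μ.prod μ))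
    (h2 : Integrable (fun p : Herm β n × Herm β n => f (p.1 + p.2) • residual A B C p)
      (μ.prod μ)) :
    ∫ p : Herm β n × Herm β n, f (p.1 + p.2) • residual A B C p ∂(μ.prod μ) = 0 := by
  obtain ⟨-, hL2, hce⟩ := h
  set m := MeasurableSpace.comap (fun p : Herm β n × Herm β n => p.1 + p.2) inferInstance with hm
  have hfm : AEStronglyMeasurable[m] (fun p : Herm β n × Herm β n => f (p.1 + p.2)) (μ.prod μ) :=
    (hf.comp (comap_measurable _)).stronglyMeasurable.aestronglyMeasurable
  have h3 := condExp_smul_of_aestronglyMeasurable_left hfm h1 (integrable_sq_sub hL2)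
  have h4 := integral_condExp (μ := μ.prod μ) (comap_add_le (β := β) (n := n))
    (f := (fun p : Herm β n × Herm β n => f (p.1 + p.2)) •
      fun p : Herm β n × Herm β n => sq (p.1 - p.2))
  have h5 : ∫ p : Herm β n × Herm β n, f (p.1 + p.2) • sq (p.1 - p.2) ∂(μ.prod μ) =
      ∫ p : Herm β n × Herm β n, f (p.1 + p.2) •
        (A • sq (p.1 + p.2) + B • (p.1 + p.2) + C • (1 : Herm β n)) ∂(μ.prod μ) := by
    refine Eq.trans h4.symm (integral_congr_ae ?_)
    filter_upwards [h3, hce] with p hp1 hp2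
    rw [hp1, Pi.smul_apply', hp2]
  have h6 : Integrable (fun p : Herm β n × Herm β n => f (p.1 + p.2) •
      (A • sq (p.1 + p.2) + B • (p.1 + p.2) + C • (1 : Herm β n))) (μ.prod μ) := by
    refine (h1.sub' h2).congr (Eventually.of_forall fun p => ?_)
    simp only [residual, smul_sub, sub_sub_cancel]
  simp only [residual, smul_sub]
  rw [integral_sub h1 h6, h5, sub_self]

theorem integrable_exp_smul_sq_sub {θ : Herm β n} (hθ : θ ∈ laplaceDomain μ) :
    Integrable (fun p : Herm β n × Herm β n =>
      Real.exp (inner ℝ θ (p.1 + p.2)) • sq (p.1 - p.2)) (μ.prod μ) := by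
  have h := (integrable_integral_exp_residual (μ := μ) 0 0 0 hθ).1
  simpa only [residual, zero_smul, add_zero, sub_zero] using h

theorem IsMeixnerWith.satisfiesCumulantEquation {a b : ℝ} (ha : 1 + 2 * a ≠ 0)
    (h : IsMeixnerWith μ a b) : SatisfiesCumulantEquation μ a b := by
  intro θ hθ
  have h1 := IsMeixner.integral_smul_residual h (continuous_exp_inner θ).measurable
    (integrable_exp_smul_sq_sub hθ) (integrable_integral_exp_residual _ _ _ hθ).1
  rw [integral_exp_residual_meixner b ha hθ, smul_eq_zero] at h1
  have h2 : 2 * laplace μ θ ^ 2 / (1 + 2 * a) ≠ 0 := by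
    have := (laplace_pos hθ).ne'
    positivity
  rw [Psi_fderiv_gradient_logLaplace hθ, gradient_logLaplace hθ]
  exact sub_eq_zero.1 (h1.resolve_left h2)

theorem SatisfiesCumulantEquation.isMeixnerWith (hμ : IsRotationInvariant μ)
    (hdom : (laplaceDomain μ).Nonempty) (hL2 : MemLp id 2 μ) {a b : ℝ} (ha : 1 + 2 * a ≠ 0)
    (h : SatisfiesCumulantEquation μ a b) : IsMeixnerWith μ a b := by
  refine ⟨hμ, hL2, ?_⟩
  set A := 2 * a / (1 + 2 * a) with hA
  set B := 2 * b / (1 + 2 * a) with hB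
  set C := 2 / (1 + 2 * a) with hC
  have hres : Integrable (residual A B C) (μ.prod μ) :=
    (integrable_sq_sub hL2).sub' (integrable_quadratic hL2 A B C)
  have hcont : Continuous (residual A B C : Herm β n × Herm β n → Herm β n) := by
    have := continuous_sq (β := β) (n := n)
    unfold residual
    fun_prop
  have hzero : ∀ θ ∈ laplaceDomain μ, ∫ p : Herm β n × Herm β n,
      Real.exp (inner ℝ θ (p.1 + p.2)) • residual A B C p ∂(μ.prod μ) = 0 := by
    intro θ hθ
    have h1 := h θ hθ
    rw [Psi_fderiv_gradient_logLaplace hθ, gradient_logLaplace hθ] at h1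
    rw [integral_exp_residual_meixner b ha hθ, h1, sub_self, smul_zero]
  refine (ae_eq_condExp_of_forall_setIntegral_eq comap_add_le (integrable_sq_sub hL2)
    (fun s _ _ => (integrable_quadratic hL2 A B C).integrableOn) ?_ ?_).symm
  · rintro _ ⟨T, hT, rfl⟩ -
    rw [eq_comm, ← sub_eq_zero, ← integral_sub (integrable_sq_sub hL2).integrableOn
      (integrable_quadratic hL2 A B C).integrableOn]
    -- The uniqueness lemma concerns real functions, so the residual is paired with an arbitrary
    -- `y`.
    refine ext_inner_left ℝ fun y => ?_
    have h2 := integral_inner (𝕜 := ℝ) (hres.integrableOn (s := (fun p : Herm β n × Herm β n =>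
      p.1 + p.2) ⁻¹' T)) y
    rw [inner_zero_right]
    refine h2.symm.trans ?_
    refine setIntegral_eq_zero_of_integral_exp_eq_zero (isOpen_laplaceDomain μ) hdom
      (by fun_prop) (hres.const_inner y) (by fun_prop) ?_ ?_ hT
    · intro θ hθ
      have h3 := (integrable_integral_exp_residual (μ := μ) A B C hθ).1.const_inner (𝕜 := ℝ) y
      simp only [inner_smul_right] at h3
      exact h3
    · intro θ hθ
      have h3 := integral_inner (𝕜 := ℝ) (integrable_integral_exp_residual (μ := μ) A B C hθ).1 y
      rw [hzero θ hθ, inner_zero_right] at h3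
      simp only [inner_smul_right] at h3
      exact h3
  · have h4 : Continuous fun x : Herm β n => A • sq x + B • x + C • (1 : Herm β n) := by
      have := continuous_sq (β := β) (n := n)
      fun_prop
    exact (h4.measurable.comp (comap_measurable _)).stronglyMeasurable.aestronglyMeasurable

end Meixner

/-! ### Tilted means at multiples of the identity. -/

section ScalarPoints

variable {μ : Measure (Herm β n)}

theorem eq_smul_one_of_conj_invariant (x : Herm β n)
    (h : ∀ U ∈ unitary (Matrix (Fin n) (Fin n) β.Scalar), conj U x = x) :
    ∃ r : ℝ, x = r • (1 : Herm β n) := by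
  have h1 := eq_diag_of_conj_invariant x fun U hU _ => h U hU
  set w : Fin n → ℝ := fun i => β.re (x.mat i i)
  have h2 : ∀ i j, w i = w j := by
    intro i j
    obtain ⟨U, hU, hc⟩ := exists_conj_diag_perm (β := β) (Equiv.swap i j)
    have h3 := h U hU
    rw [h1, hc w] at h3
    have h4 := congrFun (diag_injective h3) i
    simpa using h4.symm
  by_cases hn : IsEmpty (Fin n)
  · exact ⟨0, mat_injective (by ext i; exact hn.elim i)⟩
  · rw [not_isEmpty_iff] at hn
    obtain ⟨i⟩ := hn
    refine ⟨w i, ?_⟩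
    rw [h1, ← diag_one, ← diagL_apply, ← diagL_apply, ← map_smul]
    congr 1
    funext j
    rw [Pi.smul_apply, smul_eq_mul, mul_one, h2 i j]

theorem tr_one : tr (1 : Herm β n) = n := by
  rw [← diag_one, tr_diag]
  simp

theorem sq_one : sq (1 : Herm β n) = 1 := by
  rw [← diag_one, sq_diag]
  simp

theorem tr_smul (c : ℝ) (x : Herm β n) : tr (c • x) = c * tr x := by
  rw [← inner_one_left, inner_smul_right, inner_one_left]

theorem tr_add (x y : Herm β n) : tr (x + y) = tr x + tr y := by
  rw [← inner_one_left, inner_add_right, inner_one_left, inner_one_left]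

theorem expInt_conj_smul_one (hμ : IsRotationInvariant μ) (s : ℝ) :
    ∃ r : ℝ, tilt μ (fun x => x) (s • (1 : Herm β n)) = r • (1 : Herm β n) := by
  refine eq_smul_one_of_conj_invariant _ fun U hU => ?_
  rw [← tilt_id_conj hμ hU, conj_smul, conj_self_one hU]

end ScalarPoints

/-! ### Derivatives along rays and a differential inequality. -/

section Line

variable {μ : Measure (Herm β n)} {E : Type} [NormedAddCommGroup E] [NormedSpace ℝ E]

theorem SubExponential.inner_smul {P : Herm β n → E} (hP : SubExponential P) (θ : Herm β n) :
    SubExponential fun x => (inner ℝ θ x : ℝ) • P x := by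
  refine ⟨by have := hP.continuous; fun_prop, fun δ hδ => ?_⟩
  obtain ⟨C, hC, h⟩ := hP.smulRight.bound δ hδ
  refine ⟨C * ‖θ‖, by positivity, fun x => ?_⟩
  have h1 := ((innerSL ℝ x).smulRight (P x)).le_opNorm θ
  rw [ContinuousLinearMap.smulRight_apply, innerSL_apply_apply, real_inner_comm] at h1
  refine h1.trans ((mul_le_mul_of_nonneg_right (h x) (norm_nonneg _)).trans (le_of_eq ?_))
  ring

theorem hasDerivAt_expInt_smul [CompleteSpace E] {P : Herm β n → E} (hP : SubExponential P)
    {θ : Herm β n} {t : ℝ} (ht : t • θ ∈ laplaceDomain μ) :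
    HasDerivAt (fun t : ℝ => expInt μ P (t • θ))
      (expInt μ (fun x => (inner ℝ θ x : ℝ) • P x) (t • θ)) t := by
  have h1 : HasDerivAt (fun t : ℝ => t • θ) θ t := by
    simpa using (hasDerivAt_id t).smul_const θ
  refine ((hasFDerivAt_expInt hP ht).comp_hasDerivAt t h1).congr_deriv ?_
  rw [expInt, ContinuousLinearMap.integral_apply (hP.smulRight.integrable ht), expInt]
  refine integral_congr_ae (Eventually.of_forall fun x => ?_)
  simp only [_root_.smul_apply, ContinuousLinearMap.smulRight_apply, innerSL_apply_apply]
  rw [real_inner_comm x θ]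

end Line

/-- `M` is increasing, so it could only tend to `-∞` as `t ↓ 0`. The growth condition makes `log(1 +
(M - m)²) - 2K(L - m t)`, with `m = M 1`, increasing as well, and its value at `1` together with the
bound on `L` controls `M`. -/
theorem exists_bound_of_deriv_le {L M M' : ℝ → ℝ} {B C : ℝ} (hC : 0 ≤ C)
    (hL : ∀ t ∈ Set.Ioc (0 : ℝ) 1, HasDerivAt L (M t) t)
    (hM : ∀ t ∈ Set.Ioc (0 : ℝ) 1, HasDerivAt M (M' t) t)
    (h0 : ∀ t ∈ Set.Ioc (0 : ℝ) 1, 0 ≤ M' t)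
    (h1 : ∀ t ∈ Set.Ioc (0 : ℝ) 1, M' t ≤ C * (1 + M t ^ 2))
    (hB : ∀ t ∈ Set.Ioc (0 : ℝ) 1, |L t| ≤ B) :
    ∃ D, ∀ t ∈ Set.Ioc (0 : ℝ) 1, |M t| ≤ D := by
  set m := M 1 with hm
  have one_mem : (1 : ℝ) ∈ Set.Ioc (0 : ℝ) 1 := ⟨zero_lt_one, le_rfl⟩
  have hMmono : MonotoneOn M (Set.Ioc 0 1) := by
    refine monotoneOn_of_deriv_nonneg (convex_Ioc 0 1)
      (fun t ht => (hM t ht).continuousAt.continuousWithinAt) (fun t ht => ?_) fun t ht => ?_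
    · exact (hM t (interior_subset ht)).differentiableAt.differentiableWithinAt
    · rw [(hM t (interior_subset ht)).deriv]
      exact h0 t (interior_subset ht)
  have hle : ∀ t ∈ Set.Ioc (0 : ℝ) 1, M t - m ≤ 0 := fun t ht =>
    sub_nonpos.2 (hMmono ht one_mem ht.2)
  -- Chosen so that `C(1 + M²) ≤ K(1 + (M - m)²)`; recentring at `m` gives `M - m` a fixed sign.
  set K := C * (2 + 2 * m ^ 2) with hK
  have hK0 : 0 ≤ K := by positivity
  have h2 : ∀ t ∈ Set.Ioc (0 : ℝ) 1, M' t ≤ K * (1 + (M t - m) ^ 2) := by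
    intro t ht
    refine (h1 t ht).trans ?_
    rw [hK, mul_assoc]
    refine mul_le_mul_of_nonneg_left ?_ hC
    nlinarith [sq_nonneg (M t - 2 * m), sq_nonneg (m * (M t - m)), sq_nonneg m]
  set F : ℝ → ℝ := fun t => Real.log (1 + (M t - m) ^ 2) - 2 * K * (L t - m * t) with hF
  have hFd : ∀ t ∈ Set.Ioc (0 : ℝ) 1, HasDerivAt F
      ((2 * (M t - m) * M' t) / (1 + (M t - m) ^ 2) - 2 * K * (M t - m)) t := by
    intro t ht
    have h3 : HasDerivAt (fun t => 1 + (M t - m) ^ 2) (2 * (M t - m) * M' t) t := by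
      have := (((hM t ht).sub_const m).pow 2).const_add 1
      simpa using this
    have h4 : HasDerivAt (fun t => L t - m * t) (M t - m) t := by
      simpa using (hL t ht).fun_sub ((hasDerivAt_id t).const_mul m)
    exact (h3.log (by positivity)).sub (h4.const_mul _)
  have hFmono : MonotoneOn F (Set.Ioc 0 1) := by
    refine monotoneOn_of_deriv_nonneg (convex_Ioc 0 1)
      (fun t ht => (hFd t ht).continuousAt.continuousWithinAt) (fun t ht => ?_) fun t ht => ?_
    · exact (hFd t (interior_subset ht)).differentiableAt.differentiableWithinAt
    · have ht' := interior_subset ht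
      rw [(hFd t ht').deriv, sub_nonneg, le_div_iff₀ (by positivity)]
      nlinarith [mul_nonneg (neg_nonneg.2 (hle t ht')) (sub_nonneg.2 (h2 t ht'))]
  refine ⟨|m| + 1 + Real.exp (2 * K * (2 * B + 2 * |m|)), fun t ht => ?_⟩
  have h5 := hFmono ht one_mem ht.2
  simp only [hF, ← hm, sub_self, mul_one, ne_eq, OfNat.ofNat_ne_zero, not_false_eq_true, zero_pow,
    add_zero, Real.log_one, zero_sub] at h5
  have h6 : Real.log (1 + (M t - m) ^ 2) ≤ 2 * K * (2 * B + 2 * |m|) := by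
    have h7 : L t - m * t - (L 1 - m) ≤ 2 * B + 2 * |m| := by
      have a1 := (abs_le.1 (hB t ht)).2
      have a2 := (abs_le.1 (hB 1 one_mem)).1
      have a3 : -(m * t) ≤ |m| := by
        refine (neg_le_abs _).trans ?_
        rw [abs_mul, abs_of_pos ht.1]
        exact mul_le_of_le_one_right (abs_nonneg _) ht.2
      have a4 := le_abs_self m
      linarith
    have h8 := mul_le_mul_of_nonneg_left h7 (by positivity : 0 ≤ 2 * K)
    linarith
  have h9 := (Real.log_le_iff_le_exp (by positivity)).1 h6
  have h10 : |M t| ≤ |m| + |M t - m| := by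
    have := abs_add_le m (M t - m)
    rwa [add_sub_cancel] at this
  have h11 : |M t - m| ≤ 1 + (M t - m) ^ 2 := by
    rw [← sq_abs (M t - m)]
    nlinarith [sq_nonneg (|M t - m| - 1), abs_nonneg (M t - m)]
  linarith

/-! ### Second moments from the cumulant equation. -/

section SecondMoment

variable {μ : Measure (Herm β n)}

theorem inner_expInt {E : Type} [NormedAddCommGroup E] [InnerProductSpace ℝ E] [CompleteSpace E]
    {P : Herm β n → E} (hP : SubExponential P) {θ : Herm β n} (hθ : θ ∈ laplaceDomain μ) (y : E) :
    inner ℝ y (expInt μ P θ) = expInt μ (fun x => (inner ℝ y (P x) : ℝ)) θ := by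
  rw [expInt, ← integral_inner (hP.integrable hθ)]
  simp_rw [inner_smul_right]
  rfl

theorem SubExponential.inner_left (θ : Herm β n) :
    SubExponential fun x : Herm β n => (inner ℝ θ x : ℝ) := by
  simpa using (SubExponential.const (β := β) (n := n) (1 : ℝ)).inner_smul θ

theorem SubExponential.norm_sq : SubExponential fun x : Herm β n => ‖x‖ ^ 2 :=
  .of_norm_le (by fun_prop) zero_le_one (m := 2) fun x => by simp

variable [IsProbabilityMeasure μ]

theorem expInt_eq_smul_tilt {E : Type} [NormedAddCommGroup E] [NormedSpace ℝ E]
    {P : Herm β n → E} {θ : Herm β n} (hθ : θ ∈ laplaceDomain μ) :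
    expInt μ P θ = laplace μ θ • tilt μ P θ := by
  rw [tilt, smul_smul, mul_inv_cancel₀ (laplace_pos hθ).ne', one_smul]

theorem tr_tilt_sq {θ : Herm β n} (hθ : θ ∈ laplaceDomain μ) :
    expInt μ (fun x => ‖x‖ ^ 2) θ = laplace μ θ * tr (tilt μ sq θ) := by
  rw [tilt, tr_smul, ← inner_one_left, inner_expInt .sq hθ, mul_inv_cancel_left₀ (laplace_pos hθ).ne']
  simp_rw [inner_one_left, tr_sq]

theorem laplace_le_of_mem_Ioc {θ : Herm β n} (hθ : θ ∈ laplaceDomain μ) {t : ℝ}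
    (ht : t ∈ Set.Ioc (0 : ℝ) 1) : laplace μ (t • θ) ≤ 1 + laplace μ θ := by
  have h1 := integrable_exp_of_mem hθ
  have h2 := integrable_exp_of_mem (smul_mem_laplaceDomain hθ ht.1 ht.2)
  have h3 : laplace μ (t • θ) ≤ ∫ x, (1 + Real.exp (inner ℝ θ x)) ∂μ := by
    refine integral_mono h2 ((integrable_const 1).add h1) fun x => ?_
    simp only [real_inner_smul_left]
    rcases le_total 0 (inner ℝ θ x : ℝ) with h | h
    · have : t * inner ℝ θ x ≤ inner ℝ θ x := mul_le_of_le_one_left h ht.2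
      linarith [Real.exp_le_exp.2 this]
    · have : Real.exp (t * inner ℝ θ x) ≤ 1 :=
        Real.exp_le_one_iff.2 (mul_nonpos_of_nonneg_of_nonpos ht.1.le h)
      linarith [Real.exp_pos (inner ℝ θ x : ℝ)]
  rw [integral_add (integrable_const 1) h1] at h3
  simpa [laplace] using h3

theorem exists_pos_le_laplace {θ : Herm β n} (hθ : θ ∈ laplaceDomain μ) :
    ∃ l > 0, ∀ t ∈ Set.Ioc (0 : ℝ) 1, l ≤ laplace μ (t • θ) := by
  have hi : Integrable (fun x => Real.exp (-|(inner ℝ θ x : ℝ)|)) μ := by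
    refine (integrable_const (1 : ℝ)).mono' (by fun_prop) (Eventually.of_forall fun x => ?_)
    rw [Real.norm_eq_abs, Real.abs_exp]
    exact Real.exp_le_one_iff.2 (neg_nonpos.2 (abs_nonneg _))
  refine ⟨_, integral_exp_pos hi, fun t ht => ?_⟩
  refine integral_mono hi (integrable_exp_of_mem (smul_mem_laplaceDomain hθ ht.1 ht.2)) fun x => ?_
  simp only [real_inner_smul_left]
  refine Real.exp_le_exp.2 (neg_le.1 ((neg_le_abs _).trans ?_))
  rw [abs_mul, abs_of_pos ht.1]
  exact mul_le_of_le_one_left (abs_nonneg _) ht.2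

/-- At a scalar point the tilted mean is `r • 1`, and the trace of the cumulant equation gives the
tilted second moment as `n((1+4a)r² + 2br + 1)`. The first moment `M` equals `L c n r`, and `L` is
bounded above and away from zero along the segment. -/
theorem SatisfiesCumulantEquation.expInt_norm_sq_le (hn : 1 ≤ n) (hμ : IsRotationInvariant μ)
    {a b c : ℝ} (hc : c ≠ 0) (hθ : c • (1 : Herm β n) ∈ laplaceDomain μ)
    (h : SatisfiesCumulantEquation μ a b) :
    ∃ K, 0 ≤ K ∧ ∀ t ∈ Set.Ioc (0 : ℝ) 1,
      expInt μ (fun x => ‖x‖ ^ 2) (t • c • (1 : Herm β n)) ≤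
        K * (1 + expInt μ (fun x => (inner ℝ (c • (1 : Herm β n)) x : ℝ))
          (t • c • (1 : Herm β n)) ^ 2) := by
  obtain ⟨l, hl, hlL⟩ := exists_pos_le_laplace hθ
  have hn0 : (0 : ℝ) < n := by exact_mod_cast hn
  set θ := c • (1 : Herm β n) with hθd
  -- From `M = L c n r` and `L ≥ l`: this is the constant in `|r| ≤ ρ|M|`.
  set ρ := (l * |c| * n)⁻¹ with hρ
  have hcp : 0 < |c| := abs_pos.2 hc
  have hρ0 : 0 ≤ ρ := by positivity
  have hL1 : 0 ≤ 1 + laplace μ θ := by linarith [laplace_pos hθ]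
  refine ⟨(1 + laplace μ θ) * (n * (|1 + 4 * a| + |b| + 1)) * (1 + ρ ^ 2), by positivity,
    fun t ht => ?_⟩
  have hm := smul_mem_laplaceDomain hθ ht.1 ht.2
  have hLp := laplace_pos hm
  obtain ⟨r, hr⟩ := expInt_conj_smul_one hμ (t * c)
  rw [← smul_smul, ← hθd] at hr
  have h1 := h _ hm
  rw [Psi_fderiv_gradient_logLaplace hm, gradient_logLaplace hm, hr, sub_eq_iff_eq_add, sq_smul,
    sq_one] at h1
  have h2 : tr (tilt μ sq (t • θ)) = n * ((1 + 4 * a) * r ^ 2 + 2 * b * r + 1) := by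
    rw [h1]
    simp only [tr_add, tr_smul, tr_one]
    ring
  have hM : expInt μ (fun x => (inner ℝ θ x : ℝ)) (t • θ) = laplace μ (t • θ) * (c * n * r) := by
    rw [← inner_expInt .id hm]
    rw [expInt_eq_smul_tilt hm, hr, inner_smul_right, hθd, inner_smul_left, inner_smul_right, inner_one_left, tr_one]
    simp only [conj_trivial]
    ring
  set M := expInt μ (fun x => (inner ℝ θ x : ℝ)) (t • θ)
  have hrM : |r| ≤ ρ * |M| := by
    rw [hM, abs_mul, abs_mul, abs_mul, abs_of_pos hLp, abs_of_pos hn0, hρ, inv_mul_eq_div,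
      le_div_iff₀ (by positivity)]
    calc |r| * (l * |c| * n) = l * (|c| * n * |r|) := by ring
      _ ≤ _ := by gcongr; exact hlL t ht
  have hr2 : r ^ 2 ≤ ρ ^ 2 * M ^ 2 := by
    have := pow_le_pow_left₀ (abs_nonneg _) hrM 2
    rwa [mul_pow, sq_abs, sq_abs] at this
  have h4 : (1 + 4 * a) * r ^ 2 + 2 * b * r + 1 ≤ (|1 + 4 * a| + |b| + 1) * (1 + r ^ 2) := by
    have a1 : (1 + 4 * a) * r ^ 2 ≤ |1 + 4 * a| * r ^ 2 := by gcongr; exact le_abs_self _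
    have a2 : 2 * b * r ≤ |b| * (1 + r ^ 2) := by
      have : 2 * b * r ≤ 2 * |b| * |r| := by
        rw [mul_assoc, mul_assoc, ← abs_mul]
        linarith [le_abs_self (b * r)]
      nlinarith [sq_nonneg (|r| - 1), abs_nonneg b, sq_abs r]
    nlinarith [abs_nonneg (1 + 4 * a), sq_nonneg r]
  have h5 : 1 + r ^ 2 ≤ (1 + ρ ^ 2) * (1 + M ^ 2) := by nlinarith [sq_nonneg M, sq_nonneg ρ]
  rw [tr_tilt_sq hm, h2]
  calc laplace μ (t • θ) * (n * ((1 + 4 * a) * r ^ 2 + 2 * b * r + 1))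
      ≤ laplace μ (t • θ) * (n * ((|1 + 4 * a| + |b| + 1) * ((1 + ρ ^ 2) * (1 + M ^ 2)))) := by
        refine mul_le_mul_of_nonneg_left (mul_le_mul_of_nonneg_left (h4.trans ?_) hn0.le) hLp.le
        exact mul_le_mul_of_nonneg_left h5 (by positivity)
    _ ≤ (1 + laplace μ θ) * (n * ((|1 + 4 * a| + |b| + 1) * ((1 + ρ ^ 2) * (1 + M ^ 2)))) := by
        gcongr
        exact laplace_le_of_mem_Ioc hθ ht
    _ = _ := by ring

/-- A law whose exponential tiltings along a segment to the origin have bounded second moments has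
a second moment. -/
theorem memLp_two_of_expInt_le {θ : Herm β n} (hθ : θ ∈ laplaceDomain μ) {D : ℝ}
    (h : ∀ t ∈ Set.Ioc (0 : ℝ) 1, expInt μ (fun x => ‖x‖ ^ 2) (t • θ) ≤ D) : MemLp id 2 μ := by
  rw [memLp_two_iff_integrable_sq_norm aestronglyMeasurable_id]
  refine ⟨by fun_prop, ?_⟩
  -- Fatou's lemma along `t = 1/(k+1)`.
  set f : ℕ → Herm β n → ENNReal := fun k x =>
    ENNReal.ofReal (Real.exp (inner ℝ ((1 / ((k : ℝ) + 1)) • θ) x) • ‖x‖ ^ 2) with hf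
  have hk : ∀ k : ℕ, 1 / ((k : ℝ) + 1) ∈ Set.Ioc (0 : ℝ) 1 := fun k =>
    ⟨by positivity, by rw [div_le_one (by positivity)]; simp⟩
  have h1 : ∀ k, ∫⁻ x, f k x ∂μ ≤ ENNReal.ofReal D := by
    intro k
    have hi := SubExponential.norm_sq.integrable
      (smul_mem_laplaceDomain hθ (hk k).1 (hk k).2)
    rw [hf, ← ofReal_integral_eq_lintegral_ofReal hi (Eventually.of_forall fun x => by
      simp only [Pi.zero_apply, smul_eq_mul]; positivity)]
    exact ENNReal.ofReal_le_ofReal (h _ (hk k))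
  have h2 : ∀ x : Herm β n, Tendsto (fun k => f k x) atTop (𝓝 (ENNReal.ofReal (‖x‖ ^ 2))) := by
    intro x
    refine ENNReal.tendsto_ofReal ?_
    have h3 : Continuous fun s : ℝ => Real.exp (inner ℝ (s • θ) x) • ‖x‖ ^ 2 := by fun_prop
    have h4 := (h3.tendsto 0).comp tendsto_one_div_add_atTop_nhds_zero_nat
    simpa [Function.comp_def] using h4
  have h5 : ∫⁻ x, ENNReal.ofReal (‖x‖ ^ 2) ∂μ ≤ ENNReal.ofReal D := by
    calc ∫⁻ x, ENNReal.ofReal (‖x‖ ^ 2) ∂μ = ∫⁻ x, liminf (fun k => f k x) atTop ∂μ :=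
          lintegral_congr fun x => (h2 x).liminf_eq.symm
      _ ≤ liminf (fun k => ∫⁻ x, f k x ∂μ) atTop :=
          lintegral_liminf_le fun k => by simp only [hf]; fun_prop
      _ ≤ ENNReal.ofReal D := by
          refine (liminf_le_liminf (Eventually.of_forall h1)).trans ?_
          rw [liminf_const]
  rw [hasFiniteIntegral_iff_ofReal (Eventually.of_forall fun x => by positivity)]
  exact h5.trans_lt ENNReal.ofReal_lt_top

/-- On the ray through a scalar point, `L`, its derivative `M` and `M' ≤ ‖θ‖² ∫ exp⟨tθ|x⟩ ‖x‖²`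
satisfy the hypotheses of `exists_bound_of_deriv_le`. The resulting bound on `M` bounds the tilted
second moments uniformly. -/
theorem SatisfiesCumulantEquation.memLp_two (hn : 1 ≤ n) (hμ : IsRotationInvariant μ)
    (hdom : (laplaceDomain μ).Nonempty) {a b : ℝ} (h : SatisfiesCumulantEquation μ a b) :
    MemLp id 2 μ := by
  obtain ⟨c, hc, hθ⟩ := exists_smul_one_mem hn hμ hdom
  obtain ⟨K, hK0, hK⟩ := h.expInt_norm_sq_le hn hμ hc hθ
  set θ := c • (1 : Herm β n)
  have hm : ∀ t ∈ Set.Ioc (0 : ℝ) 1, t • θ ∈ laplaceDomain μ := fun t ht =>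
    smul_mem_laplaceDomain hθ ht.1 ht.2
  have hY2 : ∀ x : Herm β n, 0 ≤ (inner ℝ θ x : ℝ) • (inner ℝ θ x : ℝ) := fun x =>
    mul_self_nonneg _
  obtain ⟨D, hD⟩ := exists_bound_of_deriv_le (L := fun t => laplace μ (t • θ))
    (M := fun t => expInt μ (fun x => (inner ℝ θ x : ℝ)) (t • θ))
    (M' := fun t => expInt μ (fun x => (inner ℝ θ x : ℝ) • (inner ℝ θ x : ℝ)) (t • θ))
    (B := 1 + laplace μ θ) (C := ‖θ‖ ^ 2 * K) (by positivity)
    (fun t ht => by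
      have h1 := hasDerivAt_expInt_smul (μ := μ) (.const (1 : ℝ)) (hm t ht)
      rw [← laplace_eq_expInt] at h1
      simpa using h1)
    (fun t ht => hasDerivAt_expInt_smul (.inner_left θ) (hm t ht))
    (fun t ht => integral_nonneg fun x => mul_nonneg (Real.exp_nonneg _) (hY2 x))
    (fun t ht => by
      have h1 : expInt μ (fun x => (inner ℝ θ x : ℝ) • (inner ℝ θ x : ℝ)) (t • θ) ≤
          ‖θ‖ ^ 2 * expInt μ (fun x => ‖x‖ ^ 2) (t • θ) := by
        rw [expInt, expInt, ← integral_const_mul]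
        refine integral_mono (((SubExponential.inner_left θ).inner_smul θ).integrable (hm t ht))
          ((SubExponential.norm_sq.integrable (hm t ht)).const_mul _) fun x => ?_
        simp only [smul_eq_mul]
        have h2 : (inner ℝ θ x : ℝ) * inner ℝ θ x ≤ ‖θ‖ ^ 2 * ‖x‖ ^ 2 := by
          rw [← mul_pow, ← pow_two, ← sq_abs]
          exact pow_le_pow_left₀ (abs_nonneg _) (abs_real_inner_le_norm θ x) 2
        nlinarith [mul_le_mul_of_nonneg_left h2 (Real.exp_nonneg (inner ℝ (t • θ) x : ℝ))]
      refine h1.trans ?_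
      rw [mul_assoc]
      exact mul_le_mul_of_nonneg_left (hK t ht) (by positivity))
    (fun t ht => by
      rw [abs_of_pos (laplace_pos (hm t ht))]
      exact laplace_le_of_mem_Ioc hθ ht)
  refine memLp_two_of_expInt_le hθ (D := K * (1 + D ^ 2)) fun t ht => (hK t ht).trans ?_
  have := sq_le_sq' (abs_le.1 (hD t ht)).1 (abs_le.1 (hD t ht)).2
  gcongr

end SecondMoment

/-! ### Standardization from the limits along one ray. -/

section RadialLimits

variable {μ : Measure (Herm β n)}

/-- By homogeneity of the `e_{q-1}`, the chain rule at `t v` is a linear system with the fixed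
matrix `esymmJacobian v` and the unknowns `t^{q-1} g_q`. The right side tends to a constant vector,
which is `γ` times the first column, and the first unknown is `g₁` without a power of `t`. -/
theorem EigenRep.tendsto_pderiv_one {G g : (Fin n → ℝ) → ℝ} [IsProbabilityMeasure μ]
    (h : EigenRep μ G g) (hn : 1 ≤ n) {v : Fin n → ℝ} (hv : v ∈ regularDomain μ) {γ : ℝ}
    (hG : ∀ i, Tendsto (fun t : ℝ => partialD i G (t • v)) (𝓝[>] 0) (𝓝 γ)) :
    Tendsto (fun t : ℝ => pderiv 1 g (elemSymm (t • v))) (𝓝[>] 0) (𝓝 γ) := by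
  set J := esymmJacobian v with hJ
  have hdet : IsUnit J.det := (det_esymmJacobian_ne_zero hv.1).isUnit
  set x : ℝ → Fin n → ℝ := fun t r => t ^ (r : ℕ) * pderiv (r + 1) g (elemSymm (t • v)) with hx
  have h1 : ∀ᶠ t : ℝ in 𝓝[>] 0, J.mulVec (x t) = fun i => partialD i G (t • v) := by
    filter_upwards [Ioo_mem_nhdsGT (zero_lt_one (α := ℝ))] with t ht
    funext i
    rw [h.partialD_eq (smul_mem_regularDomain hv ht.1 ht.2.le), sum_Icc_eq_sum_fin,
      Matrix.mulVec, dotProduct]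
    refine Finset.sum_congr rfl fun r _ => ?_
    rw [hJ, esymmJacobian, Matrix.of_apply]
    simp only [hx, Nat.cast_add, Nat.cast_one, add_sub_cancel_right]
    rw [esub_smul]
    ring
  have h2 : ∀ᶠ t : ℝ in 𝓝[>] 0, J⁻¹.mulVec (fun i => partialD i G (t • v)) = x t := by
    filter_upwards [h1] with t ht
    rw [← ht, Matrix.mulVec_mulVec, Matrix.nonsing_inv_mul _ hdet, Matrix.one_mulVec]
  set i0 : Fin n := ⟨0, hn⟩ with hi0
  have h3 : J.mulVec (γ • Pi.single i0 1) = fun _ => γ := by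
    funext i
    simp [Matrix.mulVec_smul, hJ, esymmJacobian, esub_zero, hi0]
  have h4 : Tendsto (fun t : ℝ => J⁻¹.mulVec (fun i => partialD i G (t • v))) (𝓝[>] 0)
      (𝓝 (J⁻¹.mulVec fun _ => γ)) := by
    have hc : Continuous fun y : Fin n → ℝ => J⁻¹.mulVec y :=
      Continuous.matrix_mulVec continuous_const continuous_id
    exact (hc.tendsto _).comp (tendsto_pi_nhds.2 hG)
  rw [← h3, Matrix.mulVec_mulVec, Matrix.nonsing_inv_mul _ hdet, Matrix.one_mulVec] at h4
  have h5 := tendsto_pi_nhds.1 (h4.congr' h2) i0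
  simpa [hx, hi0] using h5

theorem integral_id_conj (hμ : IsRotationInvariant μ) {U : Matrix (Fin n) (Fin n) β.Scalar}
    (hU : U ∈ unitary _) : conj U (∫ x, x ∂μ) = ∫ x, x ∂μ := by
  have h := (conjE U hU).toLinearIsometry.integral_comp_comm (μ := μ) (φ := fun x => x)
  exact h.symm.trans ((hμ.measurePreserving hU).integral_comp (measurableEmbedding_conj hU)
    fun x => x)

variable [IsProbabilityMeasure μ]

theorem tendsto_laplace_smul {θ : Herm β n} (hθ : θ ∈ laplaceDomain μ) :
    Tendsto (fun t : ℝ => laplace μ (t • θ)) (𝓝[>] 0) (𝓝 1) := by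
  have h := tendsto_expInt_smul (.const (1 : ℝ)) (integrable_const (1 : ℝ)) hθ
  rw [← laplace_eq_expInt] at h
  simpa using h

theorem tendsto_tilt_smul {E : Type} [NormedAddCommGroup E] [NormedSpace ℝ E]
    {P : Herm β n → E} (hP : SubExponential P) (hint : Integrable P μ)
    {θ : Herm β n} (hθ : θ ∈ laplaceDomain μ) :
    Tendsto (fun t : ℝ => tilt μ P (t • θ)) (𝓝[>] 0) (𝓝 (∫ x, P x ∂μ)) := by
  have h := ((tendsto_laplace_smul hθ).inv₀ one_ne_zero).smul (tendsto_expInt_smul hP hint hθ)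
  rwa [inv_one, one_smul] at h

theorem tendsto_logLaplace_smul {θ : Herm β n} (hθ : θ ∈ laplaceDomain μ) :
    Tendsto (fun t : ℝ => logLaplace μ (t • θ)) (𝓝[>] 0) (𝓝 0) := by
  have h := (tendsto_laplace_smul hθ).log one_ne_zero
  rwa [Real.log_one] at h

theorem tendsto_eigenLog_smul {v : Fin n → ℝ} (hv : v ∈ regularDomain μ) :
    Tendsto (fun t : ℝ => eigenLog μ (t • v)) (𝓝[>] 0) (𝓝 0) := by
  have h := tendsto_logLaplace_smul hv.2
  simp_rw [← diagL_apply, ← map_smul, diagL_apply] at h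
  exact h

theorem tendsto_partialD_eigenLog_smul {m : ℝ} (hint : Integrable id μ)
    (hm : ∫ x, x ∂μ = m • (1 : Herm β n)) {v : Fin n → ℝ} (hv : v ∈ regularDomain μ) (i : Fin n) :
    Tendsto (fun t : ℝ => partialD i (eigenLog μ) (t • v)) (𝓝[>] 0) (𝓝 m) := by
  have h1 := tendsto_tilt_smul .id hint hv.2
  rw [hm] at h1
  have h2 := (tendsto_const_nhds (x := (diag (Pi.single i 1) : Herm β n))).inner (𝕜 := ℝ) h1
  rw [inner_smul_right, real_inner_comm, inner_one_left, tr_diag] at h2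
  simp only [Finset.sum_pi_single', Finset.mem_univ, if_true, mul_one] at h2
  refine h2.congr' ?_
  filter_upwards [Ioo_mem_nhdsGT (zero_lt_one (α := ℝ))] with t ht
  have h3 := smul_mem_regularDomain hv ht.1 ht.2.le
  rw [partialD_eigenLog h3.2, gradient_logLaplace h3.2, ← diagL_apply (t • v), map_smul,
    diagL_apply]

/-- Let `t ↓ 0` in the cumulant equation at `tθ`: the tilted moments tend to those of `μ`, and with
zero mean only `E X² = I` is left. -/
theorem SatisfiesCumulantEquation.isStandardized {a b : ℝ} (h : SatisfiesCumulantEquation μ a b)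
    (hL2 : MemLp id 2 μ) (hdom : (laplaceDomain μ).Nonempty) (h0 : ∫ x, x ∂μ = 0) :
    IsStandardized μ := by
  refine ⟨hL2, h0, ?_⟩
  obtain ⟨θ, hθ⟩ := hdom
  have h1 := tendsto_tilt_smul .id (hL2.integrable one_le_two) hθ
  have h2 := tendsto_tilt_smul .sq (integrable_sq_of_memLp hL2) hθ
  rw [h0] at h1
  have hs0 : sq (0 : Herm β n) = 0 := by rw [← jordanL_self, map_zero]
  have h3 : Tendsto (fun t : ℝ => sq (tilt μ (fun x => x) (t • θ))) (𝓝[>] 0) (𝓝 0) := by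
    have := (continuous_sq.tendsto 0).comp h1
    rwa [hs0] at this
  have h4 : Tendsto (fun t : ℝ => (1 : Herm β n) + (2 * b) • tilt μ (fun x => x) (t • θ) +
      (4 * a) • sq (tilt μ (fun x => x) (t • θ)) + sq (tilt μ (fun x => x) (t • θ))) (𝓝[>] 0)
      (𝓝 1) := by
    have := ((tendsto_const_nhds (x := (1 : Herm β n))).add (h1.const_smul (2 * b))).add
      (h3.const_smul (4 * a)) |>.add h3
    simpa using this
  refine tendsto_nhds_unique h2 (h4.congr' ?_)
  filter_upwards [Ioo_mem_nhdsGT (zero_lt_one (α := ℝ))] with t ht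
  have hm := smul_mem_laplaceDomain hθ ht.1 ht.2.le
  have h5 := h _ hm
  rw [Psi_fderiv_gradient_logLaplace hm, gradient_logLaplace hm] at h5
  rw [← h5, sub_add_cancel]

/-- The mean is `m • 1` by invariance. Along a ray `g₁` tends to `α m + c₁`, while the boundary
condition prescribes `c₁`; as `α ≠ 0`, the mean vanishes. -/
theorem integral_id_eq_zero_of_tendsto (hn : 1 ≤ n) (hμ : IsRotationInvariant μ)
    (hdom : (laplaceDomain μ).Nonempty) (hint : Integrable id μ) {G g : (Fin n → ℝ) → ℝ}
    (h : EigenRep μ G g) {α c₀ c₁ : ℝ} (hα : α ≠ 0)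
    (hG : ∀ v ∈ regularDomain μ, ∀ m, (∀ i, Tendsto (fun t : ℝ => partialD i (eigenLog μ) (t • v))
      (𝓝[>] 0) (𝓝 m)) → ∀ i, Tendsto (fun t : ℝ => partialD i G (t • v)) (𝓝[>] 0)
        (𝓝 (α * m + c₁)))
    (hb : HasBoundaryLimits μ g c₀ c₁) : ∫ x, x ∂μ = 0 := by
  obtain ⟨m, hm⟩ := eq_smul_one_of_conj_invariant (∫ x, x ∂μ) fun U hU => integral_id_conj hμ hU
  obtain ⟨v, hv⟩ := regularDomain_nonempty hμ hdom
  have h1 := h.tendsto_pderiv_one hn hv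
    (hG v hv m fun i => tendsto_partialD_eigenLog_smul hint hm hv i)
  have h2 := tendsto_nhds_unique h1 (hb.2.comp (tendsto_smul_regularDomain hv))
  have h3 : m = 0 := by
    have : α * m = 0 := by linarith
    exact (mul_eq_zero.1 this).resolve_left hα
  rw [hm, h3, zero_smul]

theorem eventually_smul_mem_regularDomain {v : Fin n → ℝ} (hv : v ∈ regularDomain μ) :
    ∀ᶠ t : ℝ in 𝓝[>] 0, t • v ∈ regularDomain μ := by
  filter_upwards [Ioo_mem_nhdsGT (zero_lt_one (α := ℝ))] with t ht
  exact smul_mem_regularDomain hv ht.1 ht.2.le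

theorem contDiffAt_eigenLog_affine {v : Fin n → ℝ} (hv : v ∈ regularDomain μ) (α c : ℝ) :
    ContDiffAt ℝ 2 (fun v => α * eigenLog μ v + c * ∑ k, v k) v :=
  ((contDiffOn_eigenLog_affine _ _).contDiffAt ((isOpen_diag_preimage μ).mem_nhds hv.2)).of_le
    two_le_infty

theorem tendsto_partialD_affine_smul (α c : ℝ) {v : Fin n → ℝ} (hv : v ∈ regularDomain μ) {m : ℝ}
    {i : Fin n} (hm : Tendsto (fun t : ℝ => partialD i (eigenLog μ) (t • v)) (𝓝[>] 0) (𝓝 m)) :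
    Tendsto (fun t : ℝ => partialD i (fun v => α * eigenLog μ v + c * ∑ k, v k) (t • v))
      (𝓝[>] 0) (𝓝 (α * m + c)) := by
  refine ((hm.const_mul α).add_const c).congr' ?_
  filter_upwards [eventually_smul_mem_regularDomain hv] with t ht
  exact ((muirhead_affine (β := β) (contDiffAt_eigenLog (k := 2) ht.2) α c i).1).symm

theorem tendsto_partialD_exp_smul (α c : ℝ) {v : Fin n → ℝ} (hv : v ∈ regularDomain μ) {m : ℝ}
    {i : Fin n} (hm : Tendsto (fun t : ℝ => partialD i (eigenLog μ) (t • v)) (𝓝[>] 0) (𝓝 m)) :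
    Tendsto (fun t : ℝ => partialD i
      (fun v => Real.exp (α * eigenLog μ v + c * ∑ k, v k)) (t • v)) (𝓝[>] 0) (𝓝 (α * m + c)) := by
  have h1 : Tendsto (fun t : ℝ => Real.exp (α * eigenLog μ (t • v) + c * ∑ k, (t • v) k))
      (𝓝[>] 0) (𝓝 1) := by
    have h2 : Tendsto (fun t : ℝ => c * ∑ k, (t • v) k) (𝓝[>] 0) (𝓝 0) := by
      have h3 : Continuous fun t : ℝ => c * ∑ k, (t • v) k := by
        simp only [Pi.smul_apply]
        fun_prop
      have h4 := (h3.tendsto 0).mono_left (nhdsWithin_le_nhds (s := Set.Ioi 0))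
      simpa using h4
    have h5 := (((tendsto_eigenLog_smul hv).const_mul α).add h2).rexp
    simpa using h5
  have h6 := h1.mul (tendsto_partialD_affine_smul α c hv hm)
  rw [one_mul] at h6
  refine h6.congr' ?_
  filter_upwards [eventually_smul_mem_regularDomain hv] with t ht
  exact ((muirhead_exp (β := β) (contDiffAt_eigenLog_affine ht α c) i).1).symm

theorem isStandardized_of_systemI (hn : 1 ≤ n) (hμ : IsRotationInvariant μ)
    (hdom : (laplaceDomain μ).Nonempty) {a b : ℝ} (ha : a ≠ 0) {g : (Fin n → ℝ) → ℝ}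
    (hg : SystemI μ a b g) (hb : HasBoundaryLimits μ g 1 (-b)) : IsStandardized μ := by
  have hc := ((systemI_iff hμ ha b).1 hg).2
  have hL2 := hc.memLp_two hn hμ hdom
  refine hc.isStandardized hL2 hdom ?_
  exact integral_id_eq_zero_of_tendsto hn hμ hdom (hL2.integrable one_le_two)
    (systemI_rep hμ a b hg.1) (α := -4 * a) (by simpa using ha)
    (fun v hv m hm i => tendsto_partialD_exp_smul _ _ hv (hm i)) hb

theorem isStandardized_of_systemII (hn : 1 ≤ n) (hμ : IsRotationInvariant μ)
    (hdom : (laplaceDomain μ).Nonempty) {b : ℝ} (hb0 : b ≠ 0) {g : (Fin n → ℝ) → ℝ}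
    (hg : SystemII μ b g) (hb : HasBoundaryLimits μ g 0 (1 / (2 * b))) : IsStandardized μ := by
  have hc := ((systemII_iff hμ hb0).1 hg).2
  have hL2 := hc.memLp_two hn hμ hdom
  refine hc.isStandardized hL2 hdom ?_
  exact integral_id_eq_zero_of_tendsto hn hμ hdom (hL2.integrable one_le_two)
    (systemII_rep hμ b hg.1) (α := 1) one_ne_zero
    (fun v hv m hm i => tendsto_partialD_affine_smul _ _ hv (hm i)) hb

theorem isStandardized_of_systemIII (hn : 1 ≤ n) (hμ : IsRotationInvariant μ)
    (hdom : (laplaceDomain μ).Nonempty) {g : (Fin n → ℝ) → ℝ}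
    (hg : SystemIII μ g) (hb : HasBoundaryLimits μ g 0 0) : IsStandardized μ := by
  have hc := ((systemIII_iff hμ).1 hg).2
  have hL2 := hc.memLp_two hn hμ hdom
  refine hc.isStandardized hL2 hdom ?_
  exact integral_id_eq_zero_of_tendsto hn hμ hdom (hL2.integrable one_le_two)
    (systemIII_rep hμ hg.1) (α := 1) one_ne_zero
    (fun v hv m hm i => by simpa using hm i) hb

end RadialLimits

/-! ### Exponential moments of Meixner laws. -/

section ExponentialMoment

theorem hasDerivAt_integral_exp_mul {Ω : Type} [MeasurableSpace Ω] {μ : Measure Ω} {φ q : Ω → ℝ}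
    (hφ : Measurable φ) {M : ℝ} (hM : ∀ x, |φ x| ≤ M) (hq : Integrable q μ) (t : ℝ) :
    Integrable (fun x => Real.exp (t * φ x) * q x) μ ∧
    Integrable (fun x => Real.exp (t * φ x) * (φ x * q x)) μ ∧
    HasDerivAt (fun t => ∫ x, Real.exp (t * φ x) * q x ∂μ)
      (∫ x, Real.exp (t * φ x) * (φ x * q x) ∂μ) t := by
  have hb : ∀ s ∈ Metric.ball t 1, ∀ x, Real.exp (s * φ x) ≤ Real.exp ((|t| + 1) * M) := by
    intro s hs x
    have hM0 : 0 ≤ M := (abs_nonneg _).trans (hM x)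
    have h1 : |s| ≤ |t| + 1 := by
      have h2 : |s - t| < 1 := by simpa [Real.dist_eq] using hs
      have := abs_add_le (s - t) t
      rw [sub_add_cancel] at this
      linarith
    refine Real.exp_le_exp.2 ((le_abs_self _).trans ?_)
    rw [abs_mul]
    exact mul_le_mul h1 (hM x) (abs_nonneg _) (by positivity)
  have ht := Metric.mem_ball_self (x := t) (zero_lt_one (α := ℝ))
  have hqm := hq.aestronglyMeasurable
  have hm : ∀ s : ℝ, AEStronglyMeasurable (fun x => Real.exp (s * φ x) * q x) μ := fun s =>
    (by fun_prop : Measurable fun x => Real.exp (s * φ x)).aestronglyMeasurable.mul hqm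
  have hm' : AEStronglyMeasurable (fun x => Real.exp (t * φ x) * (φ x * q x)) μ :=
    (by fun_prop : Measurable fun x => Real.exp (t * φ x)).aestronglyMeasurable.mul
      (hφ.aestronglyMeasurable.mul hqm)
  have hint : Integrable (fun x => Real.exp (t * φ x) * q x) μ := by
    refine (hq.norm.const_mul (Real.exp ((|t| + 1) * M))).mono' (hm t)
      (Eventually.of_forall fun x => ?_)
    rw [norm_mul, Real.norm_eq_abs, Real.abs_exp]
    exact mul_le_mul_of_nonneg_right (hb t ht x) (norm_nonneg _)
  have h := hasDerivAt_integral_of_dominated_loc_of_deriv_le (μ := μ) (x₀ := t)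
    (F := fun t x => Real.exp (t * φ x) * q x) (F' := fun t x => Real.exp (t * φ x) * (φ x * q x))
    (bound := fun x => Real.exp ((|t| + 1) * M) * (M * ‖q x‖)) (Metric.ball_mem_nhds t zero_lt_one)
    (Eventually.of_forall hm) hint hm' (Eventually.of_forall fun x s hs => ?_)
    ((hq.norm.const_mul M).const_mul _) (Eventually.of_forall fun x s hs => ?_)
  · exact ⟨hint, h⟩
  · rw [norm_mul, norm_mul, Real.norm_eq_abs, Real.abs_exp, Real.norm_eq_abs (φ x)]
    exact mul_le_mul (hb s hs x) (mul_le_mul_of_nonneg_right (hM x) (norm_nonneg _))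
      (by positivity) (Real.exp_nonneg _)
  · have h1 : HasDerivAt (fun s : ℝ => Real.exp (s * φ x)) (Real.exp (s * φ x) * φ x) s := by
      simpa using ((hasDerivAt_id s).mul_const (φ x)).exp
    exact (h1.mul_const (q x)).congr_deriv (by ring)

/-- The reciprocal `1/w` decreases at rate at most `K`, so up to the time `1/(2K w₀)` at least half
of `1/w₀` is left. -/
theorem le_two_mul_of_deriv_le_sq {w w' : ℝ → ℝ} {K w₀ : ℝ} (hK : 0 < K) (hw₀ : 0 < w₀)
    (h0 : w 0 = w₀) (hpos : ∀ t ∈ Set.Icc (0 : ℝ) 1, 0 < w t)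
    (hd : ∀ t ∈ Set.Icc (0 : ℝ) 1, HasDerivAt w (w' t) t)
    (hle : ∀ t ∈ Set.Icc (0 : ℝ) 1, w' t ≤ K * w t ^ 2) :
    w (min 1 (1 / (2 * K * w₀))) ≤ 2 * w₀ := by
  set t₀ := min 1 (1 / (2 * K * w₀)) with ht₀
  have ht0 : t₀ ∈ Set.Icc (0 : ℝ) 1 := ⟨le_min zero_le_one (by positivity), min_le_left _ _⟩
  have hF : ∀ t ∈ Set.Icc (0 : ℝ) 1, HasDerivAt (fun t => (w t)⁻¹ + K * t)
      (-w' t / w t ^ 2 + K) t := fun t ht => by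
    simpa using ((hd t ht).fun_inv (hpos t ht).ne').fun_add ((hasDerivAt_id t).const_mul K)
  have hmono : MonotoneOn (fun t => (w t)⁻¹ + K * t) (Set.Icc 0 1) := by
    refine monotoneOn_of_deriv_nonneg (convex_Icc 0 1)
      (fun t ht => (hF t ht).continuousAt.continuousWithinAt) (fun t ht => ?_) fun t ht => ?_
    · exact (hF t (interior_subset ht)).differentiableAt.differentiableWithinAt
    · have ht' := interior_subset ht
      rw [(hF t ht').deriv, neg_div, le_neg_add_iff_add_le, add_zero,
        div_le_iff₀ (by have := hpos t ht'; positivity)]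
      exact hle t ht'
  have h1 := hmono (Set.left_mem_Icc.2 zero_le_one) ht0 ht0.1
  simp only [h0, mul_zero, add_zero] at h1
  have h2 : K * t₀ ≤ (2 * w₀)⁻¹ := by
    calc K * t₀ ≤ K * (1 / (2 * K * w₀)) := by gcongr; exact min_le_right _ _
      _ = _ := by field_simp
  have h3 : (2 * w₀)⁻¹ ≤ (w t₀)⁻¹ := by
    have : w₀⁻¹ = (2 * w₀)⁻¹ + (2 * w₀)⁻¹ := by field_simp; norm_num
    linarith
  exact (inv_le_inv₀ (by positivity) (hpos t₀ ht0)).1 h3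

/-- The truncated norm. -/
noncomputable def truncNorm (M : ℝ) (x : Herm β n) : ℝ := min ‖x‖ M

theorem continuous_truncNorm (M : ℝ) : Continuous (truncNorm M : Herm β n → ℝ) := by
  unfold truncNorm
  fun_prop

theorem truncNorm_nonneg {M : ℝ} (hM : 0 ≤ M) (x : Herm β n) : 0 ≤ truncNorm M x :=
  le_min (norm_nonneg _) hM

theorem abs_truncNorm_le {M : ℝ} (hM : 0 ≤ M) (x : Herm β n) : |truncNorm M x| ≤ M := by
  rw [abs_of_nonneg (truncNorm_nonneg hM x)]
  exact min_le_right _ _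

theorem truncNorm_add_le {M : ℝ} (hM : 0 ≤ M) (x y : Herm β n) :
    truncNorm M (x + y) ≤ truncNorm M x + truncNorm M y := by
  have h1 := norm_add_le x y
  have h2 := norm_nonneg x
  have h3 := norm_nonneg y
  unfold truncNorm
  rcases le_total ‖x‖ M with hx | hx <;> rcases le_total ‖y‖ M with hy | hy <;>
    simp only [min_eq_left hx, min_eq_right hx, min_eq_left hy, min_eq_right hy]
  · exact (min_le_left _ _).trans h1
  · exact (min_le_right _ _).trans (by linarith)
  · exact (min_le_right _ _).trans (by linarith)
  · exact (min_le_right _ _).trans (by linarith)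

theorem truncNorm_le_add {M : ℝ} (hM : 0 ≤ M) (x y : Herm β n) :
    truncNorm M x - ‖y‖ ≤ truncNorm M (x + y) := by
  have h1 := truncNorm_add_le hM (x + y) (-y)
  rw [add_neg_cancel_right] at h1
  have h2 : truncNorm M (-y) ≤ ‖y‖ := by
    rw [truncNorm, norm_neg]
    exact min_le_left _ _
  linarith

theorem integrable_bdd_mul_prod {ν : Measure (Herm β n × Herm β n)} {f : Herm β n → ℝ} (hf : Continuous f) {D : ℝ}
    (hD : ∀ x, |f x| ≤ D) {r : Herm β n × Herm β n → ℝ} (hr : Integrable r ν) :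
    Integrable (fun p : Herm β n × Herm β n => f (p.1 + p.2) * r p) ν :=
  hr.bdd_mul (c := D) (by fun_prop) (Eventually.of_forall fun p => hD _)

variable {μ : Measure (Herm β n)} [IsProbabilityMeasure μ]

/-- In the trace of the residual the pure squares can be separated from the rest, which is bounded
by a multiple of `(‖x‖ + 1)(‖y‖ + 1)`: one power of each norm instead of two. -/
theorem inner_one_residual {a : ℝ} (b : ℝ) (ha : 1 + 2 * a ≠ 0) (p : Herm β n × Herm β n) :
    (1 + 2 * a) * inner ℝ (1 : Herm β n)
      (residual (2 * a / (1 + 2 * a)) (2 * b / (1 + 2 * a)) (2 / (1 + 2 * a)) p) =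
    ‖p.1‖ ^ 2 + ‖p.2‖ ^ 2 - ((2 + 8 * a) * inner ℝ p.1 p.2 + 2 * b * tr (p.1 + p.2) + 2 * n) := by
  rw [inner_one_left, residual, sub_eq_add_neg, ← neg_one_smul ℝ]
  simp only [tr_add, tr_smul, tr_one, tr_sq]
  rw [norm_sub_sq_real, norm_add_sq_real]
  field_simp
  ring

theorem abs_tr_le (x : Herm β n) : |tr x| ≤ ‖(1 : Herm β n)‖ * ‖x‖ := by
  rw [← inner_one_left]
  exact abs_real_inner_le_norm _ _

theorem IsMeixnerWith.integral_norm_sq_eq {a b : ℝ} (ha : 1 + 2 * a ≠ 0) (h : IsMeixnerWith μ a b)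
    {f : Herm β n → ℝ} (hf : Continuous f) {D : ℝ} (hD : ∀ x, |f x| ≤ D) :
    Integrable (fun p : Herm β n × Herm β n => f (p.1 + p.2) *
      ((2 + 8 * a) * inner ℝ p.1 p.2 + 2 * b * tr (p.1 + p.2) + 2 * n)) (μ.prod μ) ∧
    ∫ p : Herm β n × Herm β n, f (p.1 + p.2) * (‖p.1‖ ^ 2 + ‖p.2‖ ^ 2) ∂(μ.prod μ) =
    ∫ p : Herm β n × Herm β n, f (p.1 + p.2) *
      ((2 + 8 * a) * inner ℝ p.1 p.2 + 2 * b * tr (p.1 + p.2) + 2 * n) ∂(μ.prod μ) := by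
  have hL2 : MemLp id 2 μ := h.2.1
  have hbs : ∀ {r : Herm β n × Herm β n → Herm β n}, Integrable r (μ.prod μ) →
      Integrable (fun p : Herm β n × Herm β n => f (p.1 + p.2) • r p) (μ.prod μ) := fun hr =>
    hr.bdd_smul D (φ := fun p : Herm β n × Herm β n => f (p.1 + p.2)) (by fun_prop)
      (Eventually.of_forall fun p => hD _)
  have hres : Integrable (residual (2 * a / (1 + 2 * a)) (2 * b / (1 + 2 * a)) (2 / (1 + 2 * a)))
      (μ.prod μ) := (integrable_sq_sub hL2).sub' (integrable_quadratic hL2 _ _ _)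
  have h1 := IsMeixner.integral_smul_residual h hf.measurable (hbs (integrable_sq_sub hL2))
    (hbs hres)
  have h2 := integral_inner (𝕜 := ℝ) (hbs hres) (1 : Herm β n)
  rw [h1, inner_zero_right] at h2
  have h3 : Integrable (fun p : Herm β n × Herm β n => ‖p.1‖ ^ 2 + ‖p.2‖ ^ 2) (μ.prod μ) :=
    ((memLp_fst hL2).integrable_norm_pow two_ne_zero).fun_add
      ((memLp_snd hL2).integrable_norm_pow two_ne_zero)
  have h4 : Integrable (fun p : Herm β n × Herm β n => (2 + 8 * a) * (inner ℝ p.1 p.2 : ℝ) +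
      2 * b * tr (p.1 + p.2) + 2 * n) (μ.prod μ) := by
    refine (h3.sub' ((hres.const_inner (𝕜 := ℝ) (1 : Herm β n)).const_mul (1 + 2 * a))).congr
      (Eventually.of_forall fun p => ?_)
    simp only [inner_one_residual b ha]
    ring
  refine ⟨integrable_bdd_mul_prod hf hD h4, ?_⟩
  rw [← sub_eq_zero, ← integral_sub (integrable_bdd_mul_prod hf hD h3)
    (integrable_bdd_mul_prod hf hD h4)]
  have h5 : ∀ p : Herm β n × Herm β n, f (p.1 + p.2) * (‖p.1‖ ^ 2 + ‖p.2‖ ^ 2) - f (p.1 + p.2) *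
      ((2 + 8 * a) * inner ℝ p.1 p.2 + 2 * b * tr (p.1 + p.2) + 2 * n) =
      (1 + 2 * a) * inner ℝ (1 : Herm β n) (f (p.1 + p.2) •
        residual (2 * a / (1 + 2 * a)) (2 * b / (1 + 2 * a)) (2 / (1 + 2 * a)) p) := by
    intro p
    rw [inner_smul_right, mul_left_comm, inner_one_residual b ha]
    ring
  simp_rw [h5]
  rw [integral_const_mul, h2, mul_zero]

/-- The regression identity is tested against `e = exp(tφ)`, with `φ` the truncated norm. Since `φ`
is subadditive, `e(x)exp(-‖y‖) ≤ e(x + y) ≤ e(x)e(y)`; the lower bound extracts the second moment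
with the factor `l = E exp(-‖X‖)`, the upper bound factors the other side into a square. The
constant does not depend on the truncation level. -/
theorem IsMeixnerWith.integral_exp_truncNorm_le {a b : ℝ} (ha : 1 + 2 * a ≠ 0)
    (h : IsMeixnerWith μ a b) : ∃ K > 0, ∀ M, 0 ≤ M → ∀ t ∈ Set.Icc (0 : ℝ) 1,
      ∫ x, Real.exp (t * truncNorm M x) * ‖x‖ ^ 2 ∂μ ≤
        K * (∫ x, Real.exp (t * truncNorm M x) * (‖x‖ + 1) ∂μ) ^ 2 := by
  have hL2 : MemLp id 2 μ := h.2.1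
  have hi1 : Integrable (fun x : Herm β n => ‖x‖ + 1) μ :=
    (hL2.integrable one_le_two).norm.fun_add (integrable_const 1)
  have hi2 : Integrable (fun x : Herm β n => ‖x‖ ^ 2) μ := hL2.integrable_norm_pow two_ne_zero
  have hl : Integrable (fun x : Herm β n => Real.exp (-‖x‖)) μ := by
    refine (integrable_const (1 : ℝ)).mono' (by fun_prop) (Eventually.of_forall fun x => ?_)
    rw [Real.norm_eq_abs, Real.abs_exp]
    exact Real.exp_le_one_iff.2 (neg_nonpos.2 (norm_nonneg _))
  have hlp := integral_exp_pos hl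
  set l := ∫ x : Herm β n, Real.exp (-‖x‖) ∂μ with hldef
  set K := |2 + 8 * a| + 2 * |b| * ‖(1 : Herm β n)‖ + 2 * n + 1 with hK
  have hK0 : 0 < K := by positivity
  refine ⟨K / l, by positivity, fun M hM t ht => ?_⟩
  set e : Herm β n → ℝ := fun x => Real.exp (t * truncNorm M x) with he
  have hec : Continuous e := by
    have := continuous_truncNorm (β := β) (n := n) M
    fun_prop
  have heD : ∀ x, |e x| ≤ Real.exp (t * M) := fun x => by
    rw [Real.abs_exp]
    exact Real.exp_le_exp.2 (mul_le_mul_of_nonneg_left (min_le_right _ _) ht.1)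
  have he0 : ∀ x, 0 < e x := fun x => Real.exp_pos _
  have hes : ∀ x y, e (x + y) ≤ e x * e y := fun x y => by
    simp only [he]
    rw [← Real.exp_add, ← mul_add]
    exact Real.exp_le_exp.2 (mul_le_mul_of_nonneg_left (truncNorm_add_le hM x y) ht.1)
  have hel : ∀ x y, e x * Real.exp (-‖y‖) ≤ e (x + y) := fun x y => by
    simp only [he]
    rw [← Real.exp_add]
    refine Real.exp_le_exp.2 ?_
    have h1 := mul_le_mul_of_nonneg_left (truncNorm_le_add hM x y) ht.1
    have h2 : t * ‖y‖ ≤ ‖y‖ := mul_le_of_le_one_left (norm_nonneg _) ht.2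
    linarith [mul_sub t (truncNorm M x) ‖y‖]
  have hie1 : Integrable (fun x => e x * (‖x‖ + 1)) μ :=
    hi1.bdd_mul (c := Real.exp (t * M)) hec.aestronglyMeasurable (Eventually.of_forall heD)
  have hie2 : Integrable (fun x => e x * ‖x‖ ^ 2) μ :=
    hi2.bdd_mul (c := Real.exp (t * M)) hec.aestronglyMeasurable (Eventually.of_forall heD)
  have hp1 : Integrable (fun p : Herm β n × Herm β n => ‖p.1‖ ^ 2) (μ.prod μ) :=
    (memLp_fst hL2).integrable_norm_pow two_ne_zero
  have hp2 : Integrable (fun p : Herm β n × Herm β n => ‖p.2‖ ^ 2) (μ.prod μ) :=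
    (memLp_snd hL2).integrable_norm_pow two_ne_zero
  have hA : (∫ x, e x * ‖x‖ ^ 2 ∂μ) * l ≤
      ∫ p : Herm β n × Herm β n, e (p.1 + p.2) * (‖p.1‖ ^ 2 + ‖p.2‖ ^ 2) ∂(μ.prod μ) := by
    rw [hldef, ← integral_prod_mul]
    refine integral_mono (hie2.mul_prod hl) (integrable_bdd_mul_prod hec heD (hp1.fun_add hp2))
      fun p => ?_
    have h1 := mul_le_mul_of_nonneg_right (hel p.1 p.2) (sq_nonneg ‖p.1‖)
    have h2 := mul_nonneg (he0 (p.1 + p.2)).le (sq_nonneg ‖p.2‖)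
    simp only
    linarith
  have hB : ∫ p : Herm β n × Herm β n, e (p.1 + p.2) *
      ((2 + 8 * a) * inner ℝ p.1 p.2 + 2 * b * tr (p.1 + p.2) + 2 * n) ∂(μ.prod μ) ≤
      K * (∫ x, e x * (‖x‖ + 1) ∂μ) ^ 2 := by
    rw [pow_two, ← integral_prod_mul, ← integral_const_mul]
    refine integral_mono (h.integral_norm_sq_eq ha hec heD).1
      ((hie1.mul_prod hie1).const_mul K) fun p => ?_
    obtain ⟨x, y⟩ := p
    simp only
    have hx := norm_nonneg x
    have hy := norm_nonneg y
    have hxy := mul_nonneg hx hy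
    have h1 : (2 + 8 * a) * (inner ℝ x y : ℝ) ≤ |2 + 8 * a| * ((‖x‖ + 1) * (‖y‖ + 1)) := by
      refine (le_abs_self _).trans ?_
      rw [abs_mul]
      refine mul_le_mul_of_nonneg_left ((abs_real_inner_le_norm x y).trans ?_) (abs_nonneg _)
      linarith
    have h2 : 2 * b * tr (x + y) ≤ 2 * |b| * ‖(1 : Herm β n)‖ * ((‖x‖ + 1) * (‖y‖ + 1)) := by
      refine (le_abs_self _).trans ?_
      rw [abs_mul, abs_mul, abs_two, mul_assoc (2 * |b|)]
      refine mul_le_mul_of_nonneg_left ((abs_tr_le _).trans ?_) (by positivity)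
      refine mul_le_mul_of_nonneg_left ((norm_add_le x y).trans ?_) (norm_nonneg _)
      linarith
    have h3 : 2 * (n : ℝ) ≤ 2 * n * ((‖x‖ + 1) * (‖y‖ + 1)) := by
      refine le_mul_of_one_le_right (by positivity) ?_
      linarith
    have h4 : (2 + 8 * a) * inner ℝ x y + 2 * b * tr (x + y) + 2 * n ≤
        K * ((‖x‖ + 1) * (‖y‖ + 1)) := by
      rw [hK, add_mul, add_mul, add_mul]
      linarith
    calc e (x + y) * ((2 + 8 * a) * inner ℝ x y + 2 * b * tr (x + y) + 2 * n)
        ≤ e (x + y) * (K * ((‖x‖ + 1) * (‖y‖ + 1))) := mul_le_mul_of_nonneg_left h4 (he0 _).le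
      _ ≤ (e x * e y) * (K * ((‖x‖ + 1) * (‖y‖ + 1))) :=
          mul_le_mul_of_nonneg_right (hes x y) (by positivity)
      _ = _ := by ring
  rw [(h.integral_norm_sq_eq ha hec heD).2] at hA
  rw [div_mul_eq_mul_div, le_div_iff₀ hlp]
  exact hA.trans hB

/-- For `w(t) = E exp(tφ)(‖X‖ + 1)` one gets `w' ≤ K w² + w ≤ (K + 1) w²`, because `w ≥ 1`. Hence
`w` at most doubles up to a time `t₀` independent of the truncation level, and Fatou's lemma removes
the truncation. -/
theorem IsMeixnerWith.exists_integrable_exp_norm {a b : ℝ} (ha : 1 + 2 * a ≠ 0)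
    (h : IsMeixnerWith μ a b) : ∃ t > 0, Integrable (fun x => Real.exp (t * ‖x‖)) μ := by
  have hL2 : MemLp id 2 μ := h.2.1
  have hi1 : Integrable (fun x : Herm β n => ‖x‖ + 1) μ :=
    (hL2.integrable one_le_two).norm.fun_add (integrable_const 1)
  have hi2 : Integrable (fun x : Herm β n => ‖x‖ ^ 2) μ := hL2.integrable_norm_pow two_ne_zero
  obtain ⟨K, hK0, hK⟩ := h.integral_exp_truncNorm_le ha
  set w₀ := ∫ x, (‖x‖ + 1) ∂μ with hw₀
  have hw1 : 1 ≤ w₀ := by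
    have h1 : ∫ _x : Herm β n, (1 : ℝ) ∂μ ≤ w₀ :=
      integral_mono (integrable_const 1) hi1 fun x => by
        have := norm_nonneg x
        simp only
        linarith
    simpa using h1
  set t₀ := min 1 (1 / (2 * (K + 1) * w₀)) with ht₀
  have ht0 : 0 < t₀ := lt_min zero_lt_one (by positivity)
  have hkey : ∀ M, 0 ≤ M → ∫ x, Real.exp (t₀ * truncNorm M x) ∂μ ≤ 2 * w₀ := by
    intro M hM
    have hφ := (continuous_truncNorm (β := β) (n := n) M).measurable
    have hd := fun t => hasDerivAt_integral_exp_mul (μ := μ) hφ (abs_truncNorm_le hM) hi1 t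
    have hone := fun t => (hasDerivAt_integral_exp_mul (μ := μ) hφ (abs_truncNorm_le hM)
      (integrable_const (1 : ℝ)) t).1
    simp only [mul_one] at hone
    have hge : ∀ t, ∫ x, Real.exp (t * truncNorm M x) ∂μ ≤
        ∫ x, Real.exp (t * truncNorm M x) * (‖x‖ + 1) ∂μ := fun t =>
      integral_mono (hone t) (hd t).1 fun x =>
        le_mul_of_one_le_right (Real.exp_nonneg _) (by linarith [norm_nonneg x])
    have hge1 : ∀ t ∈ Set.Icc (0 : ℝ) 1, 1 ≤
        ∫ x, Real.exp (t * truncNorm M x) * (‖x‖ + 1) ∂μ := by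
      intro t ht
      refine le_trans ?_ (hge t)
      have h1 : ∫ _x : Herm β n, (1 : ℝ) ∂μ ≤ ∫ x, Real.exp (t * truncNorm M x) ∂μ :=
        integral_mono (integrable_const 1) (hone t) fun x =>
          Real.one_le_exp (mul_nonneg ht.1 (truncNorm_nonneg hM x))
      simpa using h1
    refine (hge t₀).trans (le_two_mul_of_deriv_le_sq (K := K + 1) (by positivity)
      (lt_of_lt_of_le zero_lt_one hw1) (by simp [hw₀])
      (fun t ht => lt_of_lt_of_le zero_lt_one (hge1 t ht)) (fun t _ => (hd t).2.2)
      fun t ht => ?_)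
    have hi2e := (hasDerivAt_integral_exp_mul (μ := μ) hφ (abs_truncNorm_le hM) hi2 t).1
    have hsum : ∫ x, Real.exp (t * truncNorm M x) * (truncNorm M x * (‖x‖ + 1)) ∂μ ≤
        ∫ x, (Real.exp (t * truncNorm M x) * ‖x‖ ^ 2 +
          Real.exp (t * truncNorm M x) * (‖x‖ + 1)) ∂μ := by
      refine integral_mono (hd t).2.1 (hi2e.fun_add (hd t).1) fun x => ?_
      simp only
      rw [← mul_add]
      refine mul_le_mul_of_nonneg_left ?_ (Real.exp_nonneg _)
      have h1 : truncNorm M x * (‖x‖ + 1) ≤ ‖x‖ * (‖x‖ + 1) :=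
        mul_le_mul_of_nonneg_right (min_le_left _ _) (by positivity)
      linarith
    rw [integral_add hi2e (hd t).1] at hsum
    have h1 := hK M hM t ht
    have h2 := hge1 t ht
    nlinarith
  refine ⟨t₀, ht0, by fun_prop, ?_⟩
  set f : ℕ → Herm β n → ENNReal := fun k x =>
    ENNReal.ofReal (Real.exp (t₀ * truncNorm k x)) with hf
  have hfm : ∀ k, Measurable (f k) := fun k => by
    have := continuous_truncNorm (β := β) (n := n) k
    simp only [hf]
    fun_prop
  have h1 : ∀ k, ∫⁻ x, f k x ∂μ ≤ ENNReal.ofReal (2 * w₀) := by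
    intro k
    have hi := (hasDerivAt_integral_exp_mul (μ := μ)
      (continuous_truncNorm (β := β) (n := n) (k : ℝ)).measurable
      (abs_truncNorm_le (Nat.cast_nonneg k)) (integrable_const (1 : ℝ)) t₀).1
    simp only [mul_one] at hi
    rw [hf, ← ofReal_integral_eq_lintegral_ofReal hi (Eventually.of_forall fun x =>
      Real.exp_nonneg _)]
    exact ENNReal.ofReal_le_ofReal (hkey k (Nat.cast_nonneg k))
  have h2 : ∀ x : Herm β n, Tendsto (fun k => f k x) atTop
      (𝓝 (ENNReal.ofReal (Real.exp (t₀ * ‖x‖)))) := by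
    intro x
    obtain ⟨N, hN⟩ := exists_nat_ge ‖x‖
    refine tendsto_const_nhds.congr' ?_
    filter_upwards [eventually_ge_atTop N] with k hk
    have h3 : ‖x‖ ≤ k := hN.trans (by exact_mod_cast hk)
    simp only [hf, truncNorm, min_eq_left h3]
  have h5 : ∫⁻ x, ENNReal.ofReal (Real.exp (t₀ * ‖x‖)) ∂μ ≤ ENNReal.ofReal (2 * w₀) := by
    calc ∫⁻ x, ENNReal.ofReal (Real.exp (t₀ * ‖x‖)) ∂μ =
        ∫⁻ x, liminf (fun k => f k x) atTop ∂μ :=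
          lintegral_congr fun x => (h2 x).liminf_eq.symm
      _ ≤ liminf (fun k => ∫⁻ x, f k x ∂μ) atTop := lintegral_liminf_le hfm
      _ ≤ ENNReal.ofReal (2 * w₀) := by
          refine (liminf_le_liminf (Eventually.of_forall h1)).trans ?_
          rw [liminf_const]
  rw [hasFiniteIntegral_iff_ofReal (Eventually.of_forall fun x => Real.exp_nonneg _)]
  exact h5.trans_lt ENNReal.ofReal_lt_top

theorem IsMeixnerWith.zero_mem_laplaceDomain {a b : ℝ} (ha : 1 + 2 * a ≠ 0)
    (h : IsMeixnerWith μ a b) : (0 : Herm β n) ∈ laplaceDomain μ := by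
  obtain ⟨t, ht, hi⟩ := h.exists_integrable_exp_norm ha
  refine mem_interior_iff_mem_nhds.2 (mem_of_superset (Metric.ball_mem_nhds 0 ht) fun θ hθ => ?_)
  change Integrable _ _
  refine hi.mono' (continuous_exp_inner θ).aestronglyMeasurable (Eventually.of_forall fun x => ?_)
  rw [Real.norm_eq_abs, Real.abs_exp]
  refine Real.exp_le_exp.2 ((real_inner_le_norm θ x).trans ?_)
  exact mul_le_mul_of_nonneg_right (mem_ball_zero_iff.1 hθ).le (norm_nonneg _)

end ExponentialMoment

/-! ### Smooth dependence of integrals on parameters. -/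

section ParametricIntegral

variable {E : Type} [NormedAddCommGroup E] [NormedSpace ℝ E] [ProperSpace E]

theorem hasFDerivAt_setIntegral_param {F : Type} [NormedAddCommGroup F] [NormedSpace ℝ F]
    {W : Set (ℝ × E)} (hW : IsOpen W) {U : Set E} (hU : IsOpen U)
    (hWU : ∀ u ∈ Set.Icc (0 : ℝ) 1, ∀ v ∈ U, (u, v) ∈ W) {Φ : ℝ × E → F}
    (hΦ : ContDiffOn ℝ 1 Φ W) {v : E} (hv : v ∈ U) :
    HasFDerivAt (fun v => ∫ u in Set.Icc (0 : ℝ) 1, Φ (u, v))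
      (∫ u in Set.Icc (0 : ℝ) 1, (fderiv ℝ Φ (u, v)).comp (ContinuousLinearMap.inr ℝ ℝ E)) v := by
  obtain ⟨ε, hε, hball⟩ := Metric.nhds_basis_closedBall.mem_iff.1 (hU.mem_nhds hv)
  have hcomp : IsCompact (Set.Icc (0 : ℝ) 1 ×ˢ Metric.closedBall v ε) :=
    isCompact_Icc.prod (isCompact_closedBall v ε)
  have hsub : Set.Icc (0 : ℝ) 1 ×ˢ Metric.closedBall v ε ⊆ W := fun p hp =>
    hWU p.1 hp.1 p.2 (hball hp.2)
  have hfd : ContinuousOn (fun p => (fderiv ℝ Φ p).comp (ContinuousLinearMap.inr ℝ ℝ E)) W :=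
    (hΦ.continuousOn_fderiv_of_isOpen hW le_rfl).clm_comp continuousOn_const
  obtain ⟨C, hC⟩ := hcomp.exists_bound_of_continuousOn (hfd.mono hsub)
  have hcu : ∀ w ∈ U, ContinuousOn (fun u : ℝ => (u, w)) (Set.Icc 0 1) := fun w _ => by fun_prop
  have hm : ∀ w ∈ U, ContinuousOn (fun u : ℝ => Φ (u, w)) (Set.Icc 0 1) := fun w hw =>
    hΦ.continuousOn.comp (hcu w hw) fun u hu => hWU u hu w hw
  have hm' : ContinuousOn (fun u : ℝ => (fderiv ℝ Φ (u, v)).comp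
      (ContinuousLinearMap.inr ℝ ℝ E)) (Set.Icc 0 1) :=
    hfd.comp (hcu v hv) fun u hu => hWU u hu v hv
  refine hasFDerivAt_integral_of_dominated_of_fderiv_le (Metric.ball_mem_nhds v hε)
    (bound := fun _ => C) ?_ ?_ ?_ ?_ ?_ ?_ (F' := fun v u => (fderiv ℝ Φ (u, v)).comp
      (ContinuousLinearMap.inr ℝ ℝ E))
  · filter_upwards [hU.mem_nhds hv] with w hw
    exact (hm w hw).aestronglyMeasurable measurableSet_Icc
  · exact (hm v hv).integrableOn_compact isCompact_Icc
  · exact hm'.aestronglyMeasurable measurableSet_Icc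
  · filter_upwards [ae_restrict_mem measurableSet_Icc] with u hu w hw
    exact hC (u, w) ⟨hu, Metric.ball_subset_closedBall hw⟩
  · exact integrable_const _
  · filter_upwards [ae_restrict_mem measurableSet_Icc] with u hu w hw
    have hmem : (u, w) ∈ W := hsub ⟨hu, Metric.ball_subset_closedBall hw⟩
    have h1 : HasFDerivAt Φ (fderiv ℝ Φ (u, w)) (u, w) :=
      ((hΦ.contDiffAt (hW.mem_nhds hmem)).differentiableAt one_ne_zero).hasFDerivAt
    exact h1.comp w (hasFDerivAt_prodMk_right u w)

/-- One order of differentiability is given away so that every step can use the same differentiation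
lemma; for smooth integrands this costs nothing. The target space varies because derivatives are
linear maps. -/
theorem contDiffOn_setIntegral_param_nat (m : ℕ) : ∀ {F : Type} [NormedAddCommGroup F]
    [NormedSpace ℝ F] {W : Set (ℝ × E)} (_ : IsOpen W) {U : Set E} (_ : IsOpen U)
    (_ : ∀ u ∈ Set.Icc (0 : ℝ) 1, ∀ v ∈ U, (u, v) ∈ W) {Φ : ℝ × E → F},
    ContDiffOn ℝ (m + 1) Φ W →
      ContDiffOn ℝ m (fun v => ∫ u in Set.Icc (0 : ℝ) 1, Φ (u, v)) U := by
  induction m with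
  | zero =>
    intro F _ _ W hW U hU hWU Φ hΦ
    rw [Nat.cast_zero, contDiffOn_zero]
    rw [Nat.cast_zero, zero_add] at hΦ
    exact fun v hv =>
      (hasFDerivAt_setIntegral_param hW hU hWU hΦ hv).continuousAt.continuousWithinAt
  | succ m ih =>
    intro F _ _ W hW U hU hWU Φ hΦ
    have h1 : ContDiffOn ℝ 1 Φ W := hΦ.of_le (by simp)
    have h2 : ContDiffOn ℝ (m + 1)
        (fun p => (fderiv ℝ Φ p).comp (ContinuousLinearMap.inr ℝ ℝ E)) W := by
      refine ContDiffOn.clm_comp (hΦ.fderiv_of_isOpen hW ?_) contDiffOn_const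
      push_cast
      exact le_rfl
    rw [Nat.cast_add, Nat.cast_one, contDiffOn_succ_iff_fderiv_of_isOpen hU]
    refine ⟨fun v hv => (hasFDerivAt_setIntegral_param hW hU hWU h1
      hv).differentiableAt.differentiableWithinAt, by simp, (ih hW hU hWU h2).congr fun v hv =>
      (hasFDerivAt_setIntegral_param hW hU hWU h1 hv).fderiv⟩

theorem contDiffOn_setIntegral_param {F : Type} [NormedAddCommGroup F] [NormedSpace ℝ F]
    {W : Set (ℝ × E)} (hW : IsOpen W) {U : Set E} (hU : IsOpen U)
    (hWU : ∀ u ∈ Set.Icc (0 : ℝ) 1, ∀ v ∈ U, (u, v) ∈ W) {Φ : ℝ × E → F}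
    (hΦ : ContDiffOn ℝ ∞ Φ W) :
    ContDiffOn ℝ ∞ (fun v => ∫ u in Set.Icc (0 : ℝ) 1, Φ (u, v)) U :=
  contDiffOn_infty.2 fun m => contDiffOn_setIntegral_param_nat m hW hU hWU (by
    have h := contDiffOn_infty.1 hΦ (m + 1)
    rwa [Nat.cast_add, Nat.cast_one] at h)

end ParametricIntegral

/-! ### Division by differences of coordinates, and bounds for the coefficients. -/

section SwapQuotient

/-- The difference of a smooth function and its composition with a transposition is smoothly
divisible by the difference of the two coordinates. -/
theorem exists_swap_quotient {B : Set (Fin n → ℝ)} (hB : IsOpen B) (hconv : Convex ℝ B)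
    (hperm : ∀ v ∈ B, ∀ π : Equiv.Perm (Fin n), v ∘ π ∈ B) {K : (Fin n → ℝ) → ℝ}
    (hK : ContDiffOn ℝ ∞ K B) {i j : Fin n} (hij : i ≠ j) :
    ∃ Q, ContDiffOn ℝ ∞ Q B ∧
      ∀ v ∈ B, K v - K (v ∘ Equiv.swap i j) = (v i - v j) * Q v := by
  set d : Fin n → ℝ := Pi.single i 1 - Pi.single j 1 with hd
  have hdiff : ∀ v : Fin n → ℝ, v - v ∘ Equiv.swap i j = (v i - v j) • d := by
    intro v
    funext k
    by_cases hki : k = i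
    · subst hki; simp [hd, hij]
    by_cases hkj : k = j
    · subst hkj; simp [hd, hki]
    · simp [hd, hki, hkj, Equiv.swap_apply_of_ne_of_ne hki hkj]
  -- Hadamard's lemma: `A` runs along the segment from the swapped vector to `v`, whose direction is
  -- `(v i - v j) d`, and the quotient is the integral of the derivative of `K` in the direction
  -- `d`.
  set A : ℝ × (Fin n → ℝ) → (Fin n → ℝ) := fun p =>
    p.2 ∘ Equiv.swap i j + p.1 • (p.2 - p.2 ∘ Equiv.swap i j) with hA
  have hAs : ContDiff ℝ ∞ A := by
    have h1 : ContDiff ℝ ∞ fun p : ℝ × (Fin n → ℝ) => p.2 ∘ Equiv.swap i j :=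
      contDiff_pi.2 fun k => (contDiff_apply ℝ ℝ (Equiv.swap i j k)).comp contDiff_snd
    exact h1.add (contDiff_fst.smul (contDiff_snd.sub h1))
  have hAB : ∀ u ∈ Set.Icc (0 : ℝ) 1, ∀ v ∈ B, A (u, v) ∈ B := by
    intro u hu v hv
    exact hconv.add_smul_sub_mem (hperm v hv _) hv hu
  have hdK : ContDiffOn ℝ ∞ (fun v => fderiv ℝ K v d) B :=
    (hK.fderiv_of_isOpen hB (m := ∞) (by simp)).clm_apply contDiffOn_const
  refine ⟨fun v => ∫ u in Set.Icc (0 : ℝ) 1, fderiv ℝ K (A (u, v)) d,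
    contDiffOn_setIntegral_param (W := A ⁻¹' B) (hB.preimage hAs.continuous) hB hAB
      (hdK.comp hAs.contDiffOn fun _ h => h), fun v hv => ?_⟩
  have hder : ∀ u ∈ Set.uIcc (0 : ℝ) 1, HasDerivAt (fun u => K (A (u, v)))
      ((v i - v j) * fderiv ℝ K (A (u, v)) d) u := by
    intro u hu
    rw [Set.uIcc_of_le zero_le_one] at hu
    have h1 : HasDerivAt (fun u => A (u, v)) ((v i - v j) • d) u := by
      rw [← hdiff]
      have h := ((hasDerivAt_id u).smul_const (v - v ∘ Equiv.swap i j)).const_add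
        (v ∘ Equiv.swap i j)
      rw [one_smul] at h
      exact h
    have h2 := ((hK.contDiffAt (hB.mem_nhds (hAB u hu v hv))).differentiableAt
      (by simp)).hasFDerivAt
    have h3 := h2.comp_hasDerivAt u h1
    rwa [map_smul, smul_eq_mul] at h3
  have hcont : ContinuousOn (fun u => (v i - v j) * fderiv ℝ K (A (u, v)) d)
      (Set.uIcc (0 : ℝ) 1) := by
    rw [Set.uIcc_of_le zero_le_one]
    refine continuousOn_const.mul (hdK.continuousOn.comp ?_ fun u hu => hAB u hu v hv)
    exact (hAs.continuous.comp (by fun_prop)).continuousOn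
  have h4 := intervalIntegral.integral_eq_sub_of_hasDerivAt hder hcont.intervalIntegrable
  rw [intervalIntegral.integral_const_mul, intervalIntegral.integral_of_le zero_le_one,
    ← integral_Icc_eq_integral_Ioc] at h4
  rw [h4]
  simp [hA]

/-- The coefficients are symmetric, so swapping `a ∉ s` with `i ∈ s` only replaces the variable `v
a` by `v i` in the elementary symmetric functions. The difference is `v a - v i` times the same sum
with one variable fewer and degrees lowered by one, and `exists_swap_quotient` divides smoothly. -/
theorem exists_smooth_sum_esub {B : Set (Fin n → ℝ)} (hB : IsOpen B) (hconv : Convex ℝ B)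
    (hperm : ∀ v ∈ B, ∀ π : Equiv.Perm (Fin n), v ∘ π ∈ B) {c : ℕ → (Fin n → ℝ) → ℝ}
    (hc : ∀ r v, ∀ π : Equiv.Perm (Fin n), c r (v ∘ π) = c r v)
    (h : ∀ i, ∃ K, ContDiffOn ℝ ∞ K B ∧ ∀ v ∈ B, Function.Injective v → K v =
      ∑ r ∈ Finset.Icc 1 n, c r v * esub v (Finset.univ.erase i) ((r : ℤ) - 1))
    {S : Finset (Fin n)} (hS : S.Nonempty) :
    ∃ K, ContDiffOn ℝ ∞ K B ∧ ∀ v ∈ B, Function.Injective v → K v =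
      ∑ r ∈ Finset.Icc 1 n, c r v * esub v Sᶜ ((r : ℤ) - S.card) := by
  induction hS using Finset.Nonempty.cons_induction with
  | singleton i =>
    obtain ⟨K, hK, hKe⟩ := h i
    refine ⟨K, hK, fun v hv hinj => ?_⟩
    rw [hKe v hv hinj, Finset.card_singleton, Nat.cast_one]
    have : ({i} : Finset (Fin n))ᶜ = Finset.univ.erase i := by ext k; simp
    rw [this]
  | cons a s ha hs ih =>
    obtain ⟨K, hK, hKe⟩ := ih
    obtain ⟨i, hi⟩ := hs
    have hai : a ≠ i := fun h => ha (h ▸ hi)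
    obtain ⟨Q, hQ, hQe⟩ := exists_swap_quotient hB hconv hperm hK hai
    refine ⟨Q, hQ, fun v hv hinj => ?_⟩
    have h1 := hQe v hv
    rw [hKe v hv hinj, hKe _ (hperm v hv _) (hinj.comp (Equiv.injective _)),
      ← Finset.sum_sub_distrib] at h1
    refine mul_left_cancel₀ (sub_ne_zero.2 fun h => hai (hinj h)) (h1.symm.trans ?_)
    rw [Finset.mul_sum]
    refine Finset.sum_congr rfl fun r _ => ?_
    have hac : a ∈ sᶜ := Finset.mem_compl.2 ha
    have e1 : (sᶜ).map (Equiv.swap a i).toEmbedding = insert i (sᶜ.erase a) := by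
      ext k
      simp only [Finset.mem_map_equiv, Equiv.symm_swap, Finset.mem_compl, Finset.mem_insert,
        Finset.mem_erase]
      by_cases hki : k = i
      · subst hki; simp [ha]
      by_cases hka : k = a
      · subst hka; simp [hi, hai]
      · simp [hki, hka, Equiv.swap_apply_of_ne_of_ne hka hki]
    have e2 : (Finset.cons a s ha)ᶜ = sᶜ.erase a := by
      ext k
      simp
    have hni : i ∉ sᶜ.erase a := by simp [hi]
    rw [hc, esub_comp_perm, e1, e2, esub_insert v hni, esub_eq_erase v hac, Finset.card_cons]
    push_cast
    rw [sub_add_eq_sub_sub]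
    ring

theorem esub_zero_left (T : Finset (Fin n)) {m : ℕ} (hm : m ≠ 0) : esub 0 T m = 0 := by
  have h := esub_smul 0 (0 : Fin n → ℝ) T m
  rwa [zero_smul, zero_pow hm, zero_mul] at h

theorem continuous_esub (T : Finset (Fin n)) (m : ℤ) :
    Continuous fun v : Fin n → ℝ => esub v T m := (differentiable_esub T m).continuous

/-- Coefficients of the elementary symmetric functions are bounded near the origin. -/
theorem isBigO_coefficients {B : Set (Fin n → ℝ)} (hB : IsOpen B) (h0 : 0 ∈ B)
    {c : ℕ → (Fin n → ℝ) → ℝ}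
    (h : ∀ S : Finset (Fin n), S.Nonempty → ∃ K, ContDiffOn ℝ ∞ K B ∧ ∀ v ∈ B,
      Function.Injective v → K v = ∑ r ∈ Finset.Icc 1 n, c r v * esub v Sᶜ ((r : ℤ) - S.card))
    {R : Set (Fin n → ℝ)} (hR : R ⊆ {v ∈ B | Function.Injective v}) :
    ∀ k r : ℕ, 1 ≤ r → r + k = n → c r =O[𝓝[R] 0] fun _ => (1 : ℝ) := by
  intro k
  induction k using Nat.strong_induction_on with
  | _ k ih =>
    intro r hr hk
    -- With `|S| = r` the degrees are `q - r`: terms with `q < r` vanish, `c r` has coefficient `1`,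
    -- and the terms with `q > r` are bounded by the induction, which descends from `r = n`.
    obtain ⟨S, -, hS⟩ := Finset.exists_subset_card_eq (s := (Finset.univ : Finset (Fin n)))
      (n := r) (by rw [Finset.card_univ, Fintype.card_fin]; omega)
    obtain ⟨K, hK, hKe⟩ := h S (Finset.card_pos.1 (by omega))
    have hKO : K =O[𝓝[R] 0] fun _ => (1 : ℝ) :=
      (((hK.continuousOn.continuousAt (hB.mem_nhds h0)).tendsto).mono_left
        nhdsWithin_le_nhds).isBigO_one ℝ
    have hsum : (fun v => ∑ q ∈ Finset.Ioc r n, c q v * esub v Sᶜ ((q : ℤ) - r)) =O[𝓝[R] 0]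
        fun _ => (1 : ℝ) := by
      refine Asymptotics.IsBigO.fun_sum fun q hq => ?_
      rw [Finset.mem_Ioc] at hq
      have h1 := ih (n - q) (by omega) q (by omega) (by omega)
      have h2 : (fun v : Fin n → ℝ => esub v Sᶜ ((q : ℤ) - r)) =O[𝓝[R] 0] fun _ => (1 : ℝ) :=
        (((continuous_esub _ _).tendsto 0).mono_left nhdsWithin_le_nhds).isBigO_one ℝ
      simpa using h1.mul h2
    refine (hKO.sub hsum).congr' ?_ EventuallyEq.rfl
    filter_upwards [self_mem_nhdsWithin] with v hv
    rw [hKe v (hR hv).1 (hR hv).2, hS, sub_eq_iff_eq_add]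
    have h3 : Finset.Icc 1 n = Finset.Ico 1 r ∪ ({r} ∪ Finset.Ioc r n) := by
      ext q
      simp only [Finset.mem_Icc, Finset.mem_union, Finset.mem_Ico, Finset.mem_singleton,
        Finset.mem_Ioc]
      omega
    rw [h3, Finset.sum_union, Finset.sum_union, Finset.sum_singleton, sub_self, esub_zero, mul_one,
      Finset.sum_eq_zero, zero_add]
    · intro q hq
      rw [Finset.mem_Ico] at hq
      rw [esub_neg v _ (by omega), mul_zero]
    · simp
    · rw [Finset.disjoint_left]
      intro q
      simp only [Finset.mem_Ico, Finset.mem_union, Finset.mem_singleton, Finset.mem_Ioc]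
      omega

/-- Each term with `r > 1` is a bounded coefficient times a function vanishing at the origin, so `K`
and `c 1` have the same limit. -/
theorem tendsto_coefficient_one (hn : 1 ≤ n) {R : Set (Fin n → ℝ)} {c : ℕ → (Fin n → ℝ) → ℝ}
    (hc : ∀ r ∈ Finset.Icc 1 n, c r =O[𝓝[R] 0] fun _ => (1 : ℝ)) {K : (Fin n → ℝ) → ℝ} {γ : ℝ}
    (hK : Tendsto K (𝓝[R] 0) (𝓝 γ)) (i : Fin n) (h : ∀ v ∈ R, K v =
      ∑ r ∈ Finset.Icc 1 n, c r v * esub v (Finset.univ.erase i) ((r : ℤ) - 1)) :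
    Tendsto (c 1) (𝓝[R] 0) (𝓝 γ) := by
  have hsum : Tendsto (fun v => ∑ q ∈ Finset.Ioc 1 n,
      c q v * esub v (Finset.univ.erase i) ((q : ℤ) - 1)) (𝓝[R] 0) (𝓝 0) := by
    suffices hq0 : ∀ q ∈ Finset.Ioc 1 n, Tendsto
        (fun v => c q v * esub v (Finset.univ.erase i) ((q : ℤ) - 1)) (𝓝[R] 0) (𝓝 0) by
      simpa using tendsto_finsetSum (Finset.Ioc 1 n) hq0
    intro q hq
    rw [Finset.mem_Ioc] at hq
    have h1 := hc q (Finset.mem_Icc.2 ⟨hq.1.le, hq.2⟩)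
    have h2 : Tendsto (fun v : Fin n → ℝ => esub v (Finset.univ.erase i) ((q : ℤ) - 1))
        (𝓝[R] 0) (𝓝 0) := by
      have h3 := ((continuous_esub (Finset.univ.erase i) ((q : ℤ) - 1)).tendsto 0).mono_left
        (nhdsWithin_le_nhds (s := R))
      have h4 : ((q : ℤ) - 1) = ((q - 1 : ℕ) : ℤ) := by omega
      rwa [h4, esub_zero_left _ (by omega), ← h4] at h3
    have h5 := h1.mul_isLittleO ((Asymptotics.isLittleO_one_iff ℝ).2 h2)
    simp only [mul_one] at h5
    exact (Asymptotics.isLittleO_one_iff ℝ).1 h5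
  have h6 := hK.sub hsum
  rw [sub_zero] at h6
  refine h6.congr' ?_
  filter_upwards [self_mem_nhdsWithin] with v hv
  rw [h v hv, ← Finset.add_sum_Ioc_eq_sum_Icc hn]
  simp [esub_zero]

end SwapQuotient

/-! ### The full limits at the origin in the direct part. -/

section BoundaryLimits

variable {μ : Measure (Herm β n)}

/-- `∑ vₖ² = σ₁² - 2σ₂`, so a point of the domain with small `σ` comes from a small vector of
eigenvalues. -/
theorem tendsto_sigmaDomain_of_comp {X : Type} {f : (Fin n → ℝ) → X} {l : Filter X}
    (h : Tendsto (fun v => f (elemSymm v)) (𝓝[regularDomain μ] 0) l) :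
    Tendsto f (𝓝[sigmaDomain μ] 0) l := by
  intro P hP
  obtain ⟨ε, hε, hball⟩ := Metric.mem_nhdsWithin_iff.1 (h hP)
  set q : (Fin n → ℝ) → ℝ := fun s => coord s 1 ^ 2 - 2 * coord s 2 with hq
  have hcoord : ∀ m : ℤ, Continuous fun s : Fin n → ℝ => coord s m := by
    intro m
    unfold coord
    split_ifs
    · fun_prop
    · refine continuous_finsetSum _ fun i _ => ?_
      split_ifs <;> fun_prop
  have hqc : Continuous q := ((hcoord 1).pow 2).sub ((hcoord 2).const_mul 2)
  have hq0 : q 0 = 0 := by simp [hq, coord]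
  have hev : ∀ᶠ s in 𝓝[sigmaDomain μ] 0, q s < ε ^ 2 :=
    nhdsWithin_le_nhds (hqc.continuousAt.eventually_lt continuousAt_const (by rw [hq0]; positivity))
  rw [mem_map]
  filter_upwards [hev, self_mem_nhdsWithin] with s hs hmem
  obtain ⟨v, hv, rfl⟩ := hmem
  refine hball ⟨?_, hv⟩
  rw [mem_ball_zero_iff, pi_norm_lt_iff hε]
  intro i
  have h1 : q (elemSymm v) = ∑ k, v k ^ 2 := by
    rw [hq, sum_sq_eq_esub]
    simp only [coord_elemSymm]
  rw [h1] at hs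
  have h2 := Finset.single_le_sum (f := fun k => v k ^ 2) (fun k _ => sq_nonneg _)
    (Finset.mem_univ i)
  rw [Real.norm_eq_abs]
  exact abs_lt_of_sq_lt_sq (lt_of_le_of_lt h2 hs) hε.le

theorem convex_diag_preimage (μ : Measure (Herm β n)) :
    Convex ℝ {v : Fin n → ℝ | (diag v : Herm β n) ∈ laplaceDomain μ} :=
  (convex_laplaceDomain μ).linear_preimage (diagL : (Fin n → ℝ) →L[ℝ] Herm β n).toLinearMap

/-- The Jacobian degenerates at the origin, so `g₁` cannot be controlled by inverting it. Instead,
`G` is smooth also where eigenvalues coincide, and the `g_r`, being symmetric coefficients of `∂ᵢG`,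
are bounded by iterated division; then only `g₁` contributes to the limit of `∂ᵢG`. -/
theorem EigenRep.tendsto {G g : (Fin n → ℝ) → ℝ} (hn : 1 ≤ n) (hμ : IsRotationInvariant μ)
    (h : EigenRep μ G g)
    (hG : ContDiffOn ℝ ∞ G {v : Fin n → ℝ | (diag v : Herm β n) ∈ laplaceDomain μ})
    (h0 : (0 : Herm β n) ∈ laplaceDomain μ) (i : Fin n) :
    HasBoundaryLimits μ g (G 0) (partialD i G 0) := by
  set V := {v : Fin n → ℝ | (diag v : Herm β n) ∈ laplaceDomain μ} with hV
  have hVo : IsOpen V := isOpen_diag_preimage μ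
  have hV0 : (0 : Fin n → ℝ) ∈ V := by
    change (diag 0 : Herm β n) ∈ laplaceDomain μ
    rwa [← diagL_apply, map_zero]
  have hVp : ∀ v ∈ V, ∀ π : Equiv.Perm (Fin n), v ∘ π ∈ V := by
    intro v hv π
    obtain ⟨U, hU, hc⟩ := exists_conj_diag_perm (β := β) π
    change diag (v ∘ π) ∈ laplaceDomain μ
    rw [← hc]
    exact conj_mem_laplaceDomain hμ hU hv
  have hd : ∀ i, ContDiffOn ℝ ∞ (partialD i G) V := fun i =>
    (hG.fderiv_of_isOpen hVo (m := ∞) (by simp)).clm_apply contDiffOn_const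
  have hde : ∀ i, ∀ v ∈ V, Function.Injective v → partialD i G v = ∑ r ∈ Finset.Icc 1 n,
      pderiv r g (elemSymm v) * esub v (Finset.univ.erase i) ((r : ℤ) - 1) := fun i v hv hinj =>
    h.partialD_eq ⟨hinj, hv⟩ i
  have hO := isBigO_coefficients hVo hV0 (c := fun r v => pderiv r g (elemSymm v))
    (R := regularDomain μ) (fun S hS => exists_smooth_sum_esub hVo (convex_diag_preimage μ) hVp
      (c := fun r v => pderiv r g (elemSymm v))
      (fun r v π => by simp only [elemSymm_comp_perm]) (fun i => ⟨_, hd i, hde i⟩) hS)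
    (fun v hv => ⟨hv.2, hv.1⟩)
  constructor
  · refine tendsto_sigmaDomain_of_comp ?_
    have h1 := ((hG.continuousOn.continuousAt (hVo.mem_nhds hV0)).tendsto).mono_left
      (nhdsWithin_le_nhds (s := regularDomain μ))
    refine h1.congr' ?_
    filter_upwards [self_mem_nhdsWithin] with v hv
    exact (h.eq v hv).symm
  · refine tendsto_sigmaDomain_of_comp ?_
    refine tendsto_coefficient_one hn (c := fun r v => pderiv r g (elemSymm v)) (K := partialD i G)
      (fun r hr => ?_) ?_ i fun v hv => hde i v hv.2 hv.1
    · rw [Finset.mem_Icc] at hr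
      exact hO (n - r) r hr.1 (by omega)
    · exact (((hd i).continuousOn.continuousAt (hVo.mem_nhds hV0)).tendsto).mono_left
        nhdsWithin_le_nhds

variable [IsProbabilityMeasure μ]

theorem eigenLog_zero : eigenLog μ (0 : Fin n → ℝ) = 0 := by
  have h : (diag 0 : Herm β n) = 0 := by rw [← diagL_apply, map_zero]
  rw [eigenLog, h, logLaplace, laplace]
  simp

theorem partialD_eigenLog_zero (h0 : (0 : Herm β n) ∈ laplaceDomain μ)
    (hmean : ∫ x, x ∂μ = 0) (i : Fin n) : partialD i (eigenLog μ) 0 = 0 := by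
  have h : (diag 0 : Herm β n) = 0 := by rw [← diagL_apply, map_zero]
  have h0' : (diag 0 : Herm β n) ∈ laplaceDomain μ := by rwa [h]
  rw [partialD_eigenLog h0', gradient_logLaplace h0', h, tilt, expInt]
  simp [hmean]

theorem exists_systemI (hn : 1 ≤ n) (hμ : IsRotationInvariant μ)
    (h0 : (0 : Herm β n) ∈ laplaceDomain μ) (hmean : ∫ x, x ∂μ = 0) {a b : ℝ} (ha : a ≠ 0)
    (h : SatisfiesCumulantEquation μ a b) : ∃ g : (Fin n → ℝ) → ℝ,
      ContDiffOn ℝ 2 g (sigmaDomain μ) ∧ SystemI μ a b g ∧ HasBoundaryLimits μ g 1 (-b) := by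
  obtain ⟨g, hg⟩ := exists_represents hμ
    (f := fun θ => Real.exp (-4 * a * logLaplace μ θ - b * tr θ))
    fun U hU θ => by simp only [logLaplace_conj hμ hU, tr_conj hU]
  have hr := systemI_rep hμ a b hg
  refine ⟨g, hr.contDiffOn, (systemI_iff hμ ha b).2 ⟨hg, h⟩, ?_⟩
  have h1 := hr.tendsto hn hμ (contDiffOn_eigenLog_affine _ _).exp h0 ⟨0, hn⟩
  have h0' : (diag 0 : Herm β n) ∈ laplaceDomain μ := by rwa [← diagL_apply, map_zero]
  have hf := contDiffAt_eigenLog (k := 2) h0'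
  have hfa : ContDiffAt ℝ 2 (fun v => -4 * a * eigenLog μ v + -b * ∑ k, v k) 0 :=
    ((contDiffOn_eigenLog_affine _ _).contDiffAt ((isOpen_diag_preimage μ).mem_nhds h0')).of_le
      two_le_infty
  rw [(muirhead_exp (β := β) hfa _).1, (muirhead_affine (β := β) hf _ _ _).1,
    partialD_eigenLog_zero h0 hmean] at h1
  simpa [eigenLog_zero] using h1

theorem exists_systemII (hn : 1 ≤ n) (hμ : IsRotationInvariant μ)
    (h0 : (0 : Herm β n) ∈ laplaceDomain μ) (hmean : ∫ x, x ∂μ = 0) {b : ℝ} (hb : b ≠ 0)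
    (h : SatisfiesCumulantEquation μ 0 b) : ∃ g : (Fin n → ℝ) → ℝ,
      ContDiffOn ℝ 2 g (sigmaDomain μ) ∧ SystemII μ b g ∧
        HasBoundaryLimits μ g 0 (1 / (2 * b)) := by
  obtain ⟨g, hg⟩ := exists_represents hμ (f := fun θ => logLaplace μ θ + 1 / (2 * b) * tr θ)
    fun U hU θ => by simp only [logLaplace_conj hμ hU, tr_conj hU]
  have hr := systemII_rep hμ b hg
  refine ⟨g, hr.contDiffOn, (systemII_iff hμ hb).2 ⟨hg, h⟩, ?_⟩
  have h1 := hr.tendsto hn hμ (contDiffOn_eigenLog_affine _ _) h0 ⟨0, hn⟩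
  have h0' : (diag 0 : Herm β n) ∈ laplaceDomain μ := by rwa [← diagL_apply, map_zero]
  have hf := contDiffAt_eigenLog (k := 2) h0'
  rw [(muirhead_affine (β := β) hf _ _ _).1, partialD_eigenLog_zero h0 hmean] at h1
  simpa [eigenLog_zero] using h1

theorem exists_systemIII (hn : 1 ≤ n) (hμ : IsRotationInvariant μ)
    (h0 : (0 : Herm β n) ∈ laplaceDomain μ) (hmean : ∫ x, x ∂μ = 0)
    (h : SatisfiesCumulantEquation μ 0 0) : ∃ g : (Fin n → ℝ) → ℝ,
      ContDiffOn ℝ 2 g (sigmaDomain μ) ∧ SystemIII μ g ∧ HasBoundaryLimits μ g 0 0 := by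
  obtain ⟨g, hg⟩ := exists_represents hμ (f := logLaplace μ) fun U hU θ => logLaplace_conj hμ hU θ
  have hr := systemIII_rep hμ hg
  refine ⟨g, hr.contDiffOn, (systemIII_iff hμ).2 ⟨hg, h⟩, ?_⟩
  have h1 := hr.tendsto hn hμ contDiffOn_eigenLog h0 ⟨0, hn⟩
  rwa [partialD_eigenLog_zero h0 hmean, eigenLog_zero] at h1

end BoundaryLimits

end MeixnerEnsemble

theorem theorem4p1 (β : Peirce) (n : ℕ) (hn : 1 ≤ n) (μ : Measure (Herm β n))
    [IsProbabilityMeasure μ] (hrot : IsRotationInvariant μ) (hdom : (laplaceDomain μ).Nonempty) :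
    (IsOpen (sigmaDomain μ) ∧ (0 : Fin n → ℝ) ∈ closure (sigmaDomain μ)) ∧
    -- direct part
    (∀ a b : ℝ, 1 + 2 * a ≠ 0 → IsStandardized μ → IsMeixnerWith μ a b →
      (a ≠ 0 → ∃ g : (Fin n → ℝ) → ℝ, ContDiffOn ℝ 2 g (sigmaDomain μ) ∧
        SystemI μ a b g ∧ HasBoundaryLimits μ g 1 (-b)) ∧
      (a = 0 → b ≠ 0 → ∃ g : (Fin n → ℝ) → ℝ, ContDiffOn ℝ 2 g (sigmaDomain μ) ∧
        SystemII μ b g ∧ HasBoundaryLimits μ g 0 (1 / (2 * b))) ∧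
      (a = 0 → b = 0 → ∃ g : (Fin n → ℝ) → ℝ, ContDiffOn ℝ 2 g (sigmaDomain μ) ∧
        SystemIII μ g ∧ HasBoundaryLimits μ g 0 0)) ∧
    -- converse part: the systems alone give the equation for `k` and the Meixner property,
    -- and together with the boundary limits they give the standardization
    (∀ (a b : ℝ) (g : (Fin n → ℝ) → ℝ),
      ((a ≠ 0 ∧ SystemI μ a b g) ∨ (a = 0 ∧ b ≠ 0 ∧ SystemII μ b g) ∨
        (a = 0 ∧ b = 0 ∧ SystemIII μ g)) →
      SatisfiesCumulantEquation μ a b ∧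
      (1 + 2 * a ≠ 0 → IsMeixnerWith μ a b) ∧
      ((a ≠ 0 ∧ HasBoundaryLimits μ g 1 (-b)) ∨
        (a = 0 ∧ b ≠ 0 ∧ HasBoundaryLimits μ g 0 (1 / (2 * b))) ∨
        (a = 0 ∧ b = 0 ∧ HasBoundaryLimits μ g 0 0) → IsStandardized μ)) := by
  refine ⟨⟨isOpen_sigmaDomain μ, zero_mem_closure_sigmaDomain hrot hdom⟩, ?_, ?_⟩
  · rintro a b ha ⟨hL2, hmean, hsq⟩ hm
    have h0 := hm.zero_mem_laplaceDomain ha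
    have hc := hm.satisfiesCumulantEquation ha
    refine ⟨fun ha0 => exists_systemI hn hrot h0 hmean ha0 hc, ?_, ?_⟩
    · rintro rfl hb
      exact exists_systemII hn hrot h0 hmean hb hc
    · rintro rfl rfl
      exact exists_systemIII hn hrot h0 hmean hc
  · intro a b g hg
    have hc : SatisfiesCumulantEquation μ a b := by
      rcases hg with ⟨ha, hg⟩ | ⟨rfl, hb, hg⟩ | ⟨rfl, rfl, hg⟩
      · exact ((systemI_iff hrot ha b).1 hg).2
      · exact ((systemII_iff hrot hb).1 hg).2
      · exact ((systemIII_iff hrot).1 hg).2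
    refine ⟨hc, fun ha => hc.isMeixnerWith hrot hdom (hc.memLp_two hn hrot hdom) ha,
      fun hlim => ?_⟩
    rcases hg with ⟨ha, hg⟩ | ⟨rfl, hb, hg⟩ | ⟨rfl, rfl, hg⟩
    · rcases hlim with ⟨-, hl⟩ | ⟨ha', -⟩ | ⟨ha', -⟩
      · exact isStandardized_of_systemI hn hrot hdom ha hg hl
      · exact absurd ha' ha
      · exact absurd ha' ha
    · rcases hlim with ⟨ha', -⟩ | ⟨-, -, hl⟩ | ⟨-, hb', -⟩
      · exact absurd rfl ha'
      · exact isStandardized_of_systemII hn hrot hdom hb hg hl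
      · exact absurd hb' hb
    · rcases hlim with ⟨ha', -⟩ | ⟨-, hb', -⟩ | ⟨-, -, hl⟩
      · exact absurd rfl ha'
      · exact absurd rfl hb'
      · exact isStandardized_of_systemIII hn hrot hdom hg hl
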